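/- All point sets are finite subsets of the Euclidean plane. A set is in general position if no three of its points are collinear. For an $n$-point set $P$ in general position and an integer $0\le k\le n/2-1$, a $k$-edge of $P$ is a line through two points of $P$ that leaves exactly $k$ points of $P$ on one side. Let $E_k(P)$ be the number of $k$-edges of $P$, let $E_{\le k}(P)=\sum_{j=0}^{k}E_j(P)$, and let $E_{\le k}(n)$ be the minimum of $E_{\le k}(P)$ over all $n$-point sets $P$ in general position. For $n$ a multiple of $9$ and $0\le k\le 4n/9-1$ put \[ L(n,k)=\begin{cases} 3\binom{k+2}{2} & \text{if } 0\le k\le n/3-1,\\[2pt] 3\binom{k+2}{2}+3\binom{k-n/3+2}{2} & \text{if } n/3\le k\le 4n/9-2,\\[2pt] 3\binom{(4n/9-1)+2}{2}+3\binom{(4n/9-1)-n/3+2}{2}+3 & \text{if } k=4n/9-1. \end{cases} \] Let $r\ge 3$ be an integer and $n=9r$. Then there is an $n$-point set $S_r$ in general position such that $E_{\le k}(S_r)=L(n,k)$ simultaneously for all integers $0\le k\le 4n/9-1$. Moreover, the lower bound $E_{\le k}(n)\ge L(n,k)$ is valid and tight in this range: $E_{\le k}(n)=L(n,k)$ for all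 integers $0\le k\le 4n/9-1$. -/

import Mathlib

/-- The Euclidean plane. -/
abbrev Plane : Type := EuclideanSpace ℝ (Fin 2)

/-- A finite planar point set is in general position if no three of its points are collinear. -/
def GeneralPosition (P : Finset Plane) : Prop :=
  ∀ p ∈ P, ∀ q ∈ P, ∀ r ∈ P, p ≠ q → p ≠ r → q ≠ r →
    ¬ Collinear ℝ ({p, q, r} : Set Plane)

/-- Twice the signed area of the triangle `p q x`. It is positive exactly when `x` lies strictly to
the left of the line through `p` and `q` directed from `p` to `q`. -/
def orient (p q x : Plane) : ℝ :=
  (q 0 - p 0) * (x 1 - p 1) - (q 1 - p 1) * (x 0 - p 0)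

/-- The number of points of `P` strictly to the left of the line directed from `p` to `q`. -/
noncomputable def leftCount (P : Finset Plane) (p q : Plane) : ℕ :=
  {x ∈ P | 0 < orient p q x}.card

/-- A line `L` is a `k`-edge of `P` if it passes through two points of `P` and leaves exactly `k`
points of `P` on one side. The two points may be taken in either order, so the side to the left of
the line directed from `p` to `q` can be either of the two sides of `L`. -/
def IsKEdge (P : Finset Plane) (k : ℕ) (L : AffineSubspace ℝ Plane) : Prop :=
  ∃ p ∈ P, ∃ q ∈ P, p ≠ q ∧ L = line[ℝ, p, q] ∧ leftCount P p q = k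

/-- The number `E_k(P)` of `k`-edges of `P`, for `k ≤ n / 2 - 1` where `n` is the size of `P`. -/
noncomputable def kEdgeCount (P : Finset Plane) (k : ℕ) : ℕ :=
  {L : AffineSubspace ℝ Plane | IsKEdge P k L}.ncard

/-- The number `E_{≤ k}(P) = E_0(P) + ⋯ + E_k(P)` of `(≤ k)`-edges of `P`, for `k ≤ n / 2 - 1`
where `n` is the size of `P`. -/
noncomputable def leKEdgeCount (P : Finset Plane) (k : ℕ) : ℕ :=
  ∑ j ∈ Finset.range (k + 1), kEdgeCount P j

/-- `E_{≤ k}(n)`: the minimum of `E_{≤ k}(P)` over all `n`-point sets `P` in general position. -/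
noncomputable def minLeKEdgeCount (n k : ℕ) : ℕ :=
  sInf {e : ℕ | ∃ P : Finset Plane, P.card = n ∧ GeneralPosition P ∧ leKEdgeCount P k = e}

/-- The lower bound for `E_{≤ k}(n)`, for `n` a positive multiple of `9` and `k ≤ 4n/9 - 1`. The
three cases are `0 ≤ k ≤ n/3 - 1`, `n/3 ≤ k ≤ 4n/9 - 2` and `k = 4n/9 - 1`. -/
def leKEdgeBound (n k : ℕ) : ℕ :=
  if k + 1 ≤ n / 3 then
    3 * (k + 2).choose 2
  else if k + 2 ≤ 4 * n / 9 then
    3 * (k + 2).choose 2 + 3 * (k + 2 - n / 3).choose 2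
  else
    3 * (4 * n / 9 + 1).choose 2 + 3 * (4 * n / 9 + 1 - n / 3).choose 2 + 3

/-! For `2k + 2 < n` a `k`-edge has exactly one orientation with `k` points on its left. So
`E_{≤k}(P)` counts the ordered pairs with fewer than `K = k + 1` points on the left
(`leKEdgeCount_eq`), and everything is about `pairsLT`.

Lower bound, general `K` (`le_card_pairsLT`): remove three extreme points whose triangle has less
than half of `P` beyond each side (`exists_balancedTriangle`), and go from `K = j` for the remainder
to `K = j + 2` for `P`. Pairs touching the triangle number at least `6j + 9`. A pair with fewer than
`j` remaining points on its left still has fewer than `j + 2` points of `P` there. Finally, turning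
a line around the remaining points produces at least `3(j + 2) - n` pairs with exactly `j` remaining
points and at most one vertex on the left (`BalancedTriangle.le_card`). These increments add up to
the two binomial terms.

Lower bound at `K = 4r` (`le_card_pairsLT_four_mul`): call a point central in a direction if more
than `k` points lie strictly on each side of the parallel line through it. If the line `a b` has
more than `k` points on both sides, then `a` and `b` are central in direction `b - a`. Turning
towards that direction from one in which `a` is not central, the last entrance of `a` or `b` into
the center is an ordered pair with exactly `k` points on the left, and at most `n - 2(k + 1) = r`
points are central just after it. Charging pairs to these events relates `n(n - 1)`, `#(pairsLT P (k
+ 1))` and `#(pairsEQ P k)`. Together with the general bound one level lower this yields the extra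
`3`.

Upper bound (`ClusterConfig.exists_finset`): fifteen clusters, of sizes `r, r - 1, r - 1, 1, 1`
three times, whose centers and directions are permuted by the order-three map `(x, y) ↦ (-y, x -
y)`. Each cluster lies on a tiny flat parabola, so orientations are read off from leading
coefficients in `ε`. Pairs inside a cluster or between aligned clusters have at least `4r` points on
the left. For other cluster pairs, inclusion-exclusion bounds the count by triangular numbers.
Summed over all clusters, these cancel down to `L(n, k)`, for all `k` at once. -/

section

open Finset Filter Topology

/-! ### Orientation, collinearity and the two sides of a line -/

/-- The planar cross product. -/
def cross (u v : Plane) : ℝ := u 0 * v 1 - u 1 * v 0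

theorem orient_eq_cross (p q x : Plane) : orient p q x = cross (q - p) (x - p) := by
  simp [orient, cross]

theorem orient_swap (p q x : Plane) : orient q p x = -orient p q x := by
  simp only [orient]; ring

theorem orient_rotate (p q x : Plane) : orient q x p = orient p q x := by
  simp only [orient]; ring

theorem orient_self_left (p q : Plane) : orient p q p = 0 := by
  simp only [orient]; ring

theorem orient_self_right (p q : Plane) : orient p q q = 0 := by
  simp only [orient]; ring

theorem plane_ext {p q : Plane} (h0 : p 0 = q 0) (h1 : p 1 = q 1) : p = q := by
  ext i; fin_cases i <;> assumption

theorem collinear_iff_orient {p q : Plane} (hpq : p ≠ q) (x : Plane) :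
    Collinear ℝ ({p, q, x} : Set Plane) ↔ orient p q x = 0 := by
  rw [collinear_iff_of_mem (p₀ := p) (by simp)]
  constructor
  · rintro ⟨v, hv⟩
    obtain ⟨a, ha⟩ := hv q (by simp)
    obtain ⟨b, hb⟩ := hv x (by simp)
    rw [ha, hb]
    simp [orient]
    ring
  · intro h
    simp only [orient] at h
    have key : ∃ t : ℝ, x = t • (q - p) + p := by
      by_cases h0 : q 0 - p 0 = 0
      · have h1 : q 1 - p 1 ≠ 0 := by
          intro h1
          exact hpq (plane_ext (by linarith) (by linarith))
        refine ⟨(x 1 - p 1) / (q 1 - p 1), plane_ext ?_ ?_⟩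
        · have : x 0 - p 0 = 0 := by
            rw [h0] at h
            have : (q 1 - p 1) * (x 0 - p 0) = 0 := by linarith
            exact (mul_eq_zero.1 this).resolve_left h1
          simp [h0]
          linarith
        · simp
          field_simp
          ring
      · refine ⟨(x 0 - p 0) / (q 0 - p 0), plane_ext ?_ ?_⟩
        · simp
          field_simp
          ring
        · simp
          field_simp
          linarith
    obtain ⟨t, ht⟩ := key
    refine ⟨q - p, ?_⟩
    rintro y (rfl | rfl | rfl)
    · exact ⟨0, by simp⟩
    · exact ⟨1, by simp⟩
    · exact ⟨t, by simpa using ht⟩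

theorem generalPosition_iff (P : Finset Plane) :
    GeneralPosition P ↔ ∀ p ∈ P, ∀ q ∈ P, ∀ r ∈ P, p ≠ q → p ≠ r → q ≠ r → orient p q r ≠ 0 := by
  unfold GeneralPosition
  refine forall₂_congr fun p hp => forall₂_congr fun q hq => forall₂_congr fun r hr =>
    forall_congr' fun hpq => forall_congr' fun hpr => forall_congr' fun hqr => ?_
  rw [collinear_iff_orient hpq]

theorem GeneralPosition.orient_ne {P : Finset Plane} (hP : GeneralPosition P) {p q r : Plane}
    (hp : p ∈ P) (hq : q ∈ P) (hr : r ∈ P) (hpq : p ≠ q) (hpr : p ≠ r) (hqr : q ≠ r) :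
    orient p q r ≠ 0 :=
  (generalPosition_iff P).1 hP p hp q hq r hr hpq hpr hqr

theorem GeneralPosition.subset {P Q : Finset Plane} (hP : GeneralPosition P) (h : Q ⊆ P) :
    GeneralPosition Q :=
  fun p hp q hq r hr => hP p (h hp) q (h hq) r (h hr)

theorem leftCount_add_leftCount {P : Finset Plane} (hP : GeneralPosition P) {p q : Plane}
    (hp : p ∈ P) (hq : q ∈ P) (hpq : p ≠ q) :
    leftCount P p q + leftCount P q p + 2 = #P := by
  classical
  unfold leftCount
  have h1 : P = {x ∈ P | 0 < orient p q x} ∪ ({x ∈ P | 0 < orient q p x} ∪ {p, q}) := by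
    ext x
    simp only [mem_union, mem_filter, mem_insert, mem_singleton]
    constructor
    · intro hx
      by_cases h1 : x = p
      · simp [h1]
      by_cases h2 : x = q
      · simp [h2]
      have := hP.orient_ne hp hq hx hpq (Ne.symm h1) (Ne.symm h2)
      rw [orient_swap p q x]
      rcases lt_or_gt_of_ne this with h | h
      · exact Or.inr (Or.inl ⟨hx, by linarith⟩)
      · exact Or.inl ⟨hx, h⟩
    · rintro (h | h | h | h)
      · exact h.1
      · exact h.1
      · exact h ▸ hp
      · exact h ▸ hq
  have d1 : Disjoint {x ∈ P | 0 < orient q p x} ({p, q} : Finset Plane) := by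
    rw [Finset.disjoint_left]
    intro x hx hx'
    simp only [mem_filter, mem_insert, mem_singleton] at hx hx'
    rcases hx' with rfl | rfl
    · simp [orient_self_right] at hx
    · simp [orient_self_left] at hx
  have d2 : Disjoint {x ∈ P | 0 < orient p q x} ({x ∈ P | 0 < orient q p x} ∪ {p, q}) := by
    rw [Finset.disjoint_left]
    intro x hx hx'
    simp only [mem_union, mem_filter, mem_insert, mem_singleton] at hx hx'
    rcases hx' with h | rfl | rfl
    · rw [orient_swap p q x] at h
      linarith [hx.2, h.2]
    · simp [orient_self_left] at hx
    · simp [orient_self_right] at hx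
  conv_rhs => rw [h1]
  rw [card_union_of_disjoint d2, card_union_of_disjoint d1, card_pair hpq]
  ring

/-! ### Edges as ordered pairs -/

/-- The ordered pairs of distinct points of `P` with fewer than `K` points of `P` on the left. -/
noncomputable def pairsLT (P : Finset Plane) (K : ℕ) : Finset (Plane × Plane) :=
  {e ∈ P.offDiag | leftCount P e.1 e.2 < K}

/-- The ordered pairs of distinct points of `P` with exactly `k` points of `P` on the left. -/
noncomputable def pairsEQ (P : Finset Plane) (k : ℕ) : Finset (Plane × Plane) :=
  {e ∈ P.offDiag | leftCount P e.1 e.2 = k}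

theorem mem_pairsLT {P : Finset Plane} {K : ℕ} {p q : Plane} :
    (p, q) ∈ pairsLT P K ↔ (p ∈ P ∧ q ∈ P ∧ p ≠ q) ∧ leftCount P p q < K := by
  simp [pairsLT]

theorem mem_pairsEQ {P : Finset Plane} {k : ℕ} {p q : Plane} :
    (p, q) ∈ pairsEQ P k ↔ (p ∈ P ∧ q ∈ P ∧ p ≠ q) ∧ leftCount P p q = k := by
  simp [pairsEQ]

theorem card_pairsLT_succ (P : Finset Plane) (k : ℕ) :
    #(pairsLT P (k + 1)) = #(pairsLT P k) + #(pairsEQ P k) := by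
  classical
  rw [← card_union_of_disjoint]
  · congr 1
    ext ⟨p, q⟩
    simp only [mem_union, mem_pairsLT, mem_pairsEQ, Nat.lt_succ_iff_lt_or_eq]
    tauto
  · rw [Finset.disjoint_left]
    rintro ⟨p, q⟩ h1 h2
    rw [mem_pairsLT] at h1
    rw [mem_pairsEQ] at h2
    omega

theorem GeneralPosition.eq_or_eq_of_mem_line {P : Finset Plane} (hP : GeneralPosition P)
    {p q x : Plane} (hp : p ∈ P) (hq : q ∈ P) (hx : x ∈ P) (hpq : p ≠ q)
    (h : x ∈ line[ℝ, p, q]) : x = p ∨ x = q := by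
  by_contra! hne
  have h3 := collinear_insert_of_mem_affineSpan_pair h
  exact hP x hx p hp q hq hne.1 hne.2 hpq h3

/-- The two sides of a line through two points hold `n - 2` points in all, so `2k + 2 < n` forbids
`k` on both. Hence only one orientation of a `k`-edge qualifies, and general position recovers its
two points from the line. -/
theorem kEdgeCount_eq {P : Finset Plane} (hP : GeneralPosition P) {k : ℕ} (hk : 2 * k + 2 < #P) :
    kEdgeCount P k = #(pairsEQ P k) := by
  have himg : {L : AffineSubspace ℝ Plane | IsKEdge P k L} =
      (fun e : Plane × Plane => line[ℝ, e.1, e.2]) '' (pairsEQ P k : Set (Plane × Plane)) := by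
    ext L
    simp only [Set.mem_ofPred_eq, IsKEdge, Set.mem_image, Finset.mem_coe, Prod.exists, mem_pairsEQ]
    constructor
    · rintro ⟨p, hp, q, hq, hpq, rfl, h⟩
      exact ⟨p, q, ⟨⟨hp, hq, hpq⟩, h⟩, rfl⟩
    · rintro ⟨p, q, ⟨⟨hp, hq, hpq⟩, h⟩, rfl⟩
      exact ⟨p, hp, q, hq, hpq, rfl, h⟩
  unfold kEdgeCount
  rw [himg, Set.InjOn.ncard_image, Set.ncard_coe_finset]
  rintro ⟨p, q⟩ he ⟨p', q'⟩ he' h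
  rw [Finset.mem_coe, mem_pairsEQ] at he he'
  obtain ⟨⟨hp, hq, hpq⟩, hc⟩ := he
  obtain ⟨⟨hp', hq', hpq'⟩, hc'⟩ := he'
  simp only at h
  have h1 : p' ∈ line[ℝ, p, q] := h ▸ left_mem_affineSpan_pair ℝ p' q'
  have h2 : q' ∈ line[ℝ, p, q] := h ▸ right_mem_affineSpan_pair ℝ p' q'
  rcases hP.eq_or_eq_of_mem_line hp hq hp' hpq h1 with rfl | rfl <;>
  rcases hP.eq_or_eq_of_mem_line hp hq hq' hpq h2 with rfl | rfl
  · exact absurd rfl hpq'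
  · rfl
  · have := leftCount_add_leftCount hP hp hq hpq
    omega
  · exact absurd rfl hpq'

theorem leKEdgeCount_eq {P : Finset Plane} (hP : GeneralPosition P) {k : ℕ} (hk : 2 * k + 2 < #P) :
    leKEdgeCount P k = #(pairsLT P (k + 1)) := by
  unfold leKEdgeCount
  induction k with
  | zero =>
    rw [card_pairsLT_succ, sum_range_one, kEdgeCount_eq hP hk]
    simp [pairsLT]
  | succ k ih =>
    rw [sum_range_succ, ih (by omega), kEdgeCount_eq hP hk, card_pairsLT_succ P (k + 1)]

/-! ### Extreme points and the angular order around them -/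

/-- `v` is strictly extreme with respect to `Q`: the points of `Q` other than `v` lie in an open
half-plane whose boundary passes through `v`. -/
def ExtremeFor (v : Plane) (Q : Finset Plane) : Prop :=
  ∃ w : Plane, ∀ x ∈ Q, x ≠ v → 0 < cross w (x - v)

theorem ExtremeFor.subset {v : Plane} {P Q : Finset Plane} (h : ExtremeFor v P) (hQ : Q ⊆ P) :
    ExtremeFor v Q := by
  obtain ⟨w, hw⟩ := h
  exact ⟨w, fun x hx => hw x (hQ hx)⟩

/-- Angular order is transitive inside an open half-plane at `v`. The identity is the linear
dependence of the three vectors from `v`, paired with `w`. -/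
theorem orient_trans_of_extreme {w v x y z : Plane} (hx : 0 < cross w (x - v))
    (hy : 0 < cross w (y - v)) (hz : 0 < cross w (z - v)) (hxy : 0 < orient v x y)
    (hyz : 0 < orient v y z) : 0 < orient v x z := by
  have key : cross w (y - v) * orient v x z =
      cross w (x - v) * orient v y z + cross w (z - v) * orient v x y := by
    simp only [orient, cross, PiLp.sub_apply]; ring
  have : 0 < cross w (y - v) * orient v x z := by rw [key]; positivity
  exact (pos_iff_pos_of_mul_pos this).1 hy

theorem leftCount_swap_eq (Q : Finset Plane) (v x : Plane) :
    leftCount Q x v = #{y ∈ Q | 0 < orient v y x} := by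
  unfold leftCount
  congr 1
  ext y
  rw [mem_filter, mem_filter, orient_rotate x v y]

/-- If `y` comes before `t` in the angular order around `v`, then so does everything before `y`. -/
theorem leftCount_lt_of_orient_pos {Q : Finset Plane} {v y t : Plane} {w : Plane}
    (hw : ∀ x ∈ Q, 0 < cross w (x - v)) (ht : 0 < cross w (t - v)) (hy : y ∈ Q)
    (h : 0 < orient v y t) : leftCount Q y v < leftCount Q t v := by
  rw [leftCount_swap_eq, leftCount_swap_eq]
  apply card_lt_card
  refine ⟨fun x hx => ?_, fun hsub => ?_⟩
  · rw [mem_filter] at hx ⊢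
    exact ⟨hx.1, orient_trans_of_extreme (hw x hx.1) (hw y hy) ht hx.2 h⟩
  · have := hsub (mem_filter.2 ⟨hy, h⟩)
    rw [mem_filter, orient_self_right] at this
    exact lt_irrefl _ this.2

theorem leftCount_lt_of_orient_neg {Q : Finset Plane} {v y t : Plane} {w : Plane}
    (hw : ∀ x ∈ Q, 0 < cross w (x - v)) (ht : 0 < cross w (t - v)) (hy : y ∈ Q)
    (h : 0 < orient v t y) : leftCount Q v y < leftCount Q v t := by
  unfold leftCount
  apply card_lt_card
  refine ⟨fun x hx => ?_, fun hsub => ?_⟩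
  · rw [mem_filter] at hx ⊢
    exact ⟨hx.1, orient_trans_of_extreme ht (hw y hy) (hw x hx.1) h hx.2⟩
  · have := hsub (mem_filter.2 ⟨hy, h⟩)
    rw [mem_filter, orient_self_right] at this
    exact lt_irrefl _ this.2

/-- Around a point `v` that is extreme for `Q`, the number of points of `Q` to the left of `v x`
takes each value below `#Q` exactly once. -/
theorem image_leftCount_eq_range {Q : Finset Plane} {v : Plane} (hv : v ∉ Q)
    (hext : ExtremeFor v Q)
    (hgp : ∀ x ∈ Q, ∀ y ∈ Q, x ≠ y → orient v x y ≠ 0) :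
    Set.InjOn (fun x => leftCount Q v x) Q ∧ Q.image (fun x => leftCount Q v x) = range #Q := by
  obtain ⟨w, hw⟩ := hext
  have hw' : ∀ x ∈ Q, 0 < cross w (x - v) := fun x hx => hw x hx (fun h => hv (h ▸ hx))
  have hinj : Set.InjOn (fun x => leftCount Q v x) Q := by
    intro x hx y hy hxy
    simp only at hxy
    by_contra hne
    rcases lt_or_gt_of_ne (hgp x hx y hy hne) with h | h
    · have h' : 0 < orient v y x := by
        have e1 : orient v y x = -orient v x y := by simp only [orient]; ring
        linarith
      have := leftCount_lt_of_orient_neg hw' (hw' y hy) hx h'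
      omega
    · have := leftCount_lt_of_orient_neg hw' (hw' x hx) hy h
      omega
  refine ⟨hinj, eq_of_subset_of_card_le (fun k hk => ?_) ?_⟩
  · obtain ⟨x, hx, rfl⟩ := mem_image.1 hk
    rw [mem_range]
    apply card_lt_card
    refine ⟨filter_subset (fun y => 0 < orient v x y) Q, fun hsub => ?_⟩
    have := hsub hx
    rw [mem_filter, orient_self_right] at this
    exact lt_irrefl _ this.2
  · rw [card_range, card_image_of_injOn hinj]

theorem leftCount_add_leftCount_of_extreme {Q : Finset Plane} {v x : Plane}
    (hgp : ∀ y ∈ Q, x ≠ y → orient v x y ≠ 0) (hx : x ∈ Q) :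
    leftCount Q v x + leftCount Q x v + 1 = #Q := by
  classical
  unfold leftCount
  have h1 : Q = insert x ({y ∈ Q | 0 < orient v x y} ∪ {y ∈ Q | 0 < orient x v y}) := by
    ext y
    simp only [mem_insert, mem_union, mem_filter]
    constructor
    · intro hy
      by_cases h : y = x
      · exact Or.inl h
      rcases lt_or_gt_of_ne (hgp y hy (Ne.symm h)) with h' | h'
      · exact Or.inr (Or.inr ⟨hy, by rw [orient_swap]; linarith⟩)
      · exact Or.inr (Or.inl ⟨hy, h'⟩)
    · rintro (rfl | h | h)
      · exact hx
      · exact h.1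
      · exact h.1
  conv_rhs => rw [h1]
  rw [card_insert_of_notMem, card_union_of_disjoint]
  · rw [Finset.disjoint_left]
    intro y hy hy'
    rw [mem_filter] at hy hy'
    rw [orient_swap] at hy'
    linarith [hy.2, hy'.2]
  · simp [orient_self_right, orient_self_left]

theorem exists_leftCount_eq {Q : Finset Plane} {v : Plane} (hv : v ∉ Q) (hext : ExtremeFor v Q)
    (hgp : ∀ x ∈ Q, ∀ y ∈ Q, x ≠ y → orient v x y ≠ 0) {j : ℕ} (hj : j < #Q) :
    ∃ x ∈ Q, leftCount Q v x = j := by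
  have := (image_leftCount_eq_range hv hext hgp).2
  have hj' := mem_range.2 hj
  rw [← this] at hj'
  simpa using hj'

theorem card_filter_leftCount_lt {Q : Finset Plane} {v : Plane} (hv : v ∉ Q)
    (hext : ExtremeFor v Q) (hgp : ∀ x ∈ Q, ∀ y ∈ Q, x ≠ y → orient v x y ≠ 0) {K : ℕ}
    (hK : K ≤ #Q) : #{x ∈ Q | leftCount Q v x < K} = K := by
  obtain ⟨hinj, himg⟩ := image_leftCount_eq_range hv hext hgp
  have : ({x ∈ Q | leftCount Q v x < K}).image (fun x => leftCount Q v x) = range K := by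
    ext k
    simp only [mem_image, mem_filter, mem_range]
    constructor
    · rintro ⟨x, hx, rfl⟩
      exact hx.2
    · intro hk
      obtain ⟨x, hx, rfl⟩ := exists_leftCount_eq hv hext hgp (lt_of_lt_of_le hk hK)
      exact ⟨x, ⟨hx, hk⟩, rfl⟩
  have h := congrArg card this
  rw [card_range, card_image_of_injOn] at h
  · exact h
  refine hinj.mono fun x hx => ?_
  rw [mem_coe, mem_filter] at hx
  exact hx.1

theorem exists_leftCount_swap_eq {Q : Finset Plane} {v : Plane} (hv : v ∉ Q)
    (hext : ExtremeFor v Q) (hgp : ∀ x ∈ Q, ∀ y ∈ Q, x ≠ y → orient v x y ≠ 0) {j : ℕ}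
    (hj : j < #Q) : ∃ x ∈ Q, leftCount Q x v = j := by
  obtain ⟨x, hx, h⟩ := exists_leftCount_eq hv hext hgp (j := #Q - 1 - j) (by omega)
  have := leftCount_add_leftCount_of_extreme (hgp x hx) hx
  exact ⟨x, hx, by omega⟩

theorem card_filter_leftCount_swap_lt {Q : Finset Plane} {v : Plane} (hv : v ∉ Q)
    (hext : ExtremeFor v Q) (hgp : ∀ x ∈ Q, ∀ y ∈ Q, x ≠ y → orient v x y ≠ 0) {K : ℕ}
    (hK : K ≤ #Q) : #{x ∈ Q | leftCount Q x v < K} = K := by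
  have h1 := card_filter_leftCount_lt hv hext hgp (Nat.sub_le #Q K)
  have h2 := card_filter_add_card_filter_not (s := Q) (p := fun x => leftCount Q v x < #Q - K)
  have h3 : {x ∈ Q | ¬ leftCount Q v x < #Q - K} = {x ∈ Q | leftCount Q x v < K} := by
    refine filter_congr fun x hx => ?_
    have := leftCount_add_leftCount_of_extreme (hgp x hx) hx
    omega
  rw [h3] at h2
  omega

/-- If `y` precedes the extreme point `v` in direction `u`, then so does one of the two angular
segments ending at `y`. -/
theorem min_leftCount_lt_card {Q : Finset Plane} {v y u : Plane} (hv : v ∉ Q)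
    (hext : ExtremeFor v Q) (hy : y ∈ Q) (hu : 0 < cross u (y - v)) {j : ℕ}
    (h1 : j ≤ leftCount Q y v) (h2 : j ≤ leftCount Q v y) :
    j + 1 ≤ #{z ∈ Q | 0 < cross u (z - v)} := by
  classical
  obtain ⟨w, hw⟩ := hext
  have hw' : ∀ x ∈ Q, 0 < cross w (x - v) := fun x hx => hw x hx (fun h => hv (h ▸ hx))
  -- The points span less than a half-turn around `v`, so the boundary of the half-plane separates
  -- their angular order at most once. If some point before `y` is outside, everything after `y` is
  -- inside.
  by_cases hall : ∀ a ∈ Q, 0 < orient v a y → 0 < cross u (a - v)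
  · have hsub : insert y {a ∈ Q | 0 < orient v a y} ⊆ {z ∈ Q | 0 < cross u (z - v)} := by
      intro a ha
      rw [mem_insert, mem_filter] at ha
      rw [mem_filter]
      rcases ha with rfl | ha
      · exact ⟨hy, hu⟩
      · exact ⟨ha.1, hall a ha.1 ha.2⟩
    have := card_le_card hsub
    rw [card_insert_of_notMem (by simp [orient_self_right])] at this
    rw [leftCount_swap_eq] at h1
    omega
  · push Not at hall
    obtain ⟨a, ha, hay, hua⟩ := hall
    have hsub : insert y {c ∈ Q | 0 < orient v y c} ⊆ {z ∈ Q | 0 < cross u (z - v)} := by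
      intro c hc
      rw [mem_insert, mem_filter] at hc
      rw [mem_filter]
      rcases hc with rfl | hc
      · exact ⟨hy, hu⟩
      · refine ⟨hc.1, ?_⟩
        by_contra hneg
        have hac := orient_trans_of_extreme (hw' a ha) (hw' y hy) (hw' c hc.1) hay hc.2
        have key : orient v a c * cross u (y - v) =
            orient v y c * cross u (a - v) + orient v a y * cross u (c - v) := by
          simp only [orient, cross, PiLp.sub_apply]; ring
        have e1 : 0 < orient v a c * cross u (y - v) := mul_pos hac hu
        have e2 : orient v y c * cross u (a - v) ≤ 0 :=
          mul_nonpos_of_nonneg_of_nonpos hc.2.le hua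
        have e3 : orient v a y * cross u (c - v) ≤ 0 :=
          mul_nonpos_of_nonneg_of_nonpos hay.le (not_lt.1 hneg)
        linarith
    have := card_le_card hsub
    rw [card_insert_of_notMem (by simp [orient_self_right])] at this
    unfold leftCount at h2
    omega

theorem exists_direction_injOn (P : Finset Plane) :
    ∃ w : Plane, ∀ x ∈ P, ∀ y ∈ P, x ≠ y → cross w (x - y) ≠ 0 := by
  classical
  let bad : Finset ℝ := (P ×ˢ P).image fun e => (e.1 1 - e.2 1) / (e.1 0 - e.2 0)
  obtain ⟨t, ht⟩ := Infinite.exists_notMem_finset bad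
  refine ⟨!₂[1, t], fun x hx y hy hxy h => ?_⟩
  simp only [cross, PiLp.sub_apply] at h
  simp at h
  by_cases h0 : x 0 - y 0 = 0
  · rw [h0] at h
    exact hxy (plane_ext (by linarith) (by linarith))
  · refine ht (mem_image.2 ⟨(x, y), mem_product.2 ⟨hx, hy⟩, ?_⟩)
    simp only
    rw [div_eq_iff h0]
    linarith

theorem exists_extremeFor {P : Finset Plane} (hP : P.Nonempty) : ∃ p ∈ P, ExtremeFor p P := by
  obtain ⟨w, hw⟩ := exists_direction_injOn P
  obtain ⟨p, hp, hmin⟩ := P.exists_min_image (fun x => cross w x) hP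
  refine ⟨p, hp, w, fun x hx hxp => ?_⟩
  have h1 := hmin x hx
  have h2 := hw x hx p hp hxp
  have h3 : cross w (x - p) = cross w x - cross w p := by
    simp only [cross, PiLp.sub_apply]; ring
  rw [h3] at h2 ⊢
  exact lt_of_le_of_ne (by linarith) (Ne.symm h2)

/-! ### Supporting edges and balanced triangles -/

/-- The tail of a supporting edge is strictly extreme. -/
theorem extremeFor_of_edge {P : Finset Plane} {q w s : Plane}
    (h : ∀ x ∈ P, x ≠ q → 0 < cross w (x - q) ∨ cross w (x - q) = 0 ∧ 0 < cross s (x - q)) :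
    ExtremeFor q P := by
  -- Tilting `w` slightly towards `s` preserves the finitely many strict inequalities and makes the
  -- ties positive.
  have key : ∀ᶠ δ : ℝ in 𝓝[>] 0, ∀ x ∈ P, x ≠ q → 0 < cross w (x - q) + δ * cross s (x - q) := by
    rw [Filter.eventually_all_finset]
    intro x hx
    by_cases hxq : x = q
    · simp [hxq]
    rcases h x hx hxq with h1 | ⟨h1, h2⟩
    · have hc : ContinuousAt (fun δ : ℝ => cross w (x - q) + δ * cross s (x - q)) 0 := by fun_prop
      have h3 : ∀ᶠ δ : ℝ in 𝓝 0, 0 < cross w (x - q) + δ * cross s (x - q) :=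
        hc.eventually (lt_mem_nhds (by simpa using h1))
      exact (h3.filter_mono nhdsWithin_le_nhds).mono fun δ hδ _ => hδ
    · filter_upwards [self_mem_nhdsWithin] with δ hδ _
      rw [h1, zero_add]
      exact mul_pos hδ h2
  obtain ⟨δ, hδ⟩ := key.exists
  refine ⟨w + δ • s, fun x hx hxq => ?_⟩
  have := hδ x hx hxq
  simp only [cross, PiLp.add_apply, PiLp.smul_apply, smul_eq_mul, PiLp.sub_apply] at this ⊢
  linarith

/-- Between two consecutive angular segments around `p` there is a supporting edge crossing from
one to the other. -/
theorem exists_bridge {A B : Finset Plane} {p d : Plane} (hA : A.Nonempty) (hB : B.Nonempty)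
    (hAd : ∀ a ∈ A, 0 < cross (a - p) d) (hBd : ∀ b ∈ B, 0 < cross d (b - p)) :
    ∃ q ∈ A, ∃ r ∈ B, (∀ x ∈ A, 0 ≤ orient q r x) ∧ ∀ x ∈ B, 0 ≤ orient q r x := by
  -- The quotient is the parameter at which the segment `q r` meets the ray from `p` in direction
  -- `d`; the segment crossing farthest out is the supporting one.
  obtain ⟨⟨q, r⟩, hqr, hmax⟩ := (A ×ˢ B).exists_max_image
    (fun e => cross (e.1 - p) (e.2 - p) / (cross (e.1 - p) d + cross d (e.2 - p)))
    (hA.product hB)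
  obtain ⟨hq, hr⟩ := mem_product.1 hqr
  simp only at hq hr
  refine ⟨q, hq, r, hr, fun x hx => ?_, fun x hx => ?_⟩
  · have h := hmax (x, r) (mem_product.2 ⟨hx, hr⟩)
    simp only at h
    have p1 := hAd q hq
    have p2 := hAd x hx
    have p3 := hBd r hr
    rw [div_le_div_iff₀ (by linarith) (by linarith)] at h
    have key : cross (x - p) (r - p) * (cross (q - p) d + cross d (r - p)) -
        cross (q - p) (r - p) * (cross (x - p) d + cross d (r - p)) =
        -(cross d (r - p) * orient q r x) := by
      simp only [orient, cross, PiLp.sub_apply]; ring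
    by_contra hneg
    have := mul_neg_of_pos_of_neg p3 (not_le.1 hneg)
    linarith
  · have h := hmax (q, x) (mem_product.2 ⟨hq, hx⟩)
    simp only at h
    have p1 := hAd q hq
    have p2 := hBd x hx
    have p3 := hBd r hr
    rw [div_le_div_iff₀ (by linarith) (by linarith)] at h
    have key : cross (q - p) (x - p) * (cross (q - p) d + cross d (r - p)) -
        cross (q - p) (r - p) * (cross (q - p) d + cross d (x - p)) =
        -(cross (q - p) d * orient q r x) := by
      simp only [orient, cross, PiLp.sub_apply]; ring
    by_contra hneg
    have := mul_neg_of_pos_of_neg p1 (not_le.1 hneg)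
    linarith

/-- Three extreme points of `P`, in counterclockwise order, such that each side of the triangle
they span cuts off less than half of the points of `P`. -/
structure BalancedTriangle (P : Finset Plane) (p q r : Plane) : Prop where
  mem₁ : p ∈ P
  mem₂ : q ∈ P
  mem₃ : r ∈ P
  ccw : 0 < orient p q r
  ext₁ : ExtremeFor p P
  ext₂ : ExtremeFor q P
  ext₃ : ExtremeFor r P
  cap₁ : 2 * leftCount P q p + 1 ≤ #P
  cap₂ : 2 * leftCount P r q + 1 ≤ #P
  cap₃ : 2 * leftCount P p r + 1 ≤ #P

theorem BalancedTriangle.rotate {P : Finset Plane} {p q r : Plane} (h : BalancedTriangle P p q r) :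
    BalancedTriangle P q r p where
  mem₁ := h.mem₂
  mem₂ := h.mem₃
  mem₃ := h.mem₁
  ccw := by rw [orient_rotate]; exact h.ccw
  ext₁ := h.ext₂
  ext₂ := h.ext₃
  ext₃ := h.ext₁
  cap₁ := h.cap₂
  cap₂ := h.cap₃
  cap₃ := h.cap₁

/-- Take any extreme `p`, halve the other points by angle around it, and let `q r` be the hull edge
bridging the halves. Nothing lies beyond `q r`, and the caps at `p q` and `p r` each sit within one
half. -/
theorem exists_balancedTriangle {P : Finset Plane} (hP : GeneralPosition P) (hn : 3 ≤ #P) :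
    ∃ p q r, BalancedTriangle P p q r := by
  classical
  obtain ⟨p, hp, hext⟩ := exists_extremeFor (P := P) (card_pos.1 (by omega))
  set Q := P.erase p with hQ
  have hcard : #Q = #P - 1 := card_erase_of_mem hp
  have hpQ : p ∉ Q := notMem_erase p P
  have hextQ : ExtremeFor p Q := hext.subset (erase_subset _ _)
  have hQP : ∀ x ∈ Q, x ∈ P := fun x hx => mem_of_mem_erase hx
  have hQp : ∀ x ∈ Q, x ≠ p := fun x hx => ne_of_mem_erase hx
  have hgp : ∀ x ∈ Q, ∀ y ∈ Q, x ≠ y → orient p x y ≠ 0 := fun x hx y hy hxy =>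
    hP.orient_ne hp (hQP x hx) (hQP y hy) (hQp x hx).symm (hQp y hy).symm hxy
  obtain ⟨w, hw⟩ := hextQ
  have hw' : ∀ x ∈ Q, 0 < cross w (x - p) := fun x hx => hw x hx (hQp x hx)
  have hextQ : ExtremeFor p Q := ⟨w, hw⟩
  have hPQ : ∀ a b : Plane, ¬ 0 < orient a b p → leftCount P a b = leftCount Q a b := by
    intro a b h
    have : P = insert p Q := (insert_erase hp).symm
    unfold leftCount
    rw [this, filter_insert, if_neg h]
  set h := #Q / 2 with hh
  obtain ⟨a₀, ha₀, ha₀'⟩ := exists_leftCount_eq hpQ hextQ hgp (j := h) (by omega)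
  obtain ⟨b₀, hb₀, hb₀'⟩ := exists_leftCount_eq hpQ hextQ hgp (j := h - 1) (by omega)
  -- order from counts
  have hord : ∀ x ∈ Q, ∀ y ∈ Q, leftCount Q p y < leftCount Q p x → 0 < orient p x y := by
    intro x hx y hy hlt
    have hne : x ≠ y := by rintro rfl; exact lt_irrefl _ hlt
    rcases lt_or_gt_of_ne (hgp x hx y hy hne) with h1 | h1
    · have h2 : 0 < orient p y x := by
        have : orient p y x = -orient p x y := by simp only [orient]; ring
        linarith
      have := leftCount_lt_of_orient_neg hw' (hw' y hy) hx h2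
      omega
    · exact h1
  set A := {x ∈ Q | h ≤ leftCount Q p x} with hA
  set B := {x ∈ Q | leftCount Q p x < h} with hB
  have hinj := (image_leftCount_eq_range hpQ hextQ hgp).1
  have hge : ∀ x ∈ Q, ∀ y ∈ Q, leftCount Q p y ≤ leftCount Q p x → 0 ≤ orient p x y := by
    intro x hx y hy hle
    rcases hle.lt_or_eq with h1 | h1
    · exact (hord x hx y hy h1).le
    · have : y = x := hinj (mem_coe.2 hy) (mem_coe.2 hx) h1
      rw [this, orient_self_right]
  -- `a₀` is the last point of `A` and `b₀` the first of `B`, so the sum of their vectors points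
  -- strictly between the two halves.
  obtain ⟨q, hq, r, hr, hqA, hqB⟩ := exists_bridge (A := A) (B := B) (p := p)
    (d := (a₀ - p) + (b₀ - p)) ⟨a₀, mem_filter.2 ⟨ha₀, ha₀'.ge⟩⟩
    ⟨b₀, mem_filter.2 ⟨hb₀, by omega⟩⟩
    (by
      intro a ha
      rw [hA, mem_filter] at ha
      have h1 := hge a ha.1 a₀ ha₀ (by omega)
      have h2 := hord a ha.1 b₀ hb₀ (by omega)
      have : cross (a - p) ((a₀ - p) + (b₀ - p)) = orient p a a₀ + orient p a b₀ := by
        simp only [orient, cross, PiLp.sub_apply, PiLp.add_apply]; ring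
      rw [this]; linarith)
    (by
      intro b hb
      rw [hB, mem_filter] at hb
      have h1 := hge b₀ hb₀ b hb.1 (by omega)
      have h2 := hord a₀ ha₀ b hb.1 (by omega)
      have : cross ((a₀ - p) + (b₀ - p)) (b - p) = orient p a₀ b + orient p b₀ b := by
        simp only [orient, cross, PiLp.sub_apply, PiLp.add_apply]; ring
      rw [this]; linarith)
  rw [hA, mem_filter] at hq
  rw [hB, mem_filter] at hr
  have hqP := hQP q hq.1
  have hrP := hQP r hr.1
  have hccw : 0 < orient p q r := hord q hq.1 r hr.1 (by omega)
  have hqr : q ≠ r := by rintro rfl; omega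
  have hside : ∀ x ∈ P, 0 ≤ orient q r x := by
    intro x hx
    by_cases hxp : x = p
    · rw [hxp, orient_rotate]; exact hccw.le
    have hxQ : x ∈ Q := mem_erase.2 ⟨hxp, hx⟩
    by_cases hxA : h ≤ leftCount Q p x
    · exact hqA x (mem_filter.2 ⟨hxQ, hxA⟩)
    · exact hqB x (mem_filter.2 ⟨hxQ, not_le.1 hxA⟩)
  have hside' : ∀ x ∈ P, x ≠ q → x ≠ r → 0 < orient q r x := fun x hx h1 h2 =>
    lt_of_le_of_ne (hside x hx) (hP.orient_ne hqP hrP hx hqr h1.symm h2.symm).symm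
  refine ⟨p, q, r, hp, hqP, hrP, hccw, hext, ?_, ?_, ?_, ?_, ?_⟩
  · refine extremeFor_of_edge (w := r - q) (s := q - p) fun x hx hxq => ?_
    by_cases hxr : x = r
    · right
      subst hxr
      refine ⟨by simp only [cross]; ring, ?_⟩
      have : cross (q - p) (x - q) = orient p q x := by
        simp only [orient, cross, PiLp.sub_apply]; ring
      rwa [this]
    · left
      have := hside' x hx hxq hxr
      rwa [orient_eq_cross] at this
  · refine extremeFor_of_edge (w := r - q) (s := p - r) fun x hx hxr => ?_
    by_cases hxq : x = q
    · right
      subst hxq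
      refine ⟨by simp only [cross, PiLp.sub_apply]; ring, ?_⟩
      have : cross (p - r) (x - r) = orient p x r := by
        simp only [orient, cross, PiLp.sub_apply]; ring
      rwa [this]
    · left
      have := hside' x hx hxq hxr
      have e : cross (r - q) (x - r) = orient q r x := by
        simp only [orient, cross, PiLp.sub_apply]; ring
      rwa [e]
  · rw [hPQ q p (by rw [orient_self_right]; exact lt_irrefl _)]
    have := leftCount_add_leftCount_of_extreme (hgp q hq.1) hq.1
    omega
  · have : leftCount P r q = 0 := by
      unfold leftCount
      rw [card_eq_zero, filter_eq_empty_iff]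
      intro x hx
      have := hside x hx
      rw [orient_swap]
      linarith
    omega
  · rw [hPQ p r (by rw [orient_self_left]; exact lt_irrefl _)]
    omega

/-! ### Turning a line around a point -/

/-- The number of points of `Q` strictly to the left of the line through `x` with direction `u`. -/
noncomputable def dirCount (Q : Finset Plane) (u x : Plane) : ℕ :=
  #{y ∈ Q | 0 < cross u (y - x)}

theorem dirCount_smul (Q : Finset Plane) (u x : Plane) {c : ℝ} (hc : 0 < c) :
    dirCount Q (c • u) x = dirCount Q u x := by
  unfold dirCount
  congr 1
  refine filter_congr fun y _ => ?_
  have : cross (c • u) (y - x) = c * cross u (y - x) := by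
    simp only [cross, PiLp.smul_apply, smul_eq_mul]; ring
  rw [this, mul_pos_iff_of_pos_left hc]

theorem leftCount_eq_dirCount (Q : Finset Plane) (y x : Plane) :
    leftCount Q y x = dirCount Q (x - y) x := by
  unfold leftCount dirCount
  congr 1
  refine filter_congr fun z _ => ?_
  have : orient y x z = cross (x - y) (z - x) := by
    simp only [orient, cross, PiLp.sub_apply]; ring
  rw [this]

theorem leftCount_eq_dirCount' (Q : Finset Plane) (y x : Plane) :
    leftCount Q y x = dirCount Q (x - y) y := by
  simp only [leftCount, dirCount, orient_eq_cross]

/-- The direction moving from `u` at time `0` to `v` at time `1`. -/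
noncomputable def dirLine (u v : Plane) (t : ℝ) : Plane := (1 - t) • u + t • v

theorem cross_dirLine_left (u v w : Plane) (t : ℝ) :
    cross (dirLine u v t) w = (1 - t) * cross u w + t * cross v w := by
  simp only [dirLine, cross, PiLp.add_apply, PiLp.smul_apply, smul_eq_mul]; ring

theorem eq_smul_of_cross_eq_zero {u v w : Plane} (huw : cross u w ≠ 0) (h : cross u v = 0) :
    v = (cross v w / cross u w) • u := by
  simp only [cross] at h huw
  refine plane_ext ?_ ?_ <;>
  · simp only [cross, PiLp.smul_apply, smul_eq_mul]
    rw [div_mul_eq_mul_div, eq_div_iff huw]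
    first
    | linear_combination (w 0) * h
    | linear_combination (w 1) * h

/-- Points strictly on the left stay there under a small turn. This openness is what makes a last
exceptional time exist. -/
theorem isOpen_lt_dirCount (Q : Finset Plane) (u v x : Plane) (j : ℕ) :
    IsOpen {t : ℝ | j < dirCount Q (dirLine u v t) x} := by
  rw [isOpen_iff_mem_nhds]
  intro t ht
  have h : ∀ᶠ s in 𝓝 t, ∀ y ∈ {y ∈ Q | 0 < cross (dirLine u v t) (y - x)},
      0 < cross (dirLine u v s) (y - x) := by
    rw [Filter.eventually_all_finset]
    intro y hy
    rw [mem_filter] at hy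
    have hc : ContinuousAt (fun s : ℝ => cross (dirLine u v s) (y - x)) t := by
      simp only [cross_dirLine_left]; fun_prop
    exact hc.eventually (lt_mem_nhds hy.2)
  refine h.mono fun s hs => lt_of_lt_of_le (Set.mem_ofPred_eq ▸ ht) (card_le_card fun y hy => ?_)
  have h2 := hs y hy
  rw [mem_filter] at hy ⊢
  exact ⟨hy.1, h2⟩

/-- While the direction turns from `u` to `v`, the number of points to the left of the line through
`x` passes from at most `j` to more than `j`; the last time this happens, the line through `x`
contains a point `y` behind `x` such that exactly `j` points are to the left of `y x`. -/
theorem exists_last_event {Q : Finset Plane} (hQ : GeneralPosition Q) {x : Plane} (hx : x ∈ Q)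
    {u v : Plane} (huv : 0 < cross u v) {j : ℕ} (h0 : dirCount Q u x ≤ j)
    (h1 : j < dirCount Q v x) :
    ∃ t : ℝ, 0 ≤ t ∧ t < 1 ∧ (∀ s, t < s → s ≤ 1 → j < dirCount Q (dirLine u v s) x) ∧
      ∃ y ∈ Q, y ≠ x ∧ leftCount Q y x = j ∧ ∃ c : ℝ, 0 < c ∧ x - y = c • dirLine u v t := by
  classical
  have e0 : dirLine u v 0 = u := by simp [dirLine]
  have e1 : dirLine u v 1 = v := by simp [dirLine]
  have hcl : IsCompact (Set.Icc (0 : ℝ) 1 ∩ {t : ℝ | j < dirCount Q (dirLine u v t) x}ᶜ) :=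
    isCompact_Icc.inter_right (isOpen_lt_dirCount Q u v x j).isClosed_compl
  obtain ⟨t, ⟨⟨ht0, ht1⟩, htj⟩, hmax⟩ := hcl.exists_isGreatest
    ⟨0, ⟨le_rfl, zero_le_one⟩, by simpa [e0] using h0⟩
  simp only [Set.mem_compl_iff, Set.mem_ofPred_eq, not_lt] at htj
  have hlast : ∀ s, t < s → s ≤ 1 → j < dirCount Q (dirLine u v s) x := by
    intro s hs hs1
    by_contra hneg
    have := hmax ⟨⟨by linarith, hs1⟩, by simpa using hneg⟩
    linarith
  have ht1' : t < 1 := by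
    refine lt_of_le_of_ne ht1 ?_
    rintro rfl
    rw [e1] at htj
    omega
  set U := dirLine u v t with hU
  have hUv : cross U v = (1 - t) * cross u v := by
    rw [hU, cross_dirLine_left]
    simp only [cross]; ring
  have hUv0 : 0 < cross U v := by rw [hUv]; exact mul_pos (by linarith) huv
  have hafter : ∀ᶠ s in 𝓝[>] t, ∀ y ∈ {y ∈ Q | cross U (y - x) < 0},
      cross (dirLine u v s) (y - x) < 0 := by
    rw [Filter.eventually_all_finset]
    intro y hy
    rw [mem_filter] at hy
    have hc : ContinuousAt (fun s : ℝ => cross (dirLine u v s) (y - x)) t := by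
      simp only [cross_dirLine_left]; fun_prop
    exact (hc.eventually (gt_mem_nhds hy.2)).filter_mono nhdsWithin_le_nhds
  obtain ⟨s, hs, hst, hs1⟩ := (hafter.and (Ioc_mem_nhdsGT ht1')).exists
  have hsj := hlast s hst hs1
  -- Just after time `t` the only new points on the left come from the line itself, and general
  -- position allows at most one of them. As the count passes from at most `j` to more than `j`, it
  -- equals `j` at time `t`.
  set B := {y ∈ Q | cross U (y - x) = 0 ∧ 0 < cross (dirLine u v s) (y - x)} with hB
  have hcov : {y ∈ Q | 0 < cross (dirLine u v s) (y - x)} ⊆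
      {y ∈ Q | 0 < cross U (y - x)} ∪ B := by
    intro y hy
    rw [mem_filter] at hy
    rw [mem_union, mem_filter, hB, mem_filter]
    rcases lt_trichotomy (cross U (y - x)) 0 with h | h | h
    · have := hs y (mem_filter.2 ⟨hy.1, h⟩)
      linarith [hy.2]
    · exact Or.inr ⟨hy.1, h, hy.2⟩
    · exact Or.inl ⟨hy.1, h⟩
  have hxB : ∀ y ∈ B, y ≠ x := by
    intro y hy hyx
    rw [hB, mem_filter, hyx] at hy
    have := hy.2.2
    simp [cross] at this
  have hB1 : #B ≤ 1 := by
    rw [card_le_one]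
    intro y hy z hz
    by_contra hne
    have hyx := hxB y hy
    have hzx := hxB z hz
    rw [hB, mem_filter] at hy hz
    refine hQ.orient_ne hx hy.1 hz.1 hyx.symm hzx.symm hne ?_
    rw [orient_eq_cross, eq_smul_of_cross_eq_zero hUv0.ne' hy.2.1,
      eq_smul_of_cross_eq_zero hUv0.ne' hz.2.1]
    simp only [cross, PiLp.smul_apply, smul_eq_mul]; ring
  have hle := (card_le_card hcov).trans (card_union_le _ _)
  unfold dirCount at hsj htj
  have hBpos : 0 < #B := by omega
  obtain ⟨y, hy⟩ := card_pos.1 hBpos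
  have hyx := hxB y hy
  rw [hB, mem_filter] at hy
  have hpar : x - y = (cross (x - y) v / cross U v) • U := by
    refine eq_smul_of_cross_eq_zero hUv0.ne' ?_
    have := hy.2.1
    simp only [cross, PiLp.sub_apply] at this ⊢
    linarith
  have hc : 0 < cross (x - y) v / cross U v := by
    refine div_pos ?_ hUv0
    have h2 := hy.2.1
    have h3 := hy.2.2
    rw [hU, cross_dirLine_left] at h2
    rw [cross_dirLine_left] at h3
    have h4 : cross (x - y) v = cross v (y - x) := by
      simp only [cross, PiLp.sub_apply]; ring
    rw [h4]
    by_contra hneg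
    have h5 : (s - t) * cross v (y - x) ≤ 0 :=
      mul_nonpos_of_nonneg_of_nonpos (by linarith) (not_lt.1 hneg)
    nlinarith
  refine ⟨t, ht0, ht1', hlast, y, hy.1, hyx, ?_,
    cross (x - y) v / cross U v, hc, hpar⟩
  rw [leftCount_eq_dirCount, hpar, dirCount_smul Q U x hc]
  unfold dirCount
  omega

/-! ### Lines cutting off a part beyond one side of the triangle -/

namespace BalancedTriangle

variable {P : Finset Plane} {p q r : Plane}

/-- A point that is not left of a line having the whole triangle on its left lies beyond one of the
three sides. -/
theorem beyond_of_nonpos (h : BalancedTriangle P p q r) {a b x : Plane}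
    (hp : 0 < orient a b p) (hq : 0 < orient a b q) (hr : 0 < orient a b r)
    (hx : orient a b x ≤ 0) : 0 < orient q p x ∨ 0 < orient r q x ∨ 0 < orient p r x := by
  by_contra! hneg
  obtain ⟨h1, h2, h3⟩ := hneg
  rw [orient_swap] at h1 h2 h3
  -- The three areas are barycentric coordinates of `x`, and `orient a b` is affine. Nonnegative
  -- coordinates would all have to vanish, contradicting their sum.
  have key : orient p q r * orient a b x =
      orient q r x * orient a b p + orient r p x * orient a b q + orient p q x * orient a b r := by
    simp only [orient]; ring
  have hsum : orient q r x + orient r p x + orient p q x = orient p q r := by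
    simp only [orient]; ring
  have hc := h.ccw
  have e0 : orient p q r * orient a b x ≤ 0 := mul_nonpos_of_nonneg_of_nonpos hc.le hx
  have e1 : 0 ≤ orient q r x * orient a b p := mul_nonneg (by linarith) hp.le
  have e2 : 0 ≤ orient r p x * orient a b q := mul_nonneg (by linarith) hq.le
  have e3 : 0 ≤ orient p q x * orient a b r := mul_nonneg (by linarith) hr.le
  have f1 : orient q r x = 0 := (mul_eq_zero.1 (by linarith)).resolve_right hp.ne'
  have f2 : orient r p x = 0 := (mul_eq_zero.1 (by linarith)).resolve_right hq.ne'
  have f3 : orient p q x = 0 := (mul_eq_zero.1 (by linarith)).resolve_right hr.ne'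
  linarith

/-- Two points beyond different sides cannot both be cut off from the triangle by one line. -/
theorem not_nonpos_of_beyond (h : BalancedTriangle P p q r) {a b x y : Plane} (hxP : x ∈ P)
    (hyP : y ∈ P) (hbx : 0 < orient q p x) (hby : 0 < orient r q y)
    (hp : 0 < orient a b p) (hq : 0 < orient a b q)
    (hx : orient a b x ≤ 0) (hy : orient a b y ≤ 0) : False := by
  have hc := h.ccw
  have hxq : x ≠ q := by rintro rfl; rw [orient_self_left] at hbx; exact lt_irrefl _ hbx
  have hyq : y ≠ q := by rintro rfl; rw [orient_self_right] at hby; exact lt_irrefl _ hby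
  have hpq : p ≠ q := by rintro rfl; simp [orient] at hc
  have hrq : r ≠ q := by rintro rfl; simp [orient] at hbx hc; linarith
  have hxp : x ≠ p := by rintro rfl; rw [orient_self_right] at hbx; exact lt_irrefl _ hbx
  have hyp : y ≠ p := by
    rintro rfl
    have : orient r q y = -orient y q r := by simp only [orient]; ring
    linarith
  have hqyr : 0 < orient q y r := by rwa [orient_rotate]
  have hqrp : 0 < orient q r p := by rwa [orient_rotate]
  obtain ⟨w, hw⟩ := h.ext₂
  have hqyp := orient_trans_of_extreme (hw y hyP hyq) (hw r h.mem₃ hrq) (hw p h.mem₁ hpq) hqyr hqrp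
  have hqyx := orient_trans_of_extreme (hw y hyP hyq) (hw p h.mem₁ hpq) (hw x hxP hxq) hqyp hbx
  obtain ⟨w', hw'⟩ := h.ext₁
  have k1 : orient p y x * cross w' (q - p) =
      -(orient q y p * cross w' (x - p) + orient q p x * cross w' (y - p)) := by
    simp only [orient, cross, PiLp.sub_apply]; ring
  -- The affine dependence of `p, q, x, y`, evaluated at the affine function `orient a b`: the left
  -- side is positive, the right side negative.
  have k2 : orient q y x * orient a b p = orient p y x * orient a b q +
      orient q y p * orient a b x + orient q p x * orient a b y := by
    simp only [orient]; ring
  have e1 := mul_pos hqyp (hw' x hxP hxp)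
  have e2 := mul_pos hbx (hw' y hyP hyp)
  have hneg : orient p y x < 0 := by
    by_contra hge
    have := mul_nonneg (not_lt.1 hge) (hw' q h.mem₂ hpq.symm).le
    linarith
  have g1 := mul_pos hqyx hp
  have g2 := mul_neg_of_neg_of_pos hneg hq
  have g3 := mul_nonpos_of_nonneg_of_nonpos hqyp.le hx
  have g4 := mul_nonpos_of_nonneg_of_nonpos hbx.le hy
  linarith

theorem beyond_subset (h : BalancedTriangle P p q r) {a b x : Plane}
    (hp : 0 < orient a b p) (hq : 0 < orient a b q) (hr : 0 < orient a b r) (hxP : x ∈ P)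
    (hx : orient a b x ≤ 0) (hb : 0 < orient q p x) :
    #{x ∈ P | orient a b x ≤ 0} ≤ leftCount P q p := by
  refine card_le_card fun y hy => ?_
  rw [mem_filter] at hy ⊢
  refine ⟨hy.1, ?_⟩
  rcases h.beyond_of_nonpos hp hq hr hy.2 with h1 | h1 | h1
  · exact h1
  · exact (h.not_nonpos_of_beyond hxP hy.1 hb h1 hp hq hx hy.2).elim
  · exact (h.rotate.rotate.not_nonpos_of_beyond hy.1 hxP h1 hb hr hp hy.2 hx).elim

/-- The points cut off from the triangle by a line lie beyond one of the sides. -/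
theorem card_nonpos_le (h : BalancedTriangle P p q r) {a b : Plane}
    (hp : 0 < orient a b p) (hq : 0 < orient a b q) (hr : 0 < orient a b r) :
    #{x ∈ P | orient a b x ≤ 0} ≤ leftCount P q p ∨
    #{x ∈ P | orient a b x ≤ 0} ≤ leftCount P r q ∨
    #{x ∈ P | orient a b x ≤ 0} ≤ leftCount P p r := by
  rcases Finset.eq_empty_or_nonempty {x ∈ P | orient a b x ≤ 0} with h0 | ⟨x, hx⟩
  · exact Or.inl (by rw [h0]; simp)
  rw [mem_filter] at hx
  rcases h.beyond_of_nonpos hp hq hr hx.2 with h1 | h1 | h1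
  · exact Or.inl (h.beyond_subset hp hq hr hx.1 hx.2 h1)
  · exact Or.inr (Or.inl (h.rotate.beyond_subset hq hr hp hx.1 hx.2 h1))
  · exact Or.inr (Or.inr (h.rotate.rotate.beyond_subset hr hp hq hx.1 hx.2 h1))

/-- A line with two vertices on the left and the third one not has everything beyond the
opposite side on its left. -/
theorem pos_of_beyond (h : BalancedTriangle P p q r) {a b z : Plane}
    (hp : 0 < orient a b p) (hq : orient a b q ≤ 0) (hr : 0 < orient a b r) (hzP : z ∈ P)
    (hz : 0 < orient p r z) : 0 < orient a b z := by
  have hc := h.ccw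
  have hzp : z ≠ p := by rintro rfl; rw [orient_self_left] at hz; exact lt_irrefl _ hz
  have hzr : z ≠ r := by rintro rfl; rw [orient_self_right] at hz; exact lt_irrefl _ hz
  have hpr : p ≠ r := by rintro rfl; simp [orient] at hz
  have hpq : q ≠ p := by rintro rfl; linarith
  have hrq : q ≠ r := by rintro rfl; linarith
  have hC : orient r p z < 0 := by rw [orient_swap]; linarith
  have hD : 0 < orient r p q := by
    rw [orient_rotate q r p, orient_rotate p q r]; exact hc
  have hA : 0 < orient p q z := by
    by_contra hneg
    obtain ⟨w, hw⟩ := h.ext₁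
    have key : orient p q z * cross w (r - p) + orient r p z * cross w (q - p)
        - orient r p q * cross w (z - p) = 0 := by
      simp only [orient, cross, PiLp.sub_apply]; ring
    have e1 := mul_nonpos_of_nonpos_of_nonneg (not_lt.1 hneg) (hw r h.mem₃ hpr.symm).le
    have e2 := mul_neg_of_neg_of_pos hC (hw q h.mem₂ hpq)
    have e3 := mul_pos hD (hw z hzP hzp)
    linarith
  have hB : orient r q z < 0 := by
    by_contra hneg
    obtain ⟨w, hw⟩ := h.ext₃
    have key : - orient r q z * cross w (p - r) + orient r p z * cross w (q - r)
        - orient r p q * cross w (z - r) = 0 := by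
      simp only [orient, cross, PiLp.sub_apply]; ring
    have e1 := mul_nonneg (not_lt.1 hneg) (hw p h.mem₁ hpr).le
    have e2 := mul_neg_of_neg_of_pos hC (hw q h.mem₂ hrq)
    have e3 := mul_pos hD (hw z hzP hzr)
    linarith
  have key : orient p q z * orient a b r - orient r q z * orient a b p
      + orient r p z * orient a b q - orient r p q * orient a b z = 0 := by
    simp only [orient]; ring
  have e1 := mul_pos hA hr
  have e2 := mul_neg_of_neg_of_pos hB hp
  have e3 := mul_nonneg_of_nonpos_of_nonpos hC.le hq
  exact (pos_iff_pos_of_mul_pos (by linarith : 0 < orient r p q * orient a b z)).1 hD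

end BalancedTriangle

/-! ### Sweeps around one or two extreme points -/

/-- `v` is a strictly extreme point of `insert v Q` not collinear with two points of `Q`. -/
structure OuterPoint (Q : Finset Plane) (v : Plane) : Prop where
  notMem : v ∉ Q
  ext : ExtremeFor v Q
  orient_ne : ∀ x ∈ Q, ∀ y ∈ Q, x ≠ y → orient v x y ≠ 0

namespace OuterPoint

variable {Q : Finset Plane} {v : Plane}

theorem add_one (hv : OuterPoint Q v) {x : Plane} (hx : x ∈ Q) :
    leftCount Q v x + leftCount Q x v + 1 = #Q :=
  leftCount_add_leftCount_of_extreme (hv.orient_ne x hx) hx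

theorem orient_pos_of_lt (hv : OuterPoint Q v) {x y : Plane} (hx : x ∈ Q) (hy : y ∈ Q)
    (h : leftCount Q x v < leftCount Q y v) : 0 < orient v x y := by
  obtain ⟨w, hw⟩ := hv.ext
  have hw' : ∀ x ∈ Q, 0 < cross w (x - v) := fun x hx => hw x hx (fun e => hv.notMem (e ▸ hx))
  have hne : x ≠ y := by rintro rfl; exact lt_irrefl _ h
  by_contra hneg
  have h1 : 0 < orient v y x := by
    have e1 := hv.orient_ne x hx y hy hne
    have e2 : orient v y x = -orient v x y := by simp only [orient]; ring
    rw [e2, neg_pos]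
    exact lt_of_le_of_ne (not_lt.1 hneg) e1
  have := leftCount_lt_of_orient_pos hw' (hw' x hx) hy h1
  omega

/-- Since `x` does not come after `y` around `v`, it is not to the right of `y v`, and the left side
of the parallel through `x` is contained in that of `y v`. This bounds the count at the start of a
sweep. -/
theorem dirCount_le (hv : OuterPoint Q v) {y x : Plane} (hy : y ∈ Q) (hx : x ∈ Q)
    (h : leftCount Q x v ≤ leftCount Q y v) :
    0 ≤ cross (v - y) (x - v) ∧ dirCount Q (v - y) x ≤ leftCount Q y v := by
  have hpos : 0 ≤ cross (v - y) (x - v) := by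
    by_contra hneg
    have h1 : 0 < orient v y x := by
      have : orient v y x = -cross (v - y) (x - v) := by
        simp only [orient, cross, PiLp.sub_apply]; ring
      linarith
    obtain ⟨w, hw⟩ := hv.ext
    have hw' : ∀ x ∈ Q, 0 < cross w (x - v) := fun x hx => hw x hx (fun e => hv.notMem (e ▸ hx))
    have := leftCount_lt_of_orient_pos hw' (hw' x hx) hy h1
    omega
  refine ⟨hpos, ?_⟩
  rw [leftCount_eq_dirCount]
  refine card_le_card fun z hz => ?_
  rw [mem_filter] at hz ⊢
  refine ⟨hz.1, ?_⟩
  have e : cross (v - y) (z - v) = cross (v - y) (z - x) + cross (v - y) (x - v) := by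
    simp only [cross, PiLp.sub_apply]; ring
  linarith [hz.2]

/-- Here `x` is strictly to the right of `v y`, so the parallel through `x` has on its left all that
`v y` has, and `y` as well. This bounds the count at the end of a sweep. -/
theorem lt_dirCount (hv : OuterPoint Q v) {y x : Plane} (hy : y ∈ Q) (hx : x ∈ Q)
    (h : leftCount Q v y < leftCount Q v x) : leftCount Q v y < dirCount Q (y - v) x := by
  have h1 := hv.add_one hx
  have h2 := hv.add_one hy
  have hpos := hv.orient_pos_of_lt hx hy (by omega)
  have hneg : cross (y - v) (x - v) < 0 := by
    have : orient v x y = -cross (y - v) (x - v) := by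
      simp only [orient, cross, PiLp.sub_apply]; ring
    linarith
  rw [leftCount_eq_dirCount']
  refine card_lt_card ⟨fun z hz => ?_, fun hsub => ?_⟩
  · rw [mem_filter] at hz ⊢
    refine ⟨hz.1, ?_⟩
    have e : cross (y - v) (z - v) = cross (y - v) (z - x) + cross (y - v) (x - v) := by
      simp only [cross, PiLp.sub_apply]; ring
    linarith [hz.2]
  · have hyy : y ∈ {z ∈ Q | 0 < cross (y - v) (z - x)} := by
      rw [mem_filter]
      refine ⟨hy, ?_⟩
      have e : cross (y - v) (y - x) = - cross (y - v) (x - v) := by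
        simp only [cross, PiLp.sub_apply]; ring
      linarith
    have := hsub hyy
    rw [mem_filter] at this
    have e : cross (y - v) (y - v) = 0 := by simp only [cross]; ring
    linarith [this.2]

/-- If a line with exactly `j` points on its left has `v` on its left, then it cannot separate `v`
from a point in the middle of the angular order around `v`. -/
theorem not_left (hv : OuterPoint Q v) {y₀ y x u : Plane} {c : ℝ} (hc : 0 < c)
    (hy₀ : y₀ ∈ Q) (h1 : leftCount Q y x ≤ leftCount Q y₀ v)
    (h2 : leftCount Q y x ≤ leftCount Q v y₀) (hu : 0 < cross u (y₀ - v))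
    (hxy : x - y = c • u) : ¬ 0 < orient y x v := by
  intro hleft
  have := min_leftCount_lt_card hv.notMem hv.ext hy₀ hu h1 h2
  have hle : #{z ∈ Q | 0 < cross u (z - v)} ≤ leftCount Q y x := by
    rw [leftCount_eq_dirCount', hxy, dirCount_smul _ _ _ hc]
    refine card_le_card fun z hz => ?_
    rw [mem_filter] at hz ⊢
    refine ⟨hz.1, ?_⟩
    have e : cross u (z - y) = cross u (z - v) + cross u (v - y) := by
      simp only [cross, PiLp.sub_apply]; ring
    have e2 : orient y x v = c * cross u (v - y) := by
      rw [orient_eq_cross, hxy]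
      simp only [cross, PiLp.smul_apply, smul_eq_mul]; ring
    rw [e2] at hleft
    have := (pos_iff_pos_of_mul_pos hleft).1 hc
    linarith [hz.2]
  omega

/-- The points among the first ones in the angular order around `v`. -/
noncomputable def firsts (Q : Finset Plane) (v : Plane) (j : ℕ) : Finset Plane :=
  {x ∈ Q | leftCount Q x v < j + 1}

/-- The points among the last ones in the angular order around `v`. -/
noncomputable def lasts (Q : Finset Plane) (v : Plane) (j : ℕ) : Finset Plane :=
  {x ∈ Q | leftCount Q v x < j + 1}

theorem card_firsts (hv : OuterPoint Q v) {j : ℕ} (hj : j < #Q) : #(firsts Q v j) = j + 1 :=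
  card_filter_leftCount_swap_lt hv.notMem hv.ext hv.orient_ne hj

theorem disjoint_firsts_lasts (hv : OuterPoint Q v) {j : ℕ} (hj : 2 * j + 2 ≤ #Q) :
    Disjoint (firsts Q v j) (lasts Q v j) := by
  rw [Finset.disjoint_left]
  intro x h1 h2
  rw [firsts, mem_filter] at h1
  rw [lasts, mem_filter] at h2
  have := hv.add_one h1.1
  omega

theorem exists_leftCount_eq (hv : OuterPoint Q v) {j : ℕ} (hj : j < #Q) :
    ∃ x ∈ Q, leftCount Q v x = j :=
  _root_.exists_leftCount_eq hv.notMem hv.ext hv.orient_ne hj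

theorem exists_leftCount_swap_eq (hv : OuterPoint Q v) {j : ℕ} (hj : j < #Q) :
    ∃ x ∈ Q, leftCount Q x v = j :=
  _root_.exists_leftCount_swap_eq hv.notMem hv.ext hv.orient_ne hj

/-- Sweeping from the direction in which `r` is passed to the one in which `q` is passed. -/
theorem exists_pairsEQ_of_cross_pos (hQ : GeneralPosition Q) {r q y₁ y₂ x : Plane}
    (hr : OuterPoint Q r) (hq : OuterPoint Q q) {j : ℕ} (hj : 2 * j + 2 ≤ #Q) (hy₁ : y₁ ∈ Q)
    (h₁ : leftCount Q y₁ r = j) (hy₂ : y₂ ∈ Q) (h₂ : leftCount Q q y₂ = j)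
    (hc : 0 < cross (r - y₁) (y₂ - q)) (hx : x ∈ firsts Q r j) (hx' : x ∉ lasts Q q j) :
    ∃ y, (y, x) ∈ pairsEQ Q j ∧ ¬ 0 < orient y x r ∧ ¬ 0 < orient y x q := by
  rw [firsts, mem_filter] at hx
  have hx'' : leftCount Q q y₂ < leftCount Q q x := by
    by_contra hneg
    exact hx' (mem_filter.2 ⟨hx.1, by omega⟩)
  obtain ⟨hs, hd⟩ := hr.dirCount_le hy₁ hx.1 (by omega)
  have hd2 := hq.lt_dirCount hy₂ hx.1 hx''
  rw [h₁] at hd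
  rw [h₂] at hd2
  obtain ⟨t, ht0, ht1, -, y, hy, hyx, hyj, c, hc0, hxy⟩ := exists_last_event hQ hx.1 hc hd hd2
  have a1 := hr.add_one hy₁
  have a2 := hq.add_one hy₂
  refine ⟨y, mem_pairsEQ.2 ⟨⟨hy, hx.1, hyx⟩, hyj⟩, ?_, ?_⟩
  -- At `t = 0` the line is parallel to `y₁ r`, and `not_left` lacks its strict inequality; the
  -- position of `x` relative to `y₁ r` decides instead.
  · rcases ht0.eq_or_lt with rfl | ht
    · have e : orient y x r = -c * cross (r - y₁) (x - r) := by
        have : orient y x r = cross (x - y) (r - x) := by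
          simp only [orient, cross, PiLp.sub_apply]; ring
        rw [this, hxy]
        simp only [dirLine, cross, PiLp.sub_apply, PiLp.smul_apply, PiLp.add_apply, smul_eq_mul]
        ring
      rw [e]
      have := mul_nonneg hc0.le hs
      linarith
    · refine hr.not_left hc0 hy₁ (by omega) (by omega) ?_ hxy
      have : cross (dirLine (r - y₁) (y₂ - q) t) (y₁ - r) = t * cross (r - y₁) (y₂ - q) := by
        rw [cross_dirLine_left]
        simp only [cross, PiLp.sub_apply]; ring
      rw [this]
      positivity
  · refine hq.not_left hc0 hy₂ (by omega) (by omega) ?_ hxy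
    have : cross (dirLine (r - y₁) (y₂ - q) t) (y₂ - q) = (1 - t) * cross (r - y₁) (y₂ - q) := by
      rw [cross_dirLine_left]
      simp only [cross]; ring
    rw [this]
    exact mul_pos (by linarith) hc

/-- Sweeping around a single vertex. -/
theorem exists_pairsEQ_of_mem_firsts (hQ : GeneralPosition Q) {q x : Plane}
    (hq : OuterPoint Q q) {j : ℕ} (hj : 2 * j + 2 ≤ #Q) (hx : x ∈ firsts Q q j) :
    ∃ y, (y, x) ∈ pairsEQ Q j ∧ ¬ 0 < orient y x q := by
  obtain ⟨y₁, hy₁, h₁⟩ := hq.exists_leftCount_swap_eq (j := j) (by omega)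
  obtain ⟨y₂, hy₂, h₂⟩ := hq.exists_leftCount_eq (j := j) (by omega)
  have hx' := Finset.disjoint_left.1 (hq.disjoint_firsts_lasts hj) hx
  have a1 := hq.add_one hy₁
  have a2 := hq.add_one hy₂
  have hc : cross (q - y₁) (y₂ - q) < 0 := by
    have h3 := hq.orient_pos_of_lt hy₁ hy₂ (by omega)
    have : orient q y₁ y₂ = - cross (q - y₁) (y₂ - q) := by
      simp only [orient, cross, PiLp.sub_apply]; ring
    linarith
  rw [firsts, mem_filter] at hx
  have hx'' : leftCount Q q y₂ < leftCount Q q x := by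
    by_contra hneg
    exact hx' (mem_filter.2 ⟨hx.1, by omega⟩)
  obtain ⟨hs, hd⟩ := hq.dirCount_le hy₁ hx.1 (by omega)
  have hd2 := hq.lt_dirCount hy₂ hx.1 hx''
  rw [h₁] at hd
  rw [h₂] at hd2
  set u := q - y₁ with hu
  set v := y₂ - q with hv
  -- With a single vertex the counterclockwise turn from `u` to `v` exceeds a half-turn; `-(u + v)`
  -- splits it into two turns that `exists_last_event` can handle.
  have c1 : 0 < cross u (-(u + v)) := by
    have : cross u (-(u + v)) = - cross u v := by
      simp only [cross, PiLp.neg_apply, PiLp.add_apply]; ring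
    linarith
  have c2 : 0 < cross (-(u + v)) v := by
    have : cross (-(u + v)) v = - cross u v := by
      simp only [cross, PiLp.neg_apply, PiLp.add_apply]; ring
    linarith
  by_cases hmid : dirCount Q (-(u + v)) x ≤ j
  · obtain ⟨t, ht0, ht1, -, y, hy, hyx, hyj, c, hc0, hxy⟩ := exists_last_event hQ hx.1 c2 hmid hd2
    refine ⟨y, mem_pairsEQ.2 ⟨⟨hy, hx.1, hyx⟩, hyj⟩, ?_⟩
    refine hq.not_left hc0 hy₂ (by omega) (by omega) ?_ hxy
    rw [← hv]
    have : cross (dirLine (-(u + v)) v t) v = (1 - t) * cross (-(u + v)) v := by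
      rw [cross_dirLine_left]
      simp only [cross]; ring
    rw [this]
    exact mul_pos (by linarith) c2
  · obtain ⟨t, ht0, ht1, -, y, hy, hyx, hyj, c, hc0, hxy⟩ :=
      exists_last_event hQ hx.1 c1 hd (not_le.1 hmid)
    refine ⟨y, mem_pairsEQ.2 ⟨⟨hy, hx.1, hyx⟩, hyj⟩, ?_⟩
    rcases ht0.eq_or_lt with rfl | ht
    · have e : orient y x q = -c * cross u (x - q) := by
        have : orient y x q = cross (x - y) (q - x) := by
          simp only [orient, cross, PiLp.sub_apply]; ring
        rw [this, hxy]
        simp only [dirLine, cross, PiLp.sub_apply, PiLp.smul_apply, PiLp.add_apply, smul_eq_mul]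
        ring
      rw [e]
      have := mul_nonneg hc0.le hs
      linarith
    · refine hq.not_left hc0 hy₁ (by omega) (by omega) ?_ hxy
      have e : y₁ - q = -u := by rw [hu]; abel
      have : cross (dirLine u (-(u + v)) t) (y₁ - q) = t * cross u (-(u + v)) := by
        rw [cross_dirLine_left, e]
        simp only [cross, PiLp.neg_apply, PiLp.add_apply]; ring
      rw [this]
      positivity

end OuterPoint

/-! ### Pairs avoiding the triangle -/

theorem leftCount_insert {Q : Finset Plane} {x : Plane} (hx : x ∉ Q) (a b : Plane) :
    leftCount (insert x Q) a b = leftCount Q a b + if 0 < orient a b x then 1 else 0 := by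
  unfold leftCount
  rw [filter_insert]
  split_ifs with h
  · rw [card_insert_of_notMem fun h' => hx (mem_filter.1 h').1]
  · rfl

theorem GeneralPosition.outerPoint {P Q : Finset Plane} (hP : GeneralPosition P) {v : Plane}
    (hv : v ∈ P) (hext : ExtremeFor v P) (hQ : Q ⊆ P) (hvQ : v ∉ Q) : OuterPoint Q v where
  notMem := hvQ
  ext := hext.subset hQ
  orient_ne _ hx _ hy hxy := hP.orient_ne hv (hQ hx) (hQ hy) (fun e => hvQ (e ▸ hx))
    (fun e => hvQ (e ▸ hy)) hxy

theorem leftCount_add_one_le_of_extreme {P Q : Finset Plane} {v a y : Plane} (hext : ExtremeFor v P)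
    (hQ : Q ⊆ P) (hvQ : v ∉ Q) (hy : y ∈ Q) (ha : a ∈ P) (h : 0 < orient v a y) :
    leftCount Q v y + 1 ≤ leftCount P v a := by
  have hav : a ≠ v := by rintro rfl; simp [orient] at h
  have hyv : y ≠ v := fun e => hvQ (e ▸ hy)
  obtain ⟨w, hw⟩ := hext
  refine card_lt_card ⟨fun z hz => ?_, fun hsub => ?_⟩
  · rw [mem_filter] at hz ⊢
    exact ⟨hQ hz.1, orient_trans_of_extreme (hw a ha hav) (hw y (hQ hy) hyv)
      (hw z (hQ hz.1) fun e => hvQ (e ▸ hz.1)) h hz.2⟩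
  · have := hsub (mem_filter.2 ⟨hQ hy, h⟩)
    rw [mem_filter, orient_self_right] at this
    exact lt_irrefl _ this.2

theorem leftCount_add_one_le_of_extreme' {P Q : Finset Plane} {v a y : Plane}
    (hext : ExtremeFor v P) (hQ : Q ⊆ P) (hvQ : v ∉ Q) (hy : y ∈ Q) (ha : a ∈ P)
    (h : 0 < orient v y a) : leftCount Q y v + 1 ≤ leftCount P a v := by
  have hav : a ≠ v := by rintro rfl; rw [orient_self_left] at h; exact lt_irrefl _ h
  have hyv : y ≠ v := fun e => hvQ (e ▸ hy)
  obtain ⟨w, hw⟩ := hext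
  rw [leftCount_swap_eq, leftCount_swap_eq]
  refine card_lt_card ⟨fun z hz => ?_, fun hsub => ?_⟩
  · rw [mem_filter] at hz ⊢
    exact ⟨hQ hz.1, orient_trans_of_extreme (hw z (hQ hz.1) fun e => hvQ (e ▸ hz.1))
      (hw y (hQ hy) hyv) (hw a ha hav) hz.2 h⟩
  · have := hsub (mem_filter.2 ⟨hQ hy, h⟩)
    rw [mem_filter, orient_self_right] at this
    exact lt_irrefl _ this.2

/-- The points of `P` other than `p`, `q`, `r`. -/
noncomputable def eraseThree (P : Finset Plane) (p q r : Plane) : Finset Plane :=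
  {x ∈ P | x ≠ p ∧ x ≠ q ∧ x ≠ r}

theorem eraseThree_rotate (P : Finset Plane) (p q r : Plane) :
    eraseThree P q r p = eraseThree P p q r := by
  ext x
  simp only [eraseThree, mem_filter]
  tauto

theorem mem_eraseThree {P : Finset Plane} {p q r x : Plane} :
    x ∈ eraseThree P p q r ↔ x ∈ P ∧ x ≠ p ∧ x ≠ q ∧ x ≠ r := by
  simp [eraseThree]

namespace BalancedTriangle

variable {P : Finset Plane} {p q r : Plane}

theorem ne₁₂ (h : BalancedTriangle P p q r) : p ≠ q := by
  rintro rfl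
  have := h.ccw
  simp [orient] at this

theorem ne₂₃ (h : BalancedTriangle P p q r) : q ≠ r := h.rotate.ne₁₂

theorem ne₁₃ (h : BalancedTriangle P p q r) : p ≠ r := h.rotate.rotate.ne₁₂.symm

theorem insert_eraseThree (h : BalancedTriangle P p q r) :
    insert p (insert q (insert r (eraseThree P p q r))) = P := by
  ext x
  simp only [mem_insert, mem_eraseThree]
  have h1 := h.mem₁
  have h2 := h.mem₂
  have h3 := h.mem₃
  by_cases e1 : x = p
  · simp [e1, h1]
  by_cases e2 : x = q
  · simp [e2, h2]
  by_cases e3 : x = r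
  · simp [e3, h3]
  simp [e1, e2, e3]

theorem subset (_ : BalancedTriangle P p q r) : eraseThree P p q r ⊆ P := filter_subset _ _

theorem leftCount_eq (h : BalancedTriangle P p q r) (a b : Plane) :
    leftCount P a b = leftCount (eraseThree P p q r) a b +
      (if 0 < orient a b r then 1 else 0) + (if 0 < orient a b q then 1 else 0) +
      (if 0 < orient a b p then 1 else 0) := by
  have h1 : r ∉ eraseThree P p q r := by simp [mem_eraseThree]
  have h2 : q ∉ insert r (eraseThree P p q r) := by simp [mem_eraseThree, h.ne₂₃]
  have h3 : p ∉ insert q (insert r (eraseThree P p q r)) := by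
    simp [mem_eraseThree, h.ne₁₂, h.ne₁₃]
  conv_lhs => rw [← h.insert_eraseThree]
  rw [leftCount_insert h3, leftCount_insert h2, leftCount_insert h1]

theorem card_eq (h : BalancedTriangle P p q r) : #P = #(eraseThree P p q r) + 3 := by
  have h1 : r ∉ eraseThree P p q r := by simp [mem_eraseThree]
  have h2 : q ∉ insert r (eraseThree P p q r) := by simp [mem_eraseThree, h.ne₂₃]
  have h3 : p ∉ insert q (insert r (eraseThree P p q r)) := by
    simp [mem_eraseThree, h.ne₁₂, h.ne₁₃]
  conv_lhs => rw [← h.insert_eraseThree]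
  rw [card_insert_of_notMem h3, card_insert_of_notMem h2, card_insert_of_notMem h1]

theorem outerPoint₁ (h : BalancedTriangle P p q r) (hP : GeneralPosition P) :
    OuterPoint (eraseThree P p q r) p :=
  hP.outerPoint h.mem₁ h.ext₁ h.subset (by simp [mem_eraseThree])

theorem outerPoint₂ (h : BalancedTriangle P p q r) (hP : GeneralPosition P) :
    OuterPoint (eraseThree P p q r) q :=
  hP.outerPoint h.mem₂ h.ext₂ h.subset (by simp [mem_eraseThree])

theorem outerPoint₃ (h : BalancedTriangle P p q r) (hP : GeneralPosition P) :
    OuterPoint (eraseThree P p q r) r :=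
  hP.outerPoint h.mem₃ h.ext₃ h.subset (by simp [mem_eraseThree])

/-- If the caps are small, then pairs with exactly `j` points on the left, none of them `q` or `r`,
are obtained by sweeping between the directions in which `r` and `q` are passed. -/
theorem exists_pairsEQ_of_cap_le (h : BalancedTriangle P p q r) (hP : GeneralPosition P) {j : ℕ}
    (hj : 2 * j + 5 ≤ #P) (c₁ : leftCount P q p ≤ j) (c₂ : leftCount P r q ≤ j)
    (c₃ : leftCount P p r ≤ j) {x : Plane}
    (hx : x ∈ OuterPoint.firsts (eraseThree P p q r) r j)
    (hx' : x ∉ OuterPoint.lasts (eraseThree P p q r) q j) :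
    ∃ y, (y, x) ∈ pairsEQ (eraseThree P p q r) j ∧
      ¬ 0 < orient y x q ∧ ¬ 0 < orient y x r := by
  have hQ := h.outerPoint₂ hP
  have hR := h.outerPoint₃ hP
  have hcard := h.card_eq
  obtain ⟨y₁, hy₁, e₁⟩ := hR.exists_leftCount_swap_eq (j := j) (by omega)
  obtain ⟨y₂, hy₂, e₂⟩ := hQ.exists_leftCount_eq (j := j) (by omega)
  have a1 := hR.add_one hy₁
  have a2 := hQ.add_one hy₂
  have hy₁' := mem_eraseThree.1 hy₁
  have hy₂' := mem_eraseThree.1 hy₂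
  -- The cap bounds force each of the lines `y₁ r` and `q y₂` to have `p` on the left and the
  -- remaining vertex on the right; otherwise some cap would hold more than `j` points.
  have s1 : 0 < orient y₁ r p := by
    rcases lt_or_gt_of_ne (hP.orient_ne hy₁'.1 h.mem₃ h.mem₁ hy₁'.2.2.2 hy₁'.2.1 h.ne₁₃.symm)
      with h1 | h1
    · have := leftCount_add_one_le_of_extreme' h.ext₃ h.subset hR.notMem hy₁ h.mem₁ (by
        rw [orient_swap] at h1; linarith)
      omega
    · exact h1
  have s2 : orient y₁ r q < 0 := by
    rcases lt_or_gt_of_ne (hP.orient_ne hy₁'.1 h.mem₃ h.mem₂ hy₁'.2.2.2 hy₁'.2.2.1 h.ne₂₃.symm)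
      with h1 | h1
    · exact h1
    · have := leftCount_add_one_le_of_extreme h.ext₃ h.subset hR.notMem hy₁ h.mem₂ (by
        rwa [orient_rotate])
      omega
  have s3 : 0 < orient q y₂ p := by
    rcases lt_or_gt_of_ne (hP.orient_ne h.mem₂ hy₂'.1 h.mem₁ hy₂'.2.2.1.symm h.ne₁₂.symm hy₂'.2.1)
      with h1 | h1
    · have := leftCount_add_one_le_of_extreme h.ext₂ h.subset hQ.notMem hy₂ h.mem₁ (by
        have : orient q p y₂ = - orient q y₂ p := by simp only [orient]; ring
        linarith)
      omega
    · exact h1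
  have s4 : orient q y₂ r < 0 := by
    rcases lt_or_gt_of_ne (hP.orient_ne h.mem₂ hy₂'.1 h.mem₃ hy₂'.2.2.1.symm h.ne₂₃ hy₂'.2.2.2)
      with h1 | h1
    · exact h1
    · have := leftCount_add_one_le_of_extreme' h.ext₂ h.subset hQ.notMem hy₂ h.mem₃ h1
      omega
  have hc : 0 < cross (r - y₁) (y₂ - q) := by
    have key : orient p q r * cross (r - y₁) (y₂ - q) =
        orient y₁ r p * (- orient q y₂ r) + (- orient y₁ r q) * (orient q y₂ p - orient q y₂ r) := by
      simp only [orient, cross, PiLp.sub_apply]; ring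
    have f1 : 0 < orient y₁ r p * (- orient q y₂ r) := mul_pos s1 (by linarith)
    have f2 : 0 < (- orient y₁ r q) * (orient q y₂ p - orient q y₂ r) :=
      mul_pos (by linarith) (by linarith)
    exact (pos_iff_pos_of_mul_pos (by linarith)).1 h.ccw
  obtain ⟨y, hy, hyr, hyq⟩ := OuterPoint.exists_pairsEQ_of_cross_pos (hP.subset h.subset) hR hQ
    (by omega) hy₁ e₁ hy₂ e₂ hc hx hx'
  exact ⟨y, hy, hyq, hyr⟩

/-- Each of the `j + 1` first points around `r`, unless it is also among the last around `q`, is the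
head of a pair found by the sweep; distinct heads give distinct pairs. -/
theorem card_le_of_cap_le (h : BalancedTriangle P p q r) (hP : GeneralPosition P) {j : ℕ}
    (hj : 2 * j + 5 ≤ #P) (c₁ : leftCount P q p ≤ j) (c₂ : leftCount P r q ≤ j)
    (c₃ : leftCount P p r ≤ j) :
    j + 1 ≤ #{e ∈ pairsEQ (eraseThree P p q r) j | ¬ 0 < orient e.1 e.2 q ∧ ¬ 0 < orient e.1 e.2 r} +
      #(OuterPoint.firsts (eraseThree P p q r) r j ∩ OuterPoint.lasts (eraseThree P p q r) q j) := by
  classical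
  have hcard := h.card_eq
  have h1 := (h.outerPoint₃ hP).card_firsts (j := j) (by omega)
  have h2 := card_sdiff_add_card_inter (OuterPoint.firsts (eraseThree P p q r) r j)
    (OuterPoint.lasts (eraseThree P p q r) q j)
  have h3 : OuterPoint.firsts (eraseThree P p q r) r j \ OuterPoint.lasts (eraseThree P p q r) q j ⊆
      {e ∈ pairsEQ (eraseThree P p q r) j |
        ¬ 0 < orient e.1 e.2 q ∧ ¬ 0 < orient e.1 e.2 r}.image Prod.snd := by
    intro x hx
    rw [Finset.mem_sdiff] at hx
    obtain ⟨y, hy, hyq⟩ := h.exists_pairsEQ_of_cap_le hP hj c₁ c₂ c₃ hx.1 hx.2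
    exact mem_image.2 ⟨(y, x), mem_filter.2 ⟨hy, hyq⟩, rfl⟩
  have h4 := (card_le_card h3).trans card_image_le
  omega

/-- With small caps no line through two of the points separates the triangle from only `j`
points. -/
theorem exists_left_of_cap_le (h : BalancedTriangle P p q r) (hP : GeneralPosition P) {j : ℕ}
    (c₁ : leftCount P q p ≤ j) (c₂ : leftCount P r q ≤ j) (c₃ : leftCount P p r ≤ j)
    {e : Plane × Plane} (he : e ∈ pairsEQ (eraseThree P p q r) j)
    (hp : ¬ 0 < orient e.1 e.2 p) (hq : ¬ 0 < orient e.1 e.2 q) (hr : ¬ 0 < orient e.1 e.2 r) :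
    False := by
  obtain ⟨a, b⟩ := e
  simp only at hp hq hr
  obtain ⟨⟨ha, hb, hab⟩, hl⟩ := mem_pairsEQ.1 he
  rw [mem_eraseThree] at ha hb
  have flip : ∀ v ∈ P, a ≠ v → b ≠ v → ¬ 0 < orient a b v → 0 < orient b a v := by
    intro v hv hav hbv hn
    have := hP.orient_ne ha.1 hb.1 hv hab hav hbv
    rw [orient_swap, neg_pos]
    exact lt_of_le_of_ne (not_lt.1 hn) this
  have key := h.card_nonpos_le (flip p h.mem₁ ha.2.1 hb.2.1 hp)
    (flip q h.mem₂ ha.2.2.1 hb.2.2.1 hq) (flip r h.mem₃ ha.2.2.2 hb.2.2.2 hr)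
  have hlt : leftCount (eraseThree P p q r) a b < #{x ∈ P | orient b a x ≤ 0} := by
    refine card_lt_card ⟨fun z hz => ?_, fun hsub => ?_⟩
    · rw [mem_filter] at hz ⊢
      refine ⟨h.subset hz.1, ?_⟩
      rw [orient_swap]; linarith [hz.2]
    · have := hsub (mem_filter.2 ⟨ha.1, (orient_self_right b a).le⟩)
      rw [mem_filter, orient_self_left] at this
      exact lt_irrefl _ this.2
  omega

end BalancedTriangle

namespace BalancedTriangle

variable {P : Finset Plane} {p q r : Plane}

/-- The pairs with `j` points on the left that still have fewer than `j + 2` points on the left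
when the three vertices of the triangle are added, if all caps are small. -/
theorem le_card_of_cap_le (h : BalancedTriangle P p q r) (hP : GeneralPosition P) {j : ℕ}
    (hj : 2 * j + 5 ≤ #P) (c₁ : leftCount P q p ≤ j) (c₂ : leftCount P r q ≤ j)
    (c₃ : leftCount P p r ≤ j) :
    3 * (j + 2) ≤ #{e ∈ pairsEQ (eraseThree P p q r) j | leftCount P e.1 e.2 < j + 2} + #P := by
  classical
  have hcard := h.card_eq
  have hj' : 2 * j + 2 ≤ #(eraseThree P p q r) := by omega
  have k1 := h.card_le_of_cap_le hP hj c₁ c₂ c₃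
  have k2 := h.rotate.card_le_of_cap_le hP hj c₂ c₃ c₁
  have k3 := h.rotate.rotate.card_le_of_cap_le hP hj c₃ c₁ c₂
  rw [eraseThree_rotate] at k2
  rw [eraseThree_rotate, eraseThree_rotate] at k3
  set Q := eraseThree P p q r with hQ
  set X₁ := {e ∈ pairsEQ Q j | ¬ 0 < orient e.1 e.2 q ∧ ¬ 0 < orient e.1 e.2 r} with hX₁
  set X₂ := {e ∈ pairsEQ Q j | ¬ 0 < orient e.1 e.2 r ∧ ¬ 0 < orient e.1 e.2 p} with hX₂
  set X₃ := {e ∈ pairsEQ Q j | ¬ 0 < orient e.1 e.2 p ∧ ¬ 0 < orient e.1 e.2 q} with hX₃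
  -- A pair in two of the families would have no vertex on its left, which small caps exclude.
  have hnone := fun e he => h.exists_left_of_cap_le hP c₁ c₂ c₃ (e := e) he
  have d12 : Disjoint X₁ X₂ := by
    rw [Finset.disjoint_left]
    intro e h1 h2
    rw [hX₁, mem_filter] at h1
    rw [hX₂, mem_filter] at h2
    exact hnone e h1.1 h2.2.2 h1.2.1 h1.2.2
  have d123 : Disjoint (X₁ ∪ X₂) X₃ := by
    rw [Finset.disjoint_left]
    intro e h1 h3
    rw [mem_union, hX₁, mem_filter, hX₂, mem_filter] at h1
    rw [hX₃, mem_filter] at h3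
    rcases h1 with h1 | h1
    · exact hnone e h1.1 h3.2.1 h1.2.1 h1.2.2
    · exact hnone e h1.1 h3.2.1 h3.2.2 h1.2.1
  have hsub : X₁ ∪ X₂ ∪ X₃ ⊆ {e ∈ pairsEQ Q j | leftCount P e.1 e.2 < j + 2} := by
    intro e he
    rw [mem_union, mem_union, hX₁, hX₂, hX₃, mem_filter, mem_filter, mem_filter] at he
    rw [mem_filter]
    have h1 : e ∈ pairsEQ Q j := by tauto
    refine ⟨h1, ?_⟩
    have h2 := (mem_pairsEQ.1 h1).2
    rw [h.leftCount_eq, ← hQ, h2]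
    rcases he with (he | he) | he
    · rw [if_neg he.2.1, if_neg he.2.2]; split_ifs <;> simp
    · rw [if_neg he.2.1, if_neg he.2.2]; split_ifs <;> simp
    · rw [if_neg he.2.1, if_neg he.2.2]; split_ifs <;> simp
  have hX := card_le_card hsub
  rw [card_union_of_disjoint d123, card_union_of_disjoint d12] at hX
  have dp := (h.outerPoint₁ hP).disjoint_firsts_lasts hj'
  have dq := (h.outerPoint₂ hP).disjoint_firsts_lasts hj'
  have dr := (h.outerPoint₃ hP).disjoint_firsts_lasts hj'
  rw [← hQ] at dp dq dr
  rw [Finset.disjoint_left] at dp dq dr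
  set F := OuterPoint.firsts Q
  set L := OuterPoint.lasts Q
  -- First and last points around the same vertex are disjoint, so the three overlaps are disjoint
  -- inside `Q` and lose at most `#P - 3` pairs in total.
  have i12 : Disjoint (F r j ∩ L q j) (F p j ∩ L r j) := by
    rw [Finset.disjoint_left]
    intro x h1 h2
    rw [mem_inter] at h1 h2
    exact dr h1.1 h2.2
  have i123 : Disjoint (F r j ∩ L q j ∪ F p j ∩ L r j) (F q j ∩ L p j) := by
    rw [Finset.disjoint_left]
    intro x h1 h2
    rw [mem_union, mem_inter, mem_inter] at h1
    rw [mem_inter] at h2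
    rcases h1 with h1 | h1
    · exact dq h2.1 h1.2
    · exact dp h1.1 h2.2
  have hle : F r j ∩ L q j ∪ F p j ∩ L r j ∪ F q j ∩ L p j ⊆ Q := by
    have : ∀ v, F v j ⊆ Q := fun v => filter_subset _ _
    exact union_subset (union_subset (inter_subset_left.trans (this _))
      (inter_subset_left.trans (this _))) (inter_subset_left.trans (this _))
  have hI := card_le_card hle
  rw [card_union_of_disjoint i123, card_union_of_disjoint i12] at hI
  omega

/-- Since `2j + 5 ≤ n`, the required `3(j + 2) - n` is at most `j + 1`, so the sweep around `q`
alone suffices. Its pairs do not have `q` on the left; having both `p` and `r` there would drag in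
the whole large cap beyond `p r`. -/
theorem le_card_of_lt_cap (h : BalancedTriangle P p q r) (hP : GeneralPosition P) {j : ℕ}
    (hj : 2 * j + 5 ≤ #P) (c₃ : j < leftCount P p r) :
    3 * (j + 2) ≤ #{e ∈ pairsEQ (eraseThree P p q r) j | leftCount P e.1 e.2 < j + 2} + #P := by
  classical
  have hcard := h.card_eq
  have hq := h.outerPoint₂ hP
  have hsub : OuterPoint.firsts (eraseThree P p q r) q j ⊆
      {e ∈ pairsEQ (eraseThree P p q r) j | leftCount P e.1 e.2 < j + 2}.image Prod.snd := by
    intro x hx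
    obtain ⟨y, hy, hyq⟩ :=
      OuterPoint.exists_pairsEQ_of_mem_firsts (hP.subset h.subset) hq (by omega) hx
    refine mem_image.2 ⟨(y, x), mem_filter.2 ⟨hy, ?_⟩, rfl⟩
    have h2 := (mem_pairsEQ.1 hy).2
    simp only
    rw [h.leftCount_eq, h2, if_neg hyq]
    by_cases hr : 0 < orient y x r
    · have hp : ¬ 0 < orient y x p := by
        intro hp
        have : leftCount P p r ≤ leftCount (eraseThree P p q r) y x := by
          refine card_le_card fun z hz => ?_
          rw [mem_filter] at hz ⊢
          refine ⟨mem_eraseThree.2 ⟨hz.1, ?_, ?_, ?_⟩,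
            h.pos_of_beyond hp (not_lt.1 hyq) hr hz.1 hz.2⟩
          · rintro rfl; rw [orient_self_left] at hz; exact lt_irrefl _ hz.2
          · rintro rfl
            have h3 := h.ccw
            have h4 : orient p z r = - orient p r z := by simp only [orient]; ring
            linarith [hz.2]
          · rintro rfl; rw [orient_self_right] at hz; exact lt_irrefl _ hz.2
        omega
      rw [if_neg hp, if_pos hr]; omega
    · rw [if_neg hr]; split_ifs <;> omega
  have h1 := (card_le_card hsub).trans card_image_le
  rw [hq.card_firsts (by omega)] at h1
  omega

theorem le_card (h : BalancedTriangle P p q r) (hP : GeneralPosition P) {j : ℕ}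
    (hj : 2 * j + 5 ≤ #P) :
    3 * (j + 2) ≤ #{e ∈ pairsEQ (eraseThree P p q r) j | leftCount P e.1 e.2 < j + 2} + #P := by
  by_cases c₃ : j < leftCount P p r
  · exact h.le_card_of_lt_cap hP hj c₃
  by_cases c₁ : j < leftCount P q p
  · have := h.rotate.le_card_of_lt_cap hP hj c₁
    rwa [eraseThree_rotate] at this
  by_cases c₂ : j < leftCount P r q
  · have := h.rotate.rotate.le_card_of_lt_cap hP hj c₂
    rwa [eraseThree_rotate, eraseThree_rotate] at this
  exact h.le_card_of_cap_le hP hj (by omega) (by omega) (by omega)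

/-- Few points on the left without the triangle imply few points on the left. -/
theorem leftCount_lt (h : BalancedTriangle P p q r) {j : ℕ}
    (hj : 2 * j + 5 ≤ #P) {a b : Plane} (hlt : leftCount (eraseThree P p q r) a b < j) :
    leftCount P a b < j + 2 := by
  have heq := h.leftCount_eq a b
  -- If all three vertices were on the left, the rest would fit in a cap, less than half of `P`,
  -- leaving at least `j + 3` points on the left. Otherwise at most two vertices are added.
  by_cases hall : 0 < orient a b p ∧ 0 < orient a b q ∧ 0 < orient a b r
  · have key := h.card_nonpos_le hall.1 hall.2.1 hall.2.2
    have hsum := card_filter_add_card_filter_not (s := P) (p := fun x => 0 < orient a b x)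
    have hneg : {x ∈ P | ¬ 0 < orient a b x} = {x ∈ P | orient a b x ≤ 0} :=
      filter_congr fun x _ => not_lt
    rw [hneg] at hsum
    rw [if_pos hall.1, if_pos hall.2.1, if_pos hall.2.2] at heq
    have h1 := h.cap₁
    have h2 := h.cap₂
    have h3 := h.cap₃
    change leftCount P a b + _ = _ at hsum
    omega
  · have : (if 0 < orient a b r then 1 else 0) + (if 0 < orient a b q then 1 else 0) +
      (if 0 < orient a b p then 1 else 0) ≤ 2 := by
      split_ifs <;> first | omega | tauto
    omega

end BalancedTriangle

/-! ### Pairs touching the triangle and the induction -/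

/-- The pairs containing an extreme point. -/
theorem card_filter_leftCount_lt_of_extreme {P : Finset Plane} (hP : GeneralPosition P) {v : Plane}
    (hv : v ∈ P) (hext : ExtremeFor v P) {K : ℕ} (hK : K + 1 ≤ #P) :
    #{x ∈ P.erase v | leftCount P v x < K} = K ∧ #{x ∈ P.erase v | leftCount P x v < K} = K := by
  classical
  have hO := hP.outerPoint hv hext (erase_subset v P) (notMem_erase v P)
  have hcard : #(P.erase v) = #P - 1 := card_erase_of_mem hv
  have e : ∀ a b, ¬ 0 < orient a b v → leftCount P a b = leftCount (P.erase v) a b := by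
    intro a b hab
    conv_lhs => rw [← insert_erase hv]
    rw [leftCount_insert (notMem_erase v P), if_neg hab, add_zero]
  have e1 : ∀ x, leftCount P v x = leftCount (P.erase v) v x := fun x =>
    e v x (by rw [orient_self_left]; exact lt_irrefl _)
  have e2 : ∀ x, leftCount P x v = leftCount (P.erase v) x v := fun x =>
    e x v (by rw [orient_self_right]; exact lt_irrefl _)
  simp only [e1, e2]
  exact ⟨card_filter_leftCount_lt hO.notMem hO.ext hO.orient_ne (by omega),
    card_filter_leftCount_swap_lt hO.notMem hO.ext hO.orient_ne (by omega)⟩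

namespace BalancedTriangle

variable {P : Finset Plane} {p q r : Plane}

/-- Each vertex is the tail of exactly `K` pairs and the head of exactly `K`. Only pairs of two
vertices are counted twice, and for each side of the triangle only one orientation can qualify. -/
theorem card_touching (h : BalancedTriangle P p q r) (hP : GeneralPosition P) {K : ℕ}
    (hK : 2 * K + 1 ≤ #P) :
    6 * K ≤ #{e ∈ pairsLT P K | ¬ (e.1 ∈ eraseThree P p q r ∧ e.2 ∈ eraseThree P p q r)} + 3 := by
  classical
  set T : Finset Plane := {p, q, r} with hT
  have hTc : #T = 3 := card_eq_three.2 ⟨p, q, r, h.ne₁₂, h.ne₁₃, h.ne₂₃, rfl⟩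
  have hTP : ∀ v ∈ T, v ∈ P ∧ ExtremeFor v P ∧ v ∉ eraseThree P p q r := by
    intro v hv
    simp only [hT, mem_insert, mem_singleton] at hv
    rcases hv with rfl | rfl | rfl
    · exact ⟨h.mem₁, h.ext₁, by simp [mem_eraseThree]⟩
    · exact ⟨h.mem₂, h.ext₂, by simp [mem_eraseThree]⟩
    · exact ⟨h.mem₃, h.ext₃, by simp [mem_eraseThree]⟩
  set O := {e ∈ pairsLT P K | e.1 ∈ T} with hO
  set I := {e ∈ pairsLT P K | e.2 ∈ T} with hI
  have cO : #O = 3 * K := by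
    rw [card_eq_sum_card_fiberwise (f := Prod.fst) (t := T)]
    · rw [sum_congr rfl (g := fun _ => K), sum_const, hTc, smul_eq_mul]
      intro v hv
      obtain ⟨hvP, hve, -⟩ := hTP v hv
      rw [← (card_filter_leftCount_lt_of_extreme hP hvP hve (K := K) (by omega)).1]
      refine card_nbij' Prod.snd (fun x => (v, x)) ?_ ?_ ?_ ?_
      · rintro ⟨a, b⟩ he
        simp only [hO, coe_filter, mem_filter, mem_pairsLT, Set.mem_ofPred_eq] at he ⊢
        obtain ⟨⟨⟨⟨h1, h2, h3⟩, h4⟩, h5⟩, rfl⟩ := he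
        exact ⟨mem_erase.2 ⟨h3.symm, h2⟩, h4⟩
      · intro b hb
        simp only [hO, coe_filter, mem_filter, mem_pairsLT, Set.mem_ofPred_eq, mem_erase] at hb ⊢
        exact ⟨⟨⟨⟨hvP, hb.1.2, hb.1.1.symm⟩, hb.2⟩, hv⟩, trivial⟩
      · rintro ⟨a, b⟩ he
        simp only [coe_filter, Set.mem_ofPred_eq] at he
        simp only [he.2]
      · intro b _
        rfl
    · intro e he
      simp only [hO, coe_filter, Set.mem_ofPred_eq] at he
      exact he.2
  have cI : #I = 3 * K := by
    rw [card_eq_sum_card_fiberwise (f := Prod.snd) (t := T)]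
    · rw [sum_congr rfl (g := fun _ => K), sum_const, hTc, smul_eq_mul]
      intro v hv
      obtain ⟨hvP, hve, -⟩ := hTP v hv
      rw [← (card_filter_leftCount_lt_of_extreme hP hvP hve (K := K) (by omega)).2]
      refine card_nbij' Prod.fst (fun x => (x, v)) ?_ ?_ ?_ ?_
      · rintro ⟨a, b⟩ he
        simp only [hI, coe_filter, mem_filter, mem_pairsLT, Set.mem_ofPred_eq] at he ⊢
        obtain ⟨⟨⟨⟨h1, h2, h3⟩, h4⟩, h5⟩, rfl⟩ := he
        exact ⟨mem_erase.2 ⟨h3, h1⟩, h4⟩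
      · intro b hb
        simp only [hI, coe_filter, mem_filter, mem_pairsLT, Set.mem_ofPred_eq, mem_erase] at hb ⊢
        exact ⟨⟨⟨⟨hb.1.2, hvP, hb.1.1⟩, hb.2⟩, hv⟩, trivial⟩
      · rintro ⟨a, b⟩ he
        simp only [coe_filter, Set.mem_ofPred_eq] at he
        simp only [he.2]
      · intro b _
        rfl
    · intro e he
      simp only [hI, coe_filter, Set.mem_ofPred_eq] at he
      exact he.2
  have cOI : #(O ∩ I) ≤ 3 := by
    have hsub : (O ∩ I) ∪ (O ∩ I).image Prod.swap ⊆ T.offDiag := by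
      intro e he
      rw [mem_offDiag]
      rw [mem_union, mem_image] at he
      rcases he with he | ⟨⟨a, b⟩, he, rfl⟩
      · rw [mem_inter, hO, hI, mem_filter, mem_filter] at he
        exact ⟨he.1.2, he.2.2, (mem_pairsLT.1 he.1.1).1.2.2⟩
      · rw [mem_inter, hO, hI, mem_filter, mem_filter] at he
        exact ⟨he.2.2, he.1.2, (mem_pairsLT.1 he.1.1).1.2.2.symm⟩
    have hdis : Disjoint (O ∩ I) ((O ∩ I).image Prod.swap) := by
      rw [Finset.disjoint_left]
      rintro ⟨a, b⟩ h1 h2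
      rw [mem_image] at h2
      obtain ⟨⟨c, d⟩, h2, h3⟩ := h2
      simp only [Prod.swap_prod_mk, Prod.mk.injEq] at h3
      obtain ⟨rfl, rfl⟩ := h3
      rw [mem_inter, hO, mem_filter, mem_pairsLT] at h1 h2
      have := leftCount_add_leftCount hP h1.1.1.1.1 h1.1.1.1.2.1 h1.1.1.1.2.2
      omega
    have h1 := card_le_card hsub
    rw [card_union_of_disjoint hdis, card_image_of_injective _ Prod.swap_injective, offDiag_card,
      hTc] at h1
    omega
  have hU : O ∪ I ⊆
      {e ∈ pairsLT P K | ¬ (e.1 ∈ eraseThree P p q r ∧ e.2 ∈ eraseThree P p q r)} := by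
    intro e he
    rw [mem_union, hO, hI, mem_filter, mem_filter] at he
    rw [mem_filter]
    rcases he with he | he
    · exact ⟨he.1, fun h' => (hTP _ he.2).2.2 h'.1⟩
    · exact ⟨he.1, fun h' => (hTP _ he.2).2.2 h'.2⟩
  have h1 := card_le_card hU
  have h2 := card_union_add_card_inter O I
  omega

theorem card_pairsLT_step (h : BalancedTriangle P p q r) (hP : GeneralPosition P) {j : ℕ}
    (hj : 2 * j + 5 ≤ #P) :
    6 * j + 9 + #(pairsLT (eraseThree P p q r) j) + (3 * (j + 2) - #P) ≤ #(pairsLT P (j + 2)) := by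
  classical
  have h1 := h.card_touching hP (K := j + 2) (by omega)
  have h2 := h.le_card hP hj
  set Q := eraseThree P p q r with hQ
  have h3 := card_filter_add_card_filter_not (s := pairsLT P (j + 2))
    (p := fun e => e.1 ∈ Q ∧ e.2 ∈ Q)
  have hsub : pairsLT Q j ∪ {e ∈ pairsEQ Q j | leftCount P e.1 e.2 < j + 2} ⊆
      {e ∈ pairsLT P (j + 2) | e.1 ∈ Q ∧ e.2 ∈ Q} := by
    rintro ⟨a, b⟩ he
    rw [mem_union, mem_filter, mem_pairsLT, mem_pairsEQ] at he
    rw [mem_filter, mem_pairsLT]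
    rcases he with ⟨⟨ha, hb, hab⟩, he⟩ | ⟨⟨⟨ha, hb, hab⟩, he⟩, he'⟩
    · exact ⟨⟨⟨h.subset ha, h.subset hb, hab⟩, h.leftCount_lt hj he⟩, ha, hb⟩
    · exact ⟨⟨⟨h.subset ha, h.subset hb, hab⟩, he'⟩, ha, hb⟩
  have hdis : Disjoint (pairsLT Q j) {e ∈ pairsEQ Q j | leftCount P e.1 e.2 < j + 2} := by
    rw [Finset.disjoint_left]
    rintro ⟨a, b⟩ h4 h5
    rw [mem_filter, mem_pairsEQ] at h5
    rw [mem_pairsLT] at h4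
    omega
  have h4 := card_le_card hsub
  rw [card_union_of_disjoint hdis] at h4
  omega

end BalancedTriangle

/-- The lower bound on the number of `(< K)`-edges below one half of the points. -/
theorem le_card_pairsLT (m : ℕ) : ∀ (K : ℕ) (P : Finset Plane), GeneralPosition P → #P = 3 * m →
    2 * K + 1 ≤ 3 * m →
    3 * (K + 1).choose 2 + 3 * (K + 1 - m).choose 2 ≤ #(pairsLT P K) := by
  induction m with
  | zero => intro K P _ _ h; omega
  | succ m ih =>
    intro K P hP hcard hK
    match K, hK with
    | 0, _ => simp
    -- The induction steps by two, so `K = 1` is separate; the touching pairs alone give `6 - 3 =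
    -- 3`.
    | 1, hK =>
      obtain ⟨p, q, r, h⟩ := exists_balancedTriangle hP (by omega)
      have h1 := h.card_touching hP (K := 1) (by omega)
      have h2 := card_le_card (filter_subset
        (fun e => ¬ (e.1 ∈ eraseThree P p q r ∧ e.2 ∈ eraseThree P p q r)) (pairsLT P 1))
      have h3 : (1 + 1 - (m + 1)).choose 2 = 0 := Nat.choose_eq_zero_of_lt (by omega)
      rw [h3]
      have h4 : (1 + 1).choose 2 = 1 := rfl
      rw [h4]
      omega
    | j + 2, hK =>
      obtain ⟨p, q, r, h⟩ := exists_balancedTriangle hP (by omega)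
      have h1 := h.card_pairsLT_step hP (j := j) (by omega)
      have h2 := ih j (eraseThree P p q r) (hP.subset h.subset)
        (by have := h.card_eq; omega) (by omega)
      -- Three times these increments are `6j + 9` and, as `n = 3(m + 1)`, the truncated `3(j + 2) -
      -- n` of the step.
      have e1 : (j + 2 + 1).choose 2 = (j + 1).choose 2 + (j + 1) + (j + 2) := by
        rw [Nat.choose_succ_succ' (j + 2) 1, Nat.choose_succ_succ' (j + 1) 1]
        simp; ring
      have e2 : (j + 2 + 1 - (m + 1)).choose 2 = (j + 1 - m).choose 2 + (j + 1 - m) := by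
        by_cases hm : m ≤ j + 1
        · obtain ⟨d, hd⟩ := Nat.exists_eq_add_of_le hm
          have a1 : j + 2 + 1 - (m + 1) = d + 1 := by omega
          have a2 : j + 1 - m = d := by omega
          rw [a1, a2, Nat.choose_succ_succ' d 1]
          simp; ring
        · rw [Nat.choose_eq_zero_of_lt (by omega), Nat.choose_eq_zero_of_lt (by omega)]
          omega
      rw [e1, e2]
      omega

/-! ### Central points and the events at which they become central -/

/-- In the order of `P` perpendicular to the direction `u`, more than `k` points are strictly before
`x` and more than `k` points are strictly after `x`. -/
def IsCentral (P : Finset Plane) (k : ℕ) (u x : Plane) : Prop :=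
  k < dirCount P u x ∧ k < dirCount P (-u) x

theorem IsCentral.neg {P : Finset Plane} {k : ℕ} {u x : Plane} (h : IsCentral P k u x) :
    IsCentral P k (-u) x := by
  refine ⟨h.2, ?_⟩
  rw [neg_neg]
  exact h.1

theorem IsCentral.smul_pos {P : Finset Plane} {k : ℕ} {u x : Plane} (h : IsCentral P k u x)
    {c : ℝ} (hc : 0 < c) : IsCentral P k (c • u) x := by
  refine ⟨?_, ?_⟩
  · rw [dirCount_smul _ _ _ hc]; exact h.1
  · rw [← smul_neg, dirCount_smul _ _ _ hc]; exact h.2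

theorem IsCentral.smul {P : Finset Plane} {k : ℕ} {u x : Plane} (h : IsCentral P k u x)
    {c : ℝ} (hc : c ≠ 0) : IsCentral P k (c • u) x := by
  rcases lt_or_gt_of_ne hc with hc | hc
  · have := (h.smul_pos (neg_pos.2 hc)).neg
    rwa [neg_smul, neg_neg] at this
  · exact h.smul_pos hc

/-- The vector `u` turned by a right angle counterclockwise. -/
noncomputable def perp (u : Plane) : Plane := !₂[-u 1, u 0]

@[simp] theorem perp_zero (u : Plane) : perp u 0 = -u 1 := rfl

@[simp] theorem perp_one (u : Plane) : perp u 1 = u 0 := rfl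

/-- The points of `P` that are central in all directions obtained from `u` by a small
counterclockwise turn. -/
noncomputable def centralAfter (P : Finset Plane) (k : ℕ) (u : Plane) : Finset Plane :=
  open Classical in {x ∈ P | ∀ᶠ δ : ℝ in 𝓝[>] 0, IsCentral P k (u + δ • perp u) x}

theorem mem_centralAfter {P : Finset Plane} {k : ℕ} {u x : Plane} :
    x ∈ centralAfter P k u ↔ x ∈ P ∧ ∀ᶠ δ : ℝ in 𝓝[>] 0, IsCentral P k (u + δ • perp u) x := by
  simp [centralAfter]

/-- Centrality is symmetric under reversing the direction, so negative `c` is allowed; the vector of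
an event pair can then replace the sweeping direction, whichever way it points. -/
theorem centralAfter_smul_subset (P : Finset Plane) (k : ℕ) (u : Plane) {c : ℝ} (hc : c ≠ 0) :
    centralAfter P k u ⊆ centralAfter P k (c • u) := by
  intro x hx
  rw [mem_centralAfter] at hx ⊢
  refine ⟨hx.1, hx.2.mono fun δ hδ => ?_⟩
  have : c • u + δ • perp (c • u) = c • (u + δ • perp u) := by
    refine plane_ext ?_ ?_ <;>
    · simp only [perp_zero, perp_one, PiLp.add_apply, PiLp.smul_apply, smul_eq_mul]; ring
  rw [this]
  exact hδ.smul hc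

/-- As `w` is to the left of `u`, a small counterclockwise turn of `u` is a positive combination of
`u` and `w`, up to a positive factor. -/
theorem mem_centralAfter_of_forall {P : Finset Plane} {k : ℕ} {u w x : Plane} (hx : x ∈ P)
    (huw : 0 < cross u w)
    (h : ∀ l m : ℝ, 0 < l → 0 < m → IsCentral P k (l • u + m • w) x) :
    x ∈ centralAfter P k u := by
  rw [mem_centralAfter]
  refine ⟨hx, ?_⟩
  have hc : ContinuousAt (fun δ : ℝ => cross u w - δ * (u 0 * w 0 + u 1 * w 1)) 0 := by fun_prop
  have h1 : ∀ᶠ δ : ℝ in 𝓝[>] 0, 0 < cross u w - δ * (u 0 * w 0 + u 1 * w 1) :=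
    (hc.eventually (lt_mem_nhds (by simpa using huw))).filter_mono nhdsWithin_le_nhds
  have hN : 0 < u 0 ^ 2 + u 1 ^ 2 := by
    by_contra hneg
    have e0 : u 0 = 0 := by nlinarith [sq_nonneg (u 0), sq_nonneg (u 1)]
    have e1 : u 1 = 0 := by nlinarith [sq_nonneg (u 0), sq_nonneg (u 1)]
    simp [cross, e0, e1] at huw
  filter_upwards [h1, self_mem_nhdsWithin] with δ hδ hδ0
  have hδ0' : 0 < δ := hδ0
  have key : cross u w • (u + δ • perp u) = (cross u w - δ * (u 0 * w 0 + u 1 * w 1)) • u +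
      (δ * (u 0 ^ 2 + u 1 ^ 2)) • w := by
    refine plane_ext ?_ ?_ <;>
    · simp only [perp_zero, perp_one, PiLp.add_apply, PiLp.smul_apply, smul_eq_mul, cross]; ring
  have h2 := (h _ _ hδ (mul_pos hδ0' hN)).smul (inv_ne_zero huw.ne')
  rwa [← key, smul_smul, inv_mul_cancel₀ huw.ne', one_smul] at h2

theorem cross_ne_zero_eventually {u z : Plane} (hu : u ≠ 0) (hz : z ≠ 0) :
    ∀ᶠ δ : ℝ in 𝓝[>] 0, cross (u + δ • perp u) z ≠ 0 := by
  have e : ∀ δ : ℝ, cross (u + δ • perp u) z = cross u z - δ * (u 0 * z 0 + u 1 * z 1) := by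
    intro δ
    simp only [cross, perp_zero, perp_one, PiLp.add_apply, PiLp.smul_apply, smul_eq_mul]; ring
  simp only [e]
  by_cases h0 : cross u z = 0
  · filter_upwards [self_mem_nhdsWithin] with δ hδ
    have hδ' : 0 < δ := hδ
    rw [h0, zero_sub, neg_ne_zero]
    refine mul_ne_zero hδ'.ne' fun h1 => ?_
    simp only [cross] at h0
    have hN : (u 0 ^ 2 + u 1 ^ 2) * (z 0 ^ 2 + z 1 ^ 2) = 0 := by
      linear_combination (u 0 * z 1 - u 1 * z 0) * h0 + (u 0 * z 0 + u 1 * z 1) * h1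
    rcases mul_eq_zero.1 hN with h2 | h2
    · refine hu (plane_ext ?_ ?_) <;> simp only [PiLp.zero_apply] <;>
        nlinarith [sq_nonneg (u 0), sq_nonneg (u 1)]
    · refine hz (plane_ext ?_ ?_) <;> simp only [PiLp.zero_apply] <;>
        nlinarith [sq_nonneg (z 0), sq_nonneg (z 1)]
  · have hc : ContinuousAt (fun δ : ℝ => cross u z - δ * (u 0 * z 0 + u 1 * z 1)) 0 := by fun_prop
    exact (hc.eventually_ne (by simpa using h0)).filter_mono nhdsWithin_le_nhds

theorem dirCount_lt_of_cross_pos {P : Finset Plane} {u x y : Plane} (hy : y ∈ P)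
    (h : 0 < cross u (y - x)) : dirCount P u y < dirCount P u x := by
  refine card_lt_card ⟨fun z hz => ?_, fun hsub => ?_⟩
  · rw [mem_filter] at hz ⊢
    refine ⟨hz.1, ?_⟩
    have : cross u (z - x) = cross u (z - y) + cross u (y - x) := by
      simp only [cross, PiLp.sub_apply]; ring
    linarith [hz.2]
  · have := hsub (mem_filter.2 ⟨hy, h⟩)
    rw [mem_filter] at this
    have e : cross u (y - y) = 0 := by simp [cross]
    linarith [this.2]

theorem dirCount_add_dirCount_neg {P : Finset Plane} {u x : Plane} (hx : x ∈ P) :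
    dirCount P u x + dirCount P (-u) x + 1 ≤ #P := by
  classical
  unfold dirCount
  rw [← card_union_of_disjoint]
  · refine card_lt_card ⟨union_subset (filter_subset _ _) (filter_subset _ _), fun hsub => ?_⟩
    have := hsub hx
    rw [mem_union, mem_filter, mem_filter] at this
    simp [cross] at this
  · rw [Finset.disjoint_left]
    intro y h1 h2
    rw [mem_filter] at h1 h2
    have : cross (-u) (y - x) = - cross u (y - x) := by
      simp only [cross, PiLp.neg_apply]; ring
    linarith [h1.2, h2.2]

/-- A small generic turn makes all ranks distinct, and a central rank lies in `[k + 1, n - k - 1)`.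
-/
theorem card_centralAfter_le {P : Finset Plane} {k : ℕ} {u : Plane} (hu : u ≠ 0) :
    #(centralAfter P k u) ≤ #P - 2 * (k + 1) := by
  have h1 : ∀ᶠ δ : ℝ in 𝓝[>] 0, ∀ x ∈ P, ∀ y ∈ P, x ≠ y → cross (u + δ • perp u) (x - y) ≠ 0 := by
    rw [Filter.eventually_all_finset]
    intro x _
    rw [Filter.eventually_all_finset]
    intro y _
    by_cases hxy : x = y
    · simp [hxy]
    · exact (cross_ne_zero_eventually hu (sub_ne_zero.2 hxy)).mono fun δ hδ _ => hδ
  have h2 : ∀ᶠ δ : ℝ in 𝓝[>] 0, ∀ x ∈ centralAfter P k u, IsCentral P k (u + δ • perp u) x := by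
    rw [Filter.eventually_all_finset]
    intro x hx
    exact (mem_centralAfter.1 hx).2
  obtain ⟨δ, hgen, hcen⟩ := (h1.and h2).exists
  set v := u + δ • perp u
  have h3 : #(centralAfter P k u) ≤ #(Ico (k + 1) (#P - (k + 1))) := by
    refine card_le_card_of_injOn (fun x => dirCount P v x) ?_ ?_
    · intro x hx
      have hx' := hcen x hx
      have := dirCount_add_dirCount_neg (u := v) (mem_centralAfter.1 hx).1
      unfold IsCentral at hx'
      simp only [coe_Ico, Set.mem_Ico]
      omega
    · intro x hx y hy hxy
      simp only at hxy
      by_contra hne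
      have hxP := (mem_centralAfter.1 hx).1
      have hyP := (mem_centralAfter.1 hy).1
      have e : cross v (y - x) = - cross v (x - y) := by
        simp only [cross, PiLp.sub_apply]; ring
      rcases lt_or_gt_of_ne (hgen x hxP y hyP hne) with h | h
      · have := dirCount_lt_of_cross_pos hyP (by linarith : 0 < cross v (y - x))
        omega
      · have := dirCount_lt_of_cross_pos hxP h
        omega
  rw [Nat.card_Ico] at h3
  omega

theorem isOpen_isCentral (P : Finset Plane) (k : ℕ) (u w x : Plane) :
    IsOpen {t : ℝ | IsCentral P k (dirLine u w t) x} := by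
  have e : ∀ t, -dirLine u w t = dirLine (-u) (-w) t := by
    intro t
    simp only [dirLine, smul_neg, neg_add]
  have : {t : ℝ | IsCentral P k (dirLine u w t) x} =
      {t | k < dirCount P (dirLine u w t) x} ∩ {t | k < dirCount P (dirLine (-u) (-w) t) x} := by
    ext t
    simp only [IsCentral, Set.mem_ofPred_eq, Set.mem_inter_iff, e]
  rw [this]
  exact (isOpen_lt_dirCount P u w x k).inter (isOpen_lt_dirCount P (-u) (-w) x k)

/-- The last event of the turn from `u` to `w` has exactly `k` points on the left, which `h` forbids
at positive times; so it happens in direction `u` itself. -/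
theorem exists_pairsEQ_of_not_lt {P : Finset Plane} (hP : GeneralPosition P) {k : ℕ}
    {u w x : Plane} (hx : x ∈ P) (huw : 0 < cross u w)
    (hu : ¬ k < dirCount P u x) (hw : k < dirCount P w x)
    (h : ∀ l m : ℝ, 0 < l → 0 < m → k < dirCount P (l • u + m • w) x) :
    ∃ y, (y, x) ∈ pairsEQ P k ∧ ∃ c : ℝ, 0 < c ∧ x - y = c • u := by
  obtain ⟨t, ht0, ht1, -, y, hy, hyx, hyj, c, hc0, hxy⟩ :=
    exists_last_event hP hx huw (not_lt.1 hu) hw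
  rcases ht0.eq_or_lt with rfl | ht
  · exact ⟨y, mem_pairsEQ.2 ⟨⟨hy, hx, hyx⟩, hyj⟩, c, hc0, by simpa [dirLine] using hxy⟩
  · have h1 := h (1 - t) t (by linarith) ht
    rw [leftCount_eq_dirCount, hxy, dirCount_smul _ _ _ hc0] at hyj
    unfold dirLine at hyj
    omega

/-- If the line `a b` has more than `k` points on both sides, and in some direction `a` or `b` is
not central, then the last time at which one of them enters the center yields a pair with exactly
`k` points on the left. -/
theorem exists_event_of_not_isCentral {P : Finset Plane} (hP : GeneralPosition P) {k : ℕ}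
    {a b u : Plane} (ha : a ∈ P) (hb : b ∈ P) (h₁ : k < leftCount P a b) (h₂ : k < leftCount P b a)
    (hu : 0 < cross u (b - a)) (hua : ¬ IsCentral P k u a) :
    ∃ e ∈ pairsEQ P k, (e.2 = a ∨ e.2 = b) ∧ a ∈ centralAfter P k (e.2 - e.1) ∧
      b ∈ centralAfter P k (e.2 - e.1) := by
  set w := b - a with hw
  have e0 : dirLine u w 0 = u := by simp [dirLine]
  have e1 : dirLine u w 1 = w := by simp [dirLine]
  have hneg : -w = a - b := by rw [hw]; abel
  have hwa : IsCentral P k w a := by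
    refine ⟨?_, ?_⟩
    · rwa [← leftCount_eq_dirCount']
    · rwa [hneg, ← leftCount_eq_dirCount]
  have hwb : IsCentral P k w b := by
    refine ⟨?_, ?_⟩
    · rwa [← leftCount_eq_dirCount]
    · rwa [hneg, ← leftCount_eq_dirCount']
  have hcl : IsCompact (Set.Icc (0 : ℝ) 1 ∩ ({t : ℝ | IsCentral P k (dirLine u w t) a} ∩
      {t : ℝ | IsCentral P k (dirLine u w t) b})ᶜ) :=
    isCompact_Icc.inter_right
      ((isOpen_isCentral P k u w a).inter (isOpen_isCentral P k u w b)).isClosed_compl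
  obtain ⟨t, ⟨⟨ht0, ht1⟩, htj⟩, hmax⟩ := hcl.exists_isGreatest
    ⟨0, ⟨le_rfl, zero_le_one⟩, fun h => hua (by rw [← e0]; exact h.1)⟩
  have hlast : ∀ s, t < s → s ≤ 1 →
      IsCentral P k (dirLine u w s) a ∧ IsCentral P k (dirLine u w s) b := by
    intro s hs hs1
    by_contra hneg
    have := hmax ⟨⟨by linarith, hs1⟩, hneg⟩
    linarith
  have ht1' : t < 1 := by
    refine lt_of_le_of_ne ht1 ?_
    rintro rfl
    exact htj ⟨by rw [Set.mem_ofPred_eq, e1]; exact hwa, by rw [Set.mem_ofPred_eq, e1]; exact hwb⟩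
  set U := dirLine u w t with hU
  have hUw : 0 < cross U w := by
    have : cross U w = (1 - t) * cross u w := by
      rw [hU, cross_dirLine_left]
      simp only [cross]; ring
    rw [this]
    exact mul_pos (by linarith) hu
  -- Such a combination is a positive multiple of the sweeping direction at a time after `t`.
  have hcomb : ∀ l m : ℝ, 0 < l → 0 < m →
      IsCentral P k (l • U + m • w) a ∧ IsCentral P k (l • U + m • w) b := by
    intro l m hl hm
    have hlm : 0 < l + m := by linarith
    have e : l • U + m • w = (l + m) • dirLine u w ((l * t + m) / (l + m)) := by
      refine plane_ext ?_ ?_ <;>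
      · simp only [hU, dirLine, PiLp.add_apply, PiLp.smul_apply, smul_eq_mul]
        field_simp
        ring
    have h3 := hlast ((l * t + m) / (l + m)) (by rw [lt_div_iff₀ hlm]; nlinarith)
      (by rw [div_le_one hlm]; nlinarith)
    rw [e]
    exact ⟨h3.1.smul_pos hlm, h3.2.smul_pos hlm⟩
  have hUa : a ∈ centralAfter P k U :=
    mem_centralAfter_of_forall ha hUw fun l m hl hm => (hcomb l m hl hm).1
  have hUb : b ∈ centralAfter P k U :=
    mem_centralAfter_of_forall hb hUw fun l m hl hm => (hcomb l m hl hm).2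
  have main : ∀ x ∈ P, (x = a ∨ x = b) → IsCentral P k w x → ¬ IsCentral P k U x →
      (∀ l m : ℝ, 0 < l → 0 < m → IsCentral P k (l • U + m • w) x) →
      ∃ e ∈ pairsEQ P k, (e.2 = a ∨ e.2 = b) ∧ a ∈ centralAfter P k (e.2 - e.1) ∧
      b ∈ centralAfter P k (e.2 - e.1) := by
    intro x hx hxab hwx hUx hc
    -- Centrality can fail on either side of the line; the second kind of failure is the first for
    -- the reversed directions.
    by_cases hd : k < dirCount P U x
    · have hd' : ¬ k < dirCount P (-U) x := fun h => hUx ⟨hd, h⟩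
      obtain ⟨y, hy, c, hc0, hxy⟩ := exists_pairsEQ_of_not_lt hP (w := -w) hx
        (by simpa [cross] using hUw) hd' hwx.2 (fun l m hl hm => by
          have := (hc l m hl hm).2
          rwa [neg_add, ← smul_neg, ← smul_neg] at this)
      refine ⟨(y, x), hy, hxab, ?_, ?_⟩ <;> simp only [hxy, smul_neg, ← neg_smul]
      · exact centralAfter_smul_subset P k U (neg_ne_zero.2 hc0.ne') hUa
      · exact centralAfter_smul_subset P k U (neg_ne_zero.2 hc0.ne') hUb
    · obtain ⟨y, hy, c, hc0, hxy⟩ := exists_pairsEQ_of_not_lt hP hx hUw hd hwx.1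
        (fun l m hl hm => (hc l m hl hm).1)
      refine ⟨(y, x), hy, hxab, ?_, ?_⟩ <;> simp only [hxy]
      · exact centralAfter_smul_subset P k U hc0.ne' hUa
      · exact centralAfter_smul_subset P k U hc0.ne' hUb
  by_cases hda : IsCentral P k U a
  · refine main b hb (Or.inr rfl) hwb (fun h => htj ⟨hda, h⟩) fun l m hl hm => (hcomb l m hl hm).2
  · exact main a ha (Or.inl rfl) hwa hda fun l m hl hm => (hcomb l m hl hm).1

/-- The points of `P` that are central in all directions. -/
noncomputable def alwaysCentral (P : Finset Plane) (k : ℕ) : Finset Plane :=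
  open Classical in {x ∈ P | ∀ u : Plane, u ≠ 0 → IsCentral P k u x}

theorem mem_alwaysCentral {P : Finset Plane} {k : ℕ} {x : Plane} :
    x ∈ alwaysCentral P k ↔ x ∈ P ∧ ∀ u : Plane, u ≠ 0 → IsCentral P k u x := by
  simp [alwaysCentral]

theorem cross_perp_pos {u : Plane} (hu : u ≠ 0) : 0 < cross u (perp u) := by
  have e : cross u (perp u) = u 0 ^ 2 + u 1 ^ 2 := by
    simp only [cross, perp_zero, perp_one]; ring
  rw [e]
  by_contra hneg
  refine hu (plane_ext ?_ ?_) <;> simp only [PiLp.zero_apply] <;>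
    nlinarith [sq_nonneg (u 0), sq_nonneg (u 1)]

theorem alwaysCentral_subset_centralAfter (P : Finset Plane) (k : ℕ) {u : Plane} (hu : u ≠ 0) :
    alwaysCentral P k ⊆ centralAfter P k u := by
  intro x hx
  rw [mem_alwaysCentral] at hx
  have hp := cross_perp_pos hu
  refine mem_centralAfter_of_forall hx.1 hp fun l m hl hm => hx.2 _ fun h0 => ?_
  have e : cross (l • u + m • perp u) (perp u) = l * cross u (perp u) := by
    simp only [cross, PiLp.add_apply, PiLp.smul_apply, smul_eq_mul]; ring
  rw [h0] at e
  have : 0 < l * cross u (perp u) := mul_pos hl hp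
  rw [← e] at this
  simp [cross] at this

/-- Reversing a direction in which `a` is not central puts `b - a` on its left. The parallel case
cannot occur, because `a` is central in direction `b - a`. -/
theorem exists_event {P : Finset Plane} (hP : GeneralPosition P) {k : ℕ}
    {a b : Plane} (ha : a ∈ P) (hb : b ∈ P) (hab : a ≠ b) (h₁ : k < leftCount P a b)
    (h₂ : k < leftCount P b a) (haZ : a ∉ alwaysCentral P k) :
    ∃ e ∈ pairsEQ P k, (e.2 = a ∨ e.2 = b) ∧ a ∈ centralAfter P k (e.2 - e.1) ∧
      b ∈ centralAfter P k (e.2 - e.1) := by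
  have hex : ∃ u : Plane, u ≠ 0 ∧ ¬ IsCentral P k u a := by
    by_contra! hall
    exact haZ (mem_alwaysCentral.2 ⟨ha, hall⟩)
  obtain ⟨u, hu, hua⟩ := hex
  rcases lt_trichotomy (cross u (b - a)) 0 with h | h | h
  · refine exists_event_of_not_isCentral hP ha hb h₁ h₂ (u := -u) ?_ fun hc => hua ?_
    · have : cross (-u) (b - a) = - cross u (b - a) := by
        simp only [cross, PiLp.neg_apply]; ring
      linarith
    · have := hc.neg
      rwa [neg_neg] at this
  · exfalso
    have e := eq_smul_of_cross_eq_zero (cross_perp_pos hu).ne' h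
    set c := cross (b - a) (perp u) / cross u (perp u)
    have hc : c ≠ 0 := by
      intro hc
      rw [hc, zero_smul, sub_eq_zero] at e
      exact hab e.symm
    have hcen : IsCentral P k (b - a) a := by
      refine ⟨?_, ?_⟩
      · rwa [← leftCount_eq_dirCount']
      · rwa [neg_sub, ← leftCount_eq_dirCount]
    have := hcen.smul (inv_ne_zero hc)
    rw [e, smul_smul, inv_mul_cancel₀ hc, one_smul] at this
    exact hua this
  · exact exists_event_of_not_isCentral hP ha hb h₁ h₂ h hua

/-- Counting the pairs by the event at which both of their points become central. -/
theorem card_mul_le_of_alwaysCentral {P : Finset Plane} (hP : GeneralPosition P) (k : ℕ) :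
    #P * #P - #P ≤ 2 * #(pairsLT P (k + 1)) + 2 * (#(alwaysCentral P k) * (#P - 1)) +
      2 * (#(pairsEQ P k) * (#P - 2 * (k + 1) - (#(alwaysCentral P k) + 1))) := by
  classical
  set Z := alwaysCentral P k with hZ
  -- The possible partners of `e.2` at the event `e`. Excluding `e.2` and the always central points
  -- saves `#Z + 1` per event.
  set F : Plane × Plane → Finset Plane := fun e =>
    if e.2 ∈ centralAfter P k (e.2 - e.1) ∧ e.2 ∉ Z then
      centralAfter P k (e.2 - e.1) \ insert e.2 Z else ∅ with hF
  have hFcard : ∀ e ∈ pairsEQ P k, #(F e) ≤ #P - 2 * (k + 1) - (#Z + 1) := by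
    rintro ⟨y, x⟩ he
    have hne : x - y ≠ 0 := sub_ne_zero.2 (mem_pairsEQ.1 he).1.2.2.symm
    simp only [hF]
    split_ifs with hx
    · rw [card_sdiff_of_subset, card_insert_of_notMem hx.2]
      · exact Nat.sub_le_sub_right (card_centralAfter_le hne) _
      · exact insert_subset hx.1 (alwaysCentral_subset_centralAfter P k hne)
    · simp
  set A := pairsLT P (k + 1) ∪ (pairsLT P (k + 1)).image Prod.swap with hA
  set B := Z.biUnion (fun a => (P.erase a).image (fun b => (a, b)) ∪
    (P.erase a).image (fun b => (b, a))) with hB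
  set C := (pairsEQ P k).biUnion (fun e => (F e).image (fun b => (e.2, b)) ∪
    (F e).image (fun b => (b, e.2))) with hC
  have hcov : P.offDiag ⊆ A ∪ B ∪ C := by
    rintro ⟨a, b⟩ hab
    obtain ⟨ha, hb, hne⟩ := mem_offDiag.1 hab
    simp only at ha hb hne
    rw [mem_union, mem_union]
    by_cases h1 : leftCount P a b < k + 1
    · exact Or.inl (Or.inl (mem_union_left _ (mem_pairsLT.2 ⟨⟨ha, hb, hne⟩, h1⟩)))
    by_cases h2 : leftCount P b a < k + 1
    · exact Or.inl (Or.inl (mem_union_right _ (mem_image.2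
        ⟨(b, a), mem_pairsLT.2 ⟨⟨hb, ha, hne.symm⟩, h2⟩, rfl⟩)))
    by_cases haZ : a ∈ Z
    · exact Or.inl (Or.inr (mem_biUnion.2 ⟨a, haZ, mem_union_left _ (mem_image.2
        ⟨b, mem_erase.2 ⟨hne.symm, hb⟩, rfl⟩)⟩))
    by_cases hbZ : b ∈ Z
    · exact Or.inl (Or.inr (mem_biUnion.2 ⟨b, hbZ, mem_union_right _ (mem_image.2
        ⟨a, mem_erase.2 ⟨hne, ha⟩, rfl⟩)⟩))
    right
    obtain ⟨⟨y, x⟩, he, hx, hca, hcb⟩ := exists_event hP ha hb hne (by omega) (by omega) haZ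
    simp only at hx hca hcb
    refine mem_biUnion.2 ⟨(y, x), he, ?_⟩
    rcases hx with rfl | rfl
    · refine mem_union_left _ (mem_image.2 ⟨b, ?_, rfl⟩)
      simp only [hF]
      rw [if_pos ⟨hca, haZ⟩]
      simp [hcb, hbZ, hne.symm]
    · refine mem_union_right _ (mem_image.2 ⟨a, ?_, rfl⟩)
      simp only [hF]
      rw [if_pos ⟨hcb, hbZ⟩]
      simp [hca, haZ, hne]
  have h1 := card_le_card hcov
  have h2 := (card_union_le (A ∪ B) C).trans (Nat.add_le_add_right (card_union_le A B) _)
  have hAc : #A ≤ 2 * #(pairsLT P (k + 1)) := by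
    have h3 := card_image_le (s := pairsLT P (k + 1)) (f := Prod.swap)
    have h4 : #A ≤ _ := card_union_le (pairsLT P (k + 1)) ((pairsLT P (k + 1)).image Prod.swap)
    omega
  have hBc : #B ≤ #Z * (2 * (#P - 1)) := by
    refine card_biUnion_le_card_mul _ _ _ fun a ha => ?_
    have haP : a ∈ P := (mem_alwaysCentral.1 ha).1
    have h3 := card_union_le ((P.erase a).image (fun b => (a, b)))
      ((P.erase a).image (fun b => (b, a)))
    have h4 := card_image_le (s := P.erase a) (f := fun b => (a, b))
    have h5 := card_image_le (s := P.erase a) (f := fun b => (b, a))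
    rw [card_erase_of_mem haP] at h4 h5
    omega
  have hCc : #C ≤ #(pairsEQ P k) * (2 * (#P - 2 * (k + 1) - (#Z + 1))) := by
    refine card_biUnion_le_card_mul _ _ _ fun e he => ?_
    have h3 := card_union_le ((F e).image (fun b => (e.2, b))) ((F e).image (fun b => (b, e.2)))
    have h4 := card_image_le (s := F e) (f := fun b => (e.2, b))
    have h5 := card_image_le (s := F e) (f := fun b => (b, e.2))
    have h6 := hFcard e he
    omega
  rw [offDiag_card] at h1
  have e1 : #Z * (2 * (#P - 1)) = 2 * (#Z * (#P - 1)) := by ring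
  have e2 : #(pairsEQ P k) * (2 * (#P - 2 * (k + 1) - (#Z + 1))) =
    2 * (#(pairsEQ P k) * (#P - 2 * (k + 1) - (#Z + 1))) := by ring
  omega

/-! ### The bound at four ninths -/

/-- The improved bound just below the center. -/
theorem le_card_pairsLT_four_mul {r : ℕ} (hr : 3 ≤ r) {P : Finset Plane} (hP : GeneralPosition P)
    (hcard : #P = 9 * r) :
    51 * r ^ 2 + 15 * r + 6 ≤ 2 * #(pairsLT P (4 * r)) := by
  obtain ⟨k, hk⟩ : ∃ k, 4 * r = k + 1 := ⟨4 * r - 1, by omega⟩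
  have hmain := card_mul_le_of_alwaysCentral hP k
  have hD := card_pairsLT_succ P k
  have hD' := le_card_pairsLT (3 * r) k P hP (by omega) (by omega)
  have hs : #(alwaysCentral P k) ≤ r := by
    have hu : (!₂[1, 0] : Plane) ≠ 0 := by
      intro h
      have := congrArg (fun v : Plane => v 0) h
      simp at this
    have h1 := card_le_card (alwaysCentral_subset_centralAfter P k hu)
    have h2 := card_centralAfter_le (P := P) (k := k) hu
    omega
  rw [hk]
  rw [hcard] at hmain
  have e1 : 9 * r - 2 * (k + 1) - (#(alwaysCentral P k) + 1) =
      r - (#(alwaysCentral P k) + 1) := by omega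
  rw [e1] at hmain
  have e2 : k + 1 - 3 * r = r := by omega
  rw [e2, ← hk] at hD'
  have c1 : 2 * (4 * r).choose 2 + 4 * r = 16 * r ^ 2 := by
    have := Nat.choose_two_right (4 * r)
    have h2 : 2 ∣ 4 * r * (4 * r - 1) := (Nat.even_mul_pred_self _).two_dvd
    have h3 : 2 * (4 * r).choose 2 = 4 * r * (4 * r - 1) := by omega
    rw [h3]
    obtain ⟨m, rfl⟩ : ∃ m, r = m + 1 := ⟨r - 1, by omega⟩
    have : 4 * (m + 1) - 1 = 4 * m + 3 := by omega
    rw [this]; ring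
  have c2 : 2 * r.choose 2 + r = r ^ 2 := by
    have := Nat.choose_two_right r
    have h2 : 2 ∣ r * (r - 1) := (Nat.even_mul_pred_self _).two_dvd
    have h3 : 2 * r.choose 2 = r * (r - 1) := by omega
    rw [h3]
    obtain ⟨m, rfl⟩ : ∃ m, r = m + 1 := ⟨r - 1, by omega⟩
    simp only [Nat.add_sub_cancel]; ring
  have hD2 : 51 * r ^ 2 ≤ 2 * #(pairsLT P k) + 15 * r := by omega
  clear hD' c1 c2 e1 e2
  generalize #(pairsLT P (k + 1)) = D at *
  generalize #(pairsLT P k) = D' at *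
  generalize #(pairsEQ P k) = E at *
  generalize #(alwaysCentral P k) = s at *
  clear hk hP hcard
  have e3 : 9 * r * (9 * r) - 9 * r = 9 * r * (9 * r - 1) := by
    rw [Nat.mul_sub, mul_one]
  rw [e3] at hmain
  obtain ⟨N, hN⟩ : ∃ N, N = 9 * r - 1 := ⟨_, rfl⟩
  rw [← hN] at hmain
  have hN' : N + 1 = 9 * r := by omega
  rcases hs.lt_or_eq with hs | rfl
  · obtain ⟨t, rfl⟩ : ∃ t, r = s + 1 + t := ⟨r - (s + 1), by omega⟩
    have e4 : s + 1 + t - (s + 1) = t := by omega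
    rw [e4] at hmain
    zify at *
    -- If `E ≥ N`, replacing `s * N` by `s * E` gives `nN ≤ 2D + 2(r - 1)E`, and `E = D - D'` with
    -- the bound on `D'` is exactly the claim. If `E < N`, then `nN ≤ 2D + 2(r - 1)N`, which is
    -- stronger.
    by_cases hE : (N : ℤ) ≤ E
    · have h1 : (s : ℤ) * N ≤ s * E := mul_le_mul_of_nonneg_left hE (by positivity)
      have h2 : (0 : ℤ) < s + 1 + t := by positivity
      refine le_of_mul_le_mul_left (a := (s + 1 + t : ℤ)) ?_ h2
      have h3 : ((s : ℤ) + t) * (51 * (s + 1 + t) ^ 2) ≤ (s + t) * (2 * D' + 15 * (s + 1 + t)) :=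
        mul_le_mul_of_nonneg_left hD2 (by positivity)
      have e5 : (N : ℤ) = 9 * (s + 1 + t) - 1 := by linarith
      rw [hD] at hmain ⊢
      rw [e5] at hmain h1
      nlinarith
    · have h1 : (E : ℤ) * t ≤ N * t := mul_le_mul_of_nonneg_right (by linarith) (by positivity)
      have e5 : (N : ℤ) = 9 * (s + 1 + t) - 1 := by linarith
      rw [e5] at hmain h1
      nlinarith
  -- With `r` always central points no event has a partner left, so `2D ≥ 7r(9r - 1)`. This suffices
  -- from `r = 3` on, but not for `r = 2`.
  · have e4 : s - (s + 1) = 0 := by omega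
    rw [e4] at hmain
    zify at *
    have e5 : (N : ℤ) = 9 * s - 1 := by linarith
    rw [e5] at hmain
    nlinarith

/-! ### The cluster configuration: data and finite checks -/

namespace ClusterConfig

/-- The planar cross product of integer vectors. -/
def crossZ (u v : ℤ × ℤ) : ℤ := u.1 * v.2 - u.2 * v.1

/-- The centers of the fifteen clusters. -/
def base : Fin 15 → ℤ × ℤ :=
  ![(37, 13), (24, 8), (8, 0), (28, 9), (14, 5),
    (-13, 24), (-8, 16), (0, 8), (-9, 19), (-5, 9),
    (-24, -37), (-16, -24), (-8, -8), (-19, -28), (-9, -14)]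

/-- The directions of the clusters. -/
def dir : Fin 15 → ℤ × ℤ :=
  ![(18, 7), (5, 1), (2, 1), (0, 0), (0, 0),
    (-7, 11), (-1, 4), (-1, 1), (0, 0), (0, 0),
    (-11, -18), (-4, -5), (-1, -2), (0, 0), (0, 0)]

/-- The cluster `i` has `a * r + b` points, where `(a, b) = size i`. -/
def size : Fin 15 → ℤ × ℤ :=
  ![(1, 0), (1, -1), (1, -1), (0, 1), (0, 1), (1, 0), (1, -1), (1, -1), (0, 1), (0, 1),
    (1, 0), (1, -1), (1, -1), (0, 1), (0, 1)]

/-- Twice the signed area of a triangle of cluster centers. -/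
def orientZ (i j k : Fin 15) : ℤ := crossZ (base j - base i) (base k - base i)

/-- The total size of the clusters strictly to the left of the line from `i` to `j`. -/
def weight (i j : Fin 15) : ℤ × ℤ := ∑ k, if 0 < orientZ i j k then size k else 0

/-- The total size of the clusters on the side of sign `t` of the line through cluster `i` in its
own direction. -/
def chordWeight (i : Fin 15) (t : ℤ) : ℤ × ℤ :=
  ∑ k, if 0 < t * crossZ (dir i) (base i - base k) then size k else 0

/-- One of the two clusters lies on the line spanned by the other. -/
def Aligned (i j : Fin 15) : Prop :=
  dir i ≠ 0 ∧ crossZ (dir i) (base i - base j) = 0 ∨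
    dir j ≠ 0 ∧ crossZ (dir j) (base i - base j) = 0

instance (i j : Fin 15) : Decidable (Aligned i j) := inferInstanceAs (Decidable (_ ∨ _))

theorem size_cases : ∀ i, size i = (1, 0) ∨ size i = (1, -1) ∨ size i = (0, 1) ∧ dir i = 0 := by
  decide +kernel

theorem sum_size : ∑ i, size i = (9, 0) := by decide +kernel

/-- On a line of three centers, one cluster does not leave the line to first order and the other two
leave it at equal nonzero rates. The `ε` coefficient is then this rate times a sum of two
parameters. -/
theorem collinear_cases : ∀ i j k, i ≠ j → i ≠ k → j ≠ k → orientZ i j k = 0 →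
    crossZ (dir i) (base j - base k) = 0 ∧
      crossZ (dir j) (base k - base i) = crossZ (dir k) (base i - base j) ∧
      crossZ (dir k) (base i - base j) ≠ 0 ∨
    crossZ (dir j) (base k - base i) = 0 ∧
      crossZ (dir i) (base j - base k) = crossZ (dir k) (base i - base j) ∧
      crossZ (dir k) (base i - base j) ≠ 0 ∨
    crossZ (dir k) (base i - base j) = 0 ∧
      crossZ (dir i) (base j - base k) = crossZ (dir j) (base k - base i) ∧
      crossZ (dir j) (base k - base i) ≠ 0 := by
  decide +kernel

/-- A cluster centered on the chord line of `i` must cross it transversally, so that the `ε ^ 2`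
coefficient can decide. -/
theorem chord_transversal : ∀ i k, i ≠ k → dir i ≠ 0 →
    crossZ (dir i) (base i - base k) ≠ 0 ∨ crossZ (dir i) (dir k) ≠ 0 := by
  decide +kernel

-- A side of a chord line holds `4r` or `4r + 1` points, unless two clusters of `r - 1` points
-- straddle the line. These are split in halves, and the signs tell which halves supplement `3r + 2`
-- or `3r + 1`.
set_option synthInstance.maxSize 1000 in
set_option synthInstance.maxHeartbeats 200000 in
theorem chordWeight_cases : ∀ i, dir i ≠ 0 → ∀ t ∈ ({1, -1} : Finset ℤ),
    chordWeight i t = (4, 0) ∨ chordWeight i t = (4, 1) ∨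
    ∃ k l, i ≠ k ∧ i ≠ l ∧ k ≠ l ∧ size k = (1, -1) ∧ size l = (1, -1) ∧
      crossZ (dir i) (base i - base k) = 0 ∧ crossZ (dir i) (base i - base l) = 0 ∧
      (chordWeight i t = (3, 2) ∧ t * crossZ (dir i) (dir k) < 0 ∧
        t * crossZ (dir i) (dir l) < 0 ∨
      chordWeight i t = (3, 1) ∧ 0 < t * crossZ (dir i) (dir k) ∧
        0 < t * crossZ (dir i) (dir l)) := by
  decide +kernel

/-- The third cluster `k` on the line makes up for the points of `j` on the wrong side: equal rates
make the two left parts complementary. -/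
theorem aligned_cases : ∀ i j, i ≠ j → dir i ≠ 0 → crossZ (dir i) (base i - base j) = 0 →
    size j = (1, -1) ∧ ∃ k, k ≠ i ∧ k ≠ j ∧ orientZ i j k = 0 ∧ size k = (1, -1) ∧
      crossZ (dir i) (base j - base k) = 0 ∧
      crossZ (dir j) (base k - base i) = crossZ (dir k) (base i - base j) ∧
      (0 < crossZ (dir k) (base i - base j) ∧ 0 < crossZ (dir j) (base i - base j) ∧
        weight i j = (3, 2) ∨
      crossZ (dir k) (base i - base j) < 0 ∧ crossZ (dir j) (base i - base j) < 0 ∧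
        weight i j = (3, 1)) := by
  decide +kernel

theorem aligned_cases' : ∀ i j, i ≠ j → dir j ≠ 0 → crossZ (dir j) (base i - base j) = 0 →
    size i = (1, -1) ∧ ∃ k, k ≠ i ∧ k ≠ j ∧ orientZ i j k = 0 ∧ size k = (1, -1) ∧
      crossZ (dir j) (base k - base i) = 0 ∧
      crossZ (dir i) (base j - base k) = crossZ (dir k) (base i - base j) ∧
      (0 < crossZ (dir k) (base i - base j) ∧ 0 < crossZ (dir i) (base i - base j) ∧
        weight i j = (3, 2) ∨
      crossZ (dir k) (base i - base j) < 0 ∧ crossZ (dir i) (base i - base j) < 0 ∧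
        weight i j = (3, 1)) := by
  decide +kernel

end ClusterConfig

/-! ### Lattice points of a rectangle below a diagonal -/

/-- Twice the `x`-th triangular number, zero for negative `x`. -/
def twiceTriangle (x : ℤ) : ℤ := max x 0 * (max x 0 + 1)

theorem twiceTriangle_of_nonpos {x : ℤ} (hx : x ≤ 0) : twiceTriangle x = 0 := by
  simp [twiceTriangle, max_eq_right hx]

theorem twiceTriangle_of_nonneg {x : ℤ} (hx : 0 ≤ x) : twiceTriangle x = x * (x + 1) := by
  simp [twiceTriangle, max_eq_left hx]

theorem twiceTriangle_sub_one (x : ℤ) :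
    twiceTriangle x = twiceTriangle (x - 1) + 2 * max x 0 := by
  rcases le_or_gt x 0 with h | h
  · rw [twiceTriangle_of_nonpos h, twiceTriangle_of_nonpos (by omega), max_eq_right h]
    ring
  · rw [twiceTriangle_of_nonneg h.le, twiceTriangle_of_nonneg (by omega), max_eq_left h.le]
    ring

theorem sum_range_ite_lt (m : ℕ) (D : ℤ) :
    ∑ t ∈ range m, (if (t : ℤ) < D then (1 : ℤ) else 0) = max D 0 - max (D - m) 0 := by
  induction m with
  | zero => simp
  | succ m ih =>
    rw [sum_range_succ, ih]
    push_cast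
    split_ifs <;> omega

theorem two_mul_sum_range_max (n : ℕ) (D : ℤ) :
    2 * ∑ s ∈ range n, max (D - s) 0 = twiceTriangle D - twiceTriangle (D - n) := by
  induction n with
  | zero => simp
  | succ n ih =>
    rw [sum_range_succ, mul_add, ih, twiceTriangle_sub_one (D - n)]
    have : D - n - 1 = D - ((n + 1 : ℕ) : ℤ) := by push_cast; ring
    rw [this]; ring

/-- Inclusion-exclusion on the sides of the rectangle: a quadrant below the diagonal holds a
triangular number of points. -/
theorem two_mul_sum_range_sum_range_ite (n m : ℕ) (D : ℤ) :
    2 * ∑ s ∈ range n, ∑ t ∈ range m, (if (s : ℤ) + t < D then (1 : ℤ) else 0) =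
      twiceTriangle D - twiceTriangle (D - n) - twiceTriangle (D - m) +
        twiceTriangle (D - n - m) := by
  have h1 : ∀ s ∈ range n, ∑ t ∈ range m, (if (s : ℤ) + t < D then (1 : ℤ) else 0) =
      max (D - s) 0 - max (D - m - s) 0 := by
    intro s _
    have h2 := sum_range_ite_lt m (D - s)
    have h3 : ∀ t : ℕ, (s : ℤ) + t < D ↔ (t : ℤ) < D - s := fun t => by omega
    simp only [h3, h2]
    have h4 : D - s - m = D - m - s := by ring
    rw [h4]
  rw [sum_congr rfl h1, sum_sub_distrib, mul_sub, two_mul_sum_range_max, two_mul_sum_range_max]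
  have h4 : D - m - n = D - n - m := by ring
  rw [h4]; ring

/-! ### Cancellation over all pairs of clusters -/

namespace ClusterConfig

/-- The terms in the inclusion-exclusion formula for the number of pairs between the clusters `i`
and `j` with few points on the left. -/
def boundTerm (i j : Fin 15) : Fin 4 → ℤ × ℤ × ℤ
  | 0 => (1, weight i j)
  | 1 => (-1, weight i j + size i)
  | 2 => (-1, weight i j + size j)
  | 3 => (1, weight i j + size i + size j)

/-- A condition ensuring `w.1 * r + w.2 ≥ 4 * r` for all `r ≥ 3`. -/
def Large (w : ℤ × ℤ) : Prop := 4 ≤ w.1 ∧ 12 ≤ 3 * w.1 + w.2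

instance (w : ℤ × ℤ) : Decidable (Large w) := inferInstanceAs (Decidable (_ ∧ _))

/-- The coefficients of the terms that are not large. -/
def coef (i j : Fin 15) (c : Fin 4) : ℤ :=
  if i = j ∨ Aligned i j ∨ Large (boundTerm i j c).2 then 0 else (boundTerm i j c).1

/-- The arguments of the terms that are not large. -/
def keys : Finset (ℤ × ℤ) :=
  {(0, 0), (1, 0), (1, 1), (2, 0), (2, 1), (2, 2), (3, 0), (3, 1), (3, 2), (4, -1)}

theorem mem_keys : ∀ i j c, coef i j c ≠ 0 → (boundTerm i j c).2 ∈ keys := by decide +kernel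

/-- This cancellation makes the configuration optimal: only the weights `0`, `3r` and `4r - 1`
survive, matching the three terms of the bound. -/
theorem sum_coef : ∀ w ∈ keys,
    (∑ i, ∑ j, ∑ c, if (boundTerm i j c).2 = w then coef i j c else 0) =
      if w = (0, 0) ∨ w = (3, 0) ∨ w = (4, -1) then 3 else 0 := by
  decide +kernel

theorem sum_boundTerm (F : ℤ × ℤ → ℤ) (hF : ∀ w, Large w → F w = 0) :
    (∑ i, ∑ j, if i = j ∨ Aligned i j then 0 else
      ∑ c, (boundTerm i j c).1 * F (boundTerm i j c).2) =
      3 * (F (0, 0) + F (3, 0) + F (4, -1)) := by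
  have h1 : ∀ i j, (if i = j ∨ Aligned i j then 0 else
      ∑ c, (boundTerm i j c).1 * F (boundTerm i j c).2) =
      ∑ c, ∑ w ∈ keys, (if (boundTerm i j c).2 = w then coef i j c else 0) * F w := by
    intro i j
    have h2 : ∀ c, ∑ w ∈ keys, (if (boundTerm i j c).2 = w then coef i j c else 0) * F w =
        coef i j c * F (boundTerm i j c).2 := by
      intro c
      simp only [ite_mul, zero_mul]
      rw [sum_ite_eq]
      split_ifs with h
      · rfl
      · by_contra hne
        exact h (mem_keys i j c fun h0 => hne (by rw [h0, zero_mul]))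
    simp only [h2]
    split_ifs with h
    · refine (sum_eq_zero fun c _ => ?_).symm
      have h3 : i = j ∨ Aligned i j ∨ Large (boundTerm i j c).2 := by tauto
      rw [coef, if_pos h3, zero_mul]
    · refine sum_congr rfl fun c _ => ?_
      by_cases hL : Large (boundTerm i j c).2
      · rw [hF _ hL, mul_zero, mul_zero]
      · rw [coef, if_neg (by tauto)]
  have h4 : ∀ w ∈ keys,
      ∑ i, ∑ j, ∑ c, (if (boundTerm i j c).2 = w then coef i j c else 0) * F w =
      (if w = (0, 0) ∨ w = (3, 0) ∨ w = (4, -1) then 3 else 0) * F w := by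
    intro w hw
    simp only [← sum_mul]
    rw [sum_coef w hw]
  calc _ = ∑ i, ∑ j, ∑ c, ∑ w ∈ keys,
        (if (boundTerm i j c).2 = w then coef i j c else 0) * F w := by simp only [h1]
    _ = ∑ w ∈ keys, ∑ i, ∑ j, ∑ c,
        (if (boundTerm i j c).2 = w then coef i j c else 0) * F w := by
      symm
      rw [sum_comm]
      refine sum_congr rfl fun i _ => ?_
      rw [sum_comm]
      refine sum_congr rfl fun j _ => ?_
      rw [sum_comm]
    _ = ∑ w ∈ keys, (if w = (0, 0) ∨ w = (3, 0) ∨ w = (4, -1) then 3 else 0) * F w :=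
      sum_congr rfl h4
    _ = 3 * (F (0, 0) + F (3, 0) + F (4, -1)) := by
      simp [keys]
      ring

end ClusterConfig

/-! ### Clusters on flat parabolas and general position -/

namespace ClusterConfig

/-- The dot product of integer vectors. -/
def dotZ (u v : ℤ × ℤ) : ℤ := u.1 * v.1 + u.2 * v.2

/-- The number of points of a cluster. -/
def clusterCard (r : ℕ) (i : Fin 15) : ℕ := ((size i).1 * r + (size i).2).toNat

/-- The indices of the points: a cluster and a position in the cluster. -/
def indices (r : ℕ) : Finset (Σ _ : Fin 15, ℕ) := univ.sigma fun i => range (clusterCard r i)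

/-- The parameter of a point of a cluster. -/
def param (r s : ℕ) : ℤ := 2 * r - 5 - 4 * s

variable (r : ℕ) (x y z : Σ _ : Fin 15, ℕ)

/-- The points of the configuration, in clusters of size `ε`, each on a flat parabola. -/
noncomputable def pt (ε : ℝ) (x : Σ _ : Fin 15, ℕ) : Plane :=
  !₂[(base x.1).1 + ε * (param r x.2 * (dir x.1).1) - ε ^ 3 * (param r x.2 ^ 2 * (dir x.1).2),
    (base x.1).2 + ε * (param r x.2 * (dir x.1).2) + ε ^ 3 * (param r x.2 ^ 2 * (dir x.1).1)]

/-- The coefficient of `ε` in the orientation of three points. -/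
def coeffOne : ℤ :=
  crossZ (dir x.1) (base y.1 - base z.1) * param r x.2 +
    crossZ (dir y.1) (base z.1 - base x.1) * param r y.2 +
    crossZ (dir z.1) (base x.1 - base y.1) * param r z.2

/-- The coefficient of `ε ^ 2` in the orientation of three points. -/
def coeffTwo : ℤ :=
  crossZ (dir x.1) (dir y.1) * (param r x.2 * param r y.2) +
    crossZ (dir y.1) (dir z.1) * (param r y.2 * param r z.2) +
    crossZ (dir z.1) (dir x.1) * (param r z.2 * param r x.2)

/-- The coefficient of `ε ^ 3` in the orientation of three points. -/
def coeffThree : ℤ :=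
  -(dotZ (dir x.1) (base y.1 - base z.1) * param r x.2 ^ 2 +
    dotZ (dir y.1) (base z.1 - base x.1) * param r y.2 ^ 2 +
    dotZ (dir z.1) (base x.1 - base y.1) * param r z.2 ^ 2)

/-- The coefficient of `ε ^ 4` in the orientation of three points. -/
def coeffFour : ℤ :=
  dotZ (dir x.1) (dir y.1) * (param r x.2 * param r y.2 * (param r y.2 - param r x.2)) +
    dotZ (dir y.1) (dir z.1) * (param r y.2 * param r z.2 * (param r z.2 - param r y.2)) +
    dotZ (dir z.1) (dir x.1) * (param r z.2 * param r x.2 * (param r x.2 - param r z.2))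

/-- The coefficient of `ε ^ 6` in the orientation of three points. -/
def coeffSix : ℤ :=
  crossZ (dir x.1) (dir y.1) * (param r x.2 * param r y.2) ^ 2 +
    crossZ (dir y.1) (dir z.1) * (param r y.2 * param r z.2) ^ 2 +
    crossZ (dir z.1) (dir x.1) * (param r z.2 * param r x.2) ^ 2

theorem orient_pt (ε : ℝ) : orient (pt r ε x) (pt r ε y) (pt r ε z) =
    orientZ x.1 y.1 z.1 + coeffOne r x y z * ε + coeffTwo r x y z * ε ^ 2 +
      coeffThree r x y z * ε ^ 3 + coeffFour r x y z * ε ^ 4 + coeffSix r x y z * ε ^ 6 := by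
  simp only [orient, pt, orientZ, coeffOne, coeffTwo, coeffThree, coeffFour, coeffSix, crossZ, dotZ,
    PiLp.toLp_apply, Matrix.cons_val_zero, Matrix.cons_val_one, Prod.fst_sub, Prod.snd_sub]
  push_cast
  ring

/-- The orientation of three points is positive for all small `ε`. -/
def Pos : Prop :=
  0 < orientZ x.1 y.1 z.1 ∨ orientZ x.1 y.1 z.1 = 0 ∧ (0 < coeffOne r x y z ∨
    coeffOne r x y z = 0 ∧ (0 < coeffTwo r x y z ∨
      coeffTwo r x y z = 0 ∧ coeffThree r x y z = 0 ∧ 0 < coeffFour r x y z))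

instance : Decidable (Pos r x y z) := inferInstanceAs (Decidable (_ ∨ _))

variable {r x y z}

/-- The orientation is a polynomial in `ε`, and its first nonzero coefficient decides the sign. -/
theorem Pos.eventually (h : Pos r x y z) :
    ∀ᶠ ε : ℝ in 𝓝[>] 0, 0 < orient (pt r ε x) (pt r ε y) (pt r ε z) := by
  simp only [orient_pt]
  have key : ∀ (m : ℕ) (c : ℝ) (g : ℝ → ℝ), 0 < c → Continuous g → g 0 = 0 →
      ∀ᶠ ε : ℝ in 𝓝[>] 0, 0 < ε ^ m * (c + g ε) := by
    intro m c g hc hg hg0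
    have hcont : ContinuousAt (fun ε => c + g ε) 0 := by fun_prop
    have h1 : ∀ᶠ ε : ℝ in 𝓝[>] 0, 0 < c + g ε :=
      (hcont.eventually (lt_mem_nhds (by simpa [hg0] using hc))).filter_mono nhdsWithin_le_nhds
    filter_upwards [h1, self_mem_nhdsWithin] with ε hε hε0
    exact mul_pos (pow_pos hε0 m) hε
  rcases h with h | ⟨h0, h | ⟨h1, h | ⟨h2, h3, h⟩⟩⟩
  · refine (key 0 _ (fun ε => coeffOne r x y z * ε + coeffTwo r x y z * ε ^ 2 +
      coeffThree r x y z * ε ^ 3 + coeffFour r x y z * ε ^ 4 + coeffSix r x y z * ε ^ 6)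
      (Int.cast_pos.2 h) (by fun_prop) (by simp)).mono fun ε hε => ?_
    exact hε.trans_eq (by ring)
  · refine (key 1 _ (fun ε => coeffTwo r x y z * ε +
      coeffThree r x y z * ε ^ 2 + coeffFour r x y z * ε ^ 3 + coeffSix r x y z * ε ^ 5)
      (Int.cast_pos.2 h) (by fun_prop) (by simp)).mono fun ε hε => ?_
    rw [h0]
    exact hε.trans_eq (by push_cast; ring)
  · refine (key 2 _ (fun ε => coeffThree r x y z * ε + coeffFour r x y z * ε ^ 2 +
      coeffSix r x y z * ε ^ 4)
      (Int.cast_pos.2 h) (by fun_prop) (by simp)).mono fun ε hε => ?_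
    rw [h0, h1]
    exact hε.trans_eq (by push_cast; ring)
  · refine (key 4 _ (fun ε => coeffSix r x y z * ε ^ 2)
      (Int.cast_pos.2 h) (by fun_prop) (by simp)).mono fun ε hε => ?_
    rw [h0, h1, h2, h3]
    exact hε.trans_eq (by push_cast; ring)

variable (r x y z)

/-- The leading coefficient of the orientation of three points does not vanish. -/
def Nondegenerate : Prop :=
  orientZ x.1 y.1 z.1 ≠ 0 ∨ coeffOne r x y z ≠ 0 ∨ coeffTwo r x y z ≠ 0 ∨
    coeffThree r x y z = 0 ∧ coeffFour r x y z ≠ 0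

theorem orientZ_rotate (i j k : Fin 15) : orientZ j k i = orientZ i j k := by
  simp only [orientZ, crossZ, Prod.fst_sub, Prod.snd_sub]; ring

theorem orientZ_swap (i j k : Fin 15) : orientZ j i k = -orientZ i j k := by
  simp only [orientZ, crossZ, Prod.fst_sub, Prod.snd_sub]; ring

theorem orientZ_self (i k : Fin 15) : orientZ i i k = 0 := by
  simp [orientZ, crossZ]

theorem orientZ_self_left (i k : Fin 15) : orientZ i k i = 0 := by
  simp [orientZ, crossZ]

theorem orientZ_self_right (i k : Fin 15) : orientZ i k k = 0 := by
  simp only [orientZ, crossZ]; ring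

variable {r x y z}

theorem Nondegenerate.rotate (h : Nondegenerate r x y z) : Nondegenerate r y z x := by
  have e1 : coeffOne r y z x = coeffOne r x y z := by unfold coeffOne; ring
  have e2 : coeffTwo r y z x = coeffTwo r x y z := by unfold coeffTwo; ring
  have e3 : coeffThree r y z x = coeffThree r x y z := by unfold coeffThree; ring
  have e4 : coeffFour r y z x = coeffFour r x y z := by unfold coeffFour; ring
  unfold Nondegenerate at *
  rwa [orientZ_rotate, e1, e2, e3, e4]

theorem Nondegenerate.pos_or (h : Nondegenerate r x y z) : Pos r x y z ∨ Pos r y x z := by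
  have e0 := orientZ_swap x.1 y.1 z.1
  have e1 : coeffOne r y x z = -coeffOne r x y z := by
    simp only [coeffOne, crossZ, Prod.fst_sub, Prod.snd_sub]; ring
  have e2 : coeffTwo r y x z = -coeffTwo r x y z := by
    simp only [coeffTwo, crossZ]; ring
  have e3 : coeffThree r y x z = -coeffThree r x y z := by
    simp only [coeffThree, dotZ, Prod.fst_sub, Prod.snd_sub]; ring
  have e4 : coeffFour r y x z = -coeffFour r x y z := by
    simp only [coeffFour, dotZ]; ring
  unfold Nondegenerate at h
  unfold Pos
  rw [e0, e1, e2, e3, e4]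
  omega

/-- If the center of `k` lies on the chord line, the third point is moved off it at second order,
because its parameter is odd and hence nonzero. -/
theorem nondegenerate_of_fst_eq {i k : Fin 15} {s t v : ℕ} (hik : i ≠ k) (hi : dir i ≠ 0)
    (hst : s ≠ t) : Nondegenerate r ⟨i, s⟩ ⟨i, t⟩ ⟨k, v⟩ := by
  have hp : param r s - param r t ≠ 0 := by unfold param; omega
  have hv : param r v ≠ 0 := by unfold param; omega
  rcases chord_transversal i k hik hi with h | h
  · refine Or.inr (Or.inl ?_)
    have e : coeffOne r ⟨i, s⟩ ⟨i, t⟩ ⟨k, v⟩ =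
        crossZ (dir i) (base i - base k) * (param r s - param r t) := by
      simp only [coeffOne, crossZ, Prod.fst_sub, Prod.snd_sub]; ring
    rw [e]
    exact mul_ne_zero h hp
  · refine Or.inr (Or.inr (Or.inl ?_))
    have e : coeffTwo r ⟨i, s⟩ ⟨i, t⟩ ⟨k, v⟩ =
        -(crossZ (dir i) (dir k) * param r v * (param r s - param r t)) := by
      simp only [coeffTwo, crossZ]; ring
    rw [e]
    exact neg_ne_zero.2 (mul_ne_zero (mul_ne_zero h hv) hp)

/-- The sum of two parameters is `2` modulo `4`, so it never vanishes; this is why the parameters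
are shifted off center. -/
theorem nondegenerate_of_fst_ne {i j k : Fin 15} {s t v : ℕ} (hij : i ≠ j) (hik : i ≠ k)
    (hjk : j ≠ k) : Nondegenerate r ⟨i, s⟩ ⟨j, t⟩ ⟨k, v⟩ := by
  by_cases h0 : orientZ i j k = 0
  · refine Or.inr (Or.inl ?_)
    have hp : ∀ a b : ℕ, param r a + param r b ≠ 0 := fun a b => by unfold param; omega
    simp only [coeffOne]
    rcases collinear_cases i j k hij hik hjk h0 with ⟨h1, h2, h3⟩ | ⟨h1, h2, h3⟩ | ⟨h1, h2, h3⟩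
    · rw [h1, h2, zero_mul, zero_add, ← mul_add]
      exact mul_ne_zero h3 (hp t v)
    · rw [h1, h2, zero_mul, add_zero, ← mul_add]
      exact mul_ne_zero h3 (hp s v)
    · rw [h1, h2, zero_mul, add_zero, ← mul_add]
      exact mul_ne_zero h3 (hp s t)
  · exact Or.inl h0

/-- Points of a parabola are never collinear: the `ε ^ 4` coefficient is a Vandermonde product times
the squared length of `dir i`. -/
theorem nondegenerate_of_fst_eq_fst {i : Fin 15} {s t v : ℕ} (hi : dir i ≠ 0)
    (hst : s ≠ t) (hsv : s ≠ v) (htv : t ≠ v) : Nondegenerate r ⟨i, s⟩ ⟨i, t⟩ ⟨i, v⟩ := by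
  refine Or.inr (Or.inr (Or.inr ⟨?_, ?_⟩))
  · simp [coeffThree, dotZ]
  · have e : coeffFour r ⟨i, s⟩ ⟨i, t⟩ ⟨i, v⟩ = dotZ (dir i) (dir i) *
        ((param r t - param r s) * (param r v - param r s) * (param r v - param r t)) := by
      simp only [coeffFour]; ring
    rw [e]
    refine mul_ne_zero ?_ (mul_ne_zero (mul_ne_zero ?_ ?_) ?_)
    · intro h
      simp only [dotZ] at h
      refine hi (Prod.ext ?_ ?_) <;> simp only [Prod.fst_zero, Prod.snd_zero] <;> nlinarith
    all_goals unfold param; omega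

theorem clusterCard_cast (hr : 3 ≤ r) (i : Fin 15) :
    (clusterCard r i : ℤ) = (size i).1 * r + (size i).2 := by
  unfold clusterCard
  rcases size_cases i with h | h | ⟨h, -⟩ <;> rw [h] <;> simp
  omega

theorem dir_ne_zero_of_lt (hr : 3 ≤ r) {i : Fin 15} {s t : ℕ} (hs : s < clusterCard r i)
    (ht : t < clusterCard r i) (hst : s ≠ t) : dir i ≠ 0 := by
  intro h0
  have h1 := clusterCard_cast hr i
  have h2 : ∀ i, dir i = 0 → size i = (0, 1) := by decide +kernel
  rw [h2 i h0] at h1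
  simp at h1
  omega

theorem nondegenerate (hr : 3 ≤ r) (hx : x ∈ indices r) (hy : y ∈ indices r) (hz : z ∈ indices r)
    (hxy : x ≠ y) (hxz : x ≠ z) (hyz : y ≠ z) : Nondegenerate r x y z := by
  obtain ⟨i, s⟩ := x
  obtain ⟨j, t⟩ := y
  obtain ⟨k, v⟩ := z
  simp only [indices, mem_sigma, mem_univ, true_and, mem_range] at hx hy hz
  by_cases hij : i = j
  · subst hij
    have hst : s ≠ t := fun h => hxy (by rw [h])
    have hi := dir_ne_zero_of_lt hr hx hy hst
    by_cases hik : i = k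
    · subst hik
      exact nondegenerate_of_fst_eq_fst hi hst (fun h => hxz (by rw [h])) fun h => hyz (by rw [h])
    · exact nondegenerate_of_fst_eq hik hi hst
  by_cases hik : i = k
  · subst hik
    have hst : v ≠ s := fun h => hxz (by rw [h])
    exact (nondegenerate_of_fst_eq hij (dir_ne_zero_of_lt hr hz hx hst) hst).rotate
  by_cases hjk : j = k
  · subst hjk
    have hst : t ≠ v := fun h => hyz (by rw [h])
    exact (nondegenerate_of_fst_eq (Ne.symm hij)
      (dir_ne_zero_of_lt hr hy hz hst) hst).rotate.rotate
  exact nondegenerate_of_fst_ne hij hik hjk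

end ClusterConfig

/-! ### Lower bounds for the number of points on the left -/

namespace ClusterConfig

/-- The number of points of the configuration to the left of two of its points. -/
def leftIdx (r : ℕ) (x y : Σ _ : Fin 15, ℕ) : ℕ := #{z ∈ indices r | Pos r x y z}

/-- The number of points of the cluster `k` to the left of two points. -/
def leftIdxIn (r : ℕ) (x y : Σ _ : Fin 15, ℕ) (k : Fin 15) : ℕ :=
  #{v ∈ range (clusterCard r k) | Pos r x y ⟨k, v⟩}

variable {r : ℕ} {x y : Σ _ : Fin 15, ℕ}

theorem leftIdx_eq_sum (r : ℕ) (x y : Σ _ : Fin 15, ℕ) :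
    leftIdx r x y = ∑ k, leftIdxIn r x y k := by
  simp only [leftIdx, leftIdxIn, card_filter, indices, sum_sigma]

theorem leftIdxIn_eq {k : Fin 15} (h : ∀ v, Pos r x y ⟨k, v⟩) :
    leftIdxIn r x y k = clusterCard r k := by
  simp [leftIdxIn, h]

/-- Lower bounds on left counts suffice, as few pairs are wanted. Clusters entirely on the left
count in full; those in `A`, met by the line, are estimated separately. -/
theorem sum_le_leftIdx (A : Finset (Fin 15)) (q : Fin 15 → Prop) [DecidablePred q]
    (hA : ∀ k ∈ A, ¬ q k) (hq : ∀ k, q k → ∀ v, Pos r x y ⟨k, v⟩) :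
    (∑ k, if q k then clusterCard r k else 0) + ∑ k ∈ A, leftIdxIn r x y k ≤ leftIdx r x y := by
  rw [leftIdx_eq_sum, ← sum_ite_mem_eq A, ← sum_add_distrib]
  refine sum_le_sum fun k _ => ?_
  by_cases hk : q k
  · rw [if_pos hk, if_neg fun h => hA k h hk, leftIdxIn_eq (hq k hk), add_zero]
  · rw [if_neg hk, zero_add]
    split_ifs
    · exact le_rfl
    · exact Nat.zero_le _

theorem sum_clusterCard_cast (hr : 3 ≤ r) (q : Fin 15 → Prop) [DecidablePred q] :
    ((∑ k, if q k then clusterCard r k else 0 : ℕ) : ℤ) =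
      (∑ k, if q k then size k else 0).1 * r + (∑ k, if q k then size k else 0).2 := by
  rw [Prod.fst_sum, Prod.snd_sum, sum_mul, ← sum_add_distrib]
  push_cast
  refine sum_congr rfl fun k _ => ?_
  split_ifs
  · exact clusterCard_cast hr k
  · simp

theorem le_leftIdxIn_of_lt {k : Fin 15} {m : ℕ} (hm : m ≤ clusterCard r k)
    (h : ∀ v < m, Pos r x y ⟨k, v⟩) : m ≤ leftIdxIn r x y k := by
  have : range m ⊆ {v ∈ range (clusterCard r k) | Pos r x y ⟨k, v⟩} := by
    intro v hv
    rw [mem_range] at hv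
    exact mem_filter.2 ⟨mem_range.2 (by omega), h v hv⟩
  have := card_le_card this
  rwa [card_range] at this

theorem le_leftIdxIn_of_ge {k : Fin 15} {m : ℕ}
    (h : ∀ v, m ≤ v → Pos r x y ⟨k, v⟩) : clusterCard r k - m ≤ leftIdxIn r x y k := by
  have : Ico m (clusterCard r k) ⊆ {v ∈ range (clusterCard r k) | Pos r x y ⟨k, v⟩} := by
    intro v hv
    rw [mem_Ico] at hv
    exact mem_filter.2 ⟨mem_range.2 hv.2, h v hv.1⟩
  have := card_le_card this
  rwa [Nat.card_Ico] at this

/-- The position of the point `s` of a cluster of `n` points, seen from the left or the right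
according to the sign of `a`. -/
def rank (a : ℤ) (n s : ℕ) : ℕ := if 0 < a then s else n - 1 - s

theorem rank_le_leftIdxIn {i : Fin 15} {a : ℤ} {s : ℕ} (hs : s < clusterCard r i)
    (ha : a ≠ 0 ∨ clusterCard r i = 1) (h : ∀ v : ℕ, 0 < a * ((s : ℤ) - v) → Pos r x y ⟨i, v⟩) :
    rank a (clusterCard r i) s ≤ leftIdxIn r x y i := by
  unfold rank
  split_ifs with h0
  · exact le_leftIdxIn_of_lt hs.le fun v hv => h v (mul_pos h0 (by omega))
  · by_cases h1 : a = 0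
    · have := ha.resolve_left (not_not.2 h1)
      omega
    · have := le_leftIdxIn_of_ge (r := r) (x := x) (y := y) (k := i) (m := s + 1)
        fun v hv => h v (mul_pos_of_neg_of_neg (by omega) (by omega))
      omega

theorem pos_of_coeffOne {z : Σ _ : Fin 15, ℕ} (h0 : orientZ x.1 y.1 z.1 = 0)
    (h : 0 < coeffOne r x y z) : Pos r x y z := Or.inr ⟨h0, Or.inl h⟩

theorem pos_left_of_mul_pos {i j : Fin 15} {s t v : ℕ}
    (h : 0 < crossZ (dir i) (base i - base j) * ((s : ℤ) - v)) :
    Pos r ⟨i, s⟩ ⟨j, t⟩ ⟨i, v⟩ := by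
  refine pos_of_coeffOne (orientZ_self_left i j) ?_
  have e : coeffOne r ⟨i, s⟩ ⟨j, t⟩ ⟨i, v⟩ =
      4 * (crossZ (dir i) (base i - base j) * ((s : ℤ) - v)) := by
    simp only [coeffOne, crossZ, Prod.fst_sub, Prod.snd_sub, param]; ring
  rw [e]
  omega

theorem pos_right_of_mul_pos {i j : Fin 15} {s t v : ℕ}
    (h : 0 < crossZ (dir j) (base i - base j) * ((t : ℤ) - v)) :
    Pos r ⟨i, s⟩ ⟨j, t⟩ ⟨j, v⟩ := by
  refine pos_of_coeffOne (orientZ_self_right i j) ?_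
  have e : coeffOne r ⟨i, s⟩ ⟨j, t⟩ ⟨j, v⟩ =
      4 * (crossZ (dir j) (base i - base j) * ((t : ℤ) - v)) := by
    simp only [coeffOne, crossZ, Prod.fst_sub, Prod.snd_sub, param]; ring
  rw [e]
  omega

theorem pos_of_orientZ_pos {z : Σ _ : Fin 15, ℕ} (h : 0 < orientZ x.1 y.1 z.1) : Pos r x y z :=
  Or.inl h

theorem clusterCard_eq_one (hr : 3 ≤ r) {i : Fin 15} (hi : dir i = 0) : clusterCard r i = 1 := by
  have h2 : ∀ i, dir i = 0 → size i = (0, 1) := by decide +kernel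
  have h1 := clusterCard_cast hr i
  rw [h2 i hi] at h1
  simp at h1
  omega

theorem clusterCard_eq_sub_one (hr : 3 ≤ r) {i : Fin 15} (hi : size i = (1, -1)) :
    clusterCard r i = r - 1 := by
  have h1 := clusterCard_cast hr i
  rw [hi] at h1
  simp at h1
  omega

theorem weight_cast (hr : 3 ≤ r) (i j : Fin 15) :
    ((∑ k, if 0 < orientZ i j k then clusterCard r k else 0 : ℕ) : ℤ) =
      (weight i j).1 * r + (weight i j).2 :=
  sum_clusterCard_cast hr _

/-- The number of points to the left of a pair of points in generic clusters. -/
theorem le_leftIdx_of_not_aligned (hr : 3 ≤ r) {i j : Fin 15} (hij : i ≠ j) (h : ¬ Aligned i j)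
    {s t : ℕ} (hs : s < clusterCard r i) (ht : t < clusterCard r j) :
    (weight i j).1 * r + (weight i j).2 +
      rank (crossZ (dir i) (base i - base j)) (clusterCard r i) s +
      rank (crossZ (dir j) (base i - base j)) (clusterCard r j) t ≤
      (leftIdx r ⟨i, s⟩ ⟨j, t⟩ : ℤ) := by
  have h1 := sum_le_leftIdx (r := r) (x := ⟨i, s⟩) (y := ⟨j, t⟩) {i, j}
    (fun k => 0 < orientZ i j k) (by simp [orientZ_self_left, orientZ_self_right])
    (fun k hk v => pos_of_orientZ_pos hk)
  rw [sum_pair hij] at h1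
  have h2 : rank (crossZ (dir i) (base i - base j)) (clusterCard r i) s ≤ _ :=
    rank_le_leftIdxIn (r := r) (x := ⟨i, s⟩) (y := ⟨j, t⟩) hs (by
      by_cases h0 : dir i = 0
      · exact Or.inr (clusterCard_eq_one hr h0)
      · exact Or.inl fun h3 => h (Or.inl ⟨h0, h3⟩)) fun v => pos_left_of_mul_pos
  have h3 : rank (crossZ (dir j) (base i - base j)) (clusterCard r j) t ≤ _ :=
    rank_le_leftIdxIn (r := r) (x := ⟨i, s⟩) (y := ⟨j, t⟩) ht (by
      by_cases h0 : dir j = 0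
      · exact Or.inr (clusterCard_eq_one hr h0)
      · exact Or.inl fun h3 => h (Or.inr ⟨h0, h3⟩)) fun v => pos_right_of_mul_pos
  rw [← weight_cast hr]
  omega

/-- A point `v` of `k` has `ε` coefficient proportional to `4(r - t - v) - 10`, with sign change at
`v = r - 2 - t`. So `j` and `k` contribute `t + (r - 2 - t)` to `3r + 2`, or `(r - 2 - t) + (t + 1)`
to `3r + 1`. -/
theorem four_mul_le_leftIdx_of_aligned_left (hr : 3 ≤ r) {i j : Fin 15} (hij : i ≠ j)
    (hi : dir i ≠ 0) (h : crossZ (dir i) (base i - base j) = 0) {s t : ℕ}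
    (ht : t < clusterCard r j) : 4 * r ≤ leftIdx r ⟨i, s⟩ ⟨j, t⟩ := by
  obtain ⟨hj, k, hki, hkj, h0, hk, h1, h2, h3⟩ := aligned_cases i j hij hi h
  have hs := sum_le_leftIdx (r := r) (x := ⟨i, s⟩) (y := ⟨j, t⟩) {j, k}
    (fun k => 0 < orientZ i j k) (by simp [orientZ_self_right, h0])
    (fun k hk v => pos_of_orientZ_pos hk)
  rw [sum_pair hkj.symm] at hs
  have hw := weight_cast hr i j
  have hjr : rank (crossZ (dir j) (base i - base j)) (clusterCard r j) t ≤ _ :=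
    rank_le_leftIdxIn (r := r) (x := ⟨i, s⟩) (y := ⟨j, t⟩) ht
      (Or.inl (by rcases h3 with h3 | h3 <;> omega)) fun v => pos_right_of_mul_pos
  have hcj := clusterCard_eq_sub_one hr hj
  have hck := clusterCard_eq_sub_one hr hk
  have hone : ∀ v : ℕ, coeffOne r ⟨i, s⟩ ⟨j, t⟩ ⟨k, v⟩ =
      crossZ (dir k) (base i - base j) * (4 * ((r : ℤ) - t - v) - 10) := by
    intro v
    simp only [coeffOne, h1, h2, param]; ring
  rw [hcj] at ht
  rcases h3 with ⟨h3, h4, h5⟩ | ⟨h3, h4, h5⟩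
  · have hkr : r - 2 - t ≤ _ := le_leftIdxIn_of_lt (r := r) (x := ⟨i, s⟩) (y := ⟨j, t⟩) (k := k)
      (by omega) fun v hv => pos_of_coeffOne h0 (by rw [hone]; exact mul_pos h3 (by omega))
    rw [h5] at hw
    rw [rank, if_pos h4] at hjr
    simp only at hw
    omega
  · have hkr := le_leftIdxIn_of_ge (r := r) (x := ⟨i, s⟩) (y := ⟨j, t⟩) (k := k) (m := r - 2 - t)
      fun v hv => pos_of_coeffOne h0 (by
        rw [hone]; exact mul_pos_of_neg_of_neg h3 (by omega))
    rw [h5] at hw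
    rw [rank, if_neg (by omega)] at hjr
    simp only at hw
    omega

theorem four_mul_le_leftIdx_of_aligned_right (hr : 3 ≤ r) {i j : Fin 15} (hij : i ≠ j)
    (hj : dir j ≠ 0) (h : crossZ (dir j) (base i - base j) = 0) {s t : ℕ}
    (hs : s < clusterCard r i) : 4 * r ≤ leftIdx r ⟨i, s⟩ ⟨j, t⟩ := by
  obtain ⟨hi, k, hki, hkj, h0, hk, h1, h2, h3⟩ := aligned_cases' i j hij hj h
  have hsum := sum_le_leftIdx (r := r) (x := ⟨i, s⟩) (y := ⟨j, t⟩) {i, k}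
    (fun k => 0 < orientZ i j k) (by simp [orientZ_self_left, h0])
    (fun k hk v => pos_of_orientZ_pos hk)
  rw [sum_pair hki.symm] at hsum
  have hw := weight_cast hr i j
  have hir : rank (crossZ (dir i) (base i - base j)) (clusterCard r i) s ≤ _ :=
    rank_le_leftIdxIn (r := r) (x := ⟨i, s⟩) (y := ⟨j, t⟩) hs
      (Or.inl (by rcases h3 with h3 | h3 <;> omega)) fun v => pos_left_of_mul_pos
  have hci := clusterCard_eq_sub_one hr hi
  have hck := clusterCard_eq_sub_one hr hk
  have hone : ∀ v : ℕ, coeffOne r ⟨i, s⟩ ⟨j, t⟩ ⟨k, v⟩ =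
      crossZ (dir k) (base i - base j) * (4 * ((r : ℤ) - s - v) - 10) := by
    intro v
    simp only [coeffOne, h1, h2, param]; ring
  rw [hci] at hs
  rcases h3 with ⟨h3, h4, h5⟩ | ⟨h3, h4, h5⟩
  · have hkr : r - 2 - s ≤ _ := le_leftIdxIn_of_lt (r := r) (x := ⟨i, s⟩) (y := ⟨j, t⟩) (k := k)
      (by omega) fun v hv => pos_of_coeffOne h0 (by rw [hone]; exact mul_pos h3 (by omega))
    rw [h5] at hw
    rw [rank, if_pos h4] at hir
    simp only at hw
    omega
  · have hkr := le_leftIdxIn_of_ge (r := r) (x := ⟨i, s⟩) (y := ⟨j, t⟩) (k := k) (m := r - 2 - s)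
      fun v hv => pos_of_coeffOne h0 (by
        rw [hone]; exact mul_pos_of_neg_of_neg h3 (by omega))
    rw [h5] at hw
    rw [rank, if_neg (by omega)] at hir
    simp only at hw
    omega

/-- The line through two points of one cluster halves the configuration. -/
theorem four_mul_le_leftIdx_of_fst_eq (hr : 3 ≤ r) {i : Fin 15} (hi : dir i ≠ 0) {s t : ℕ}
    (hst : s ≠ t) : 4 * r ≤ leftIdx r ⟨i, s⟩ ⟨i, t⟩ := by
  obtain ⟨c, hc, ht⟩ : ∃ c ∈ ({1, -1} : Finset ℤ), 0 < c * ((t : ℤ) - s) := by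
    rcases lt_or_gt_of_ne hst with h | h
    · exact ⟨1, by simp, by omega⟩
    · exact ⟨-1, by simp, by omega⟩
  have hc2 : c * c = 1 := by
    rw [mem_insert, mem_singleton] at hc
    rcases hc with rfl | rfl <;> rfl
  have hone : ∀ k v, coeffOne r ⟨i, s⟩ ⟨i, t⟩ ⟨k, v⟩ =
      4 * ((c * crossZ (dir i) (base i - base k)) * (c * ((t : ℤ) - s))) := by
    intro k v
    simp only [coeffOne, crossZ, Prod.fst_sub, Prod.snd_sub, param]
    linear_combination (-4 * ((t : ℤ) - s) * ((dir i).1 * ((base i).2 - (base k).2) -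
      (dir i).2 * ((base i).1 - (base k).1))) * hc2
  have htwo : ∀ k v, coeffTwo r ⟨i, s⟩ ⟨i, t⟩ ⟨k, v⟩ =
      4 * (-((c * crossZ (dir i) (dir k)) * param r v) * (c * ((t : ℤ) - s))) := by
    intro k v
    simp only [coeffTwo, crossZ, param]
    linear_combination (4 * ((t : ℤ) - s) * ((dir i).1 * (dir k).2 -
      (dir i).2 * (dir k).1) * (2 * r - 5 - 4 * v)) * hc2
  have hpos : ∀ k, 0 < c * crossZ (dir i) (base i - base k) → ∀ v,
      Pos r ⟨i, s⟩ ⟨i, t⟩ ⟨k, v⟩ := by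
    intro k hk v
    refine pos_of_coeffOne (orientZ_self i k) ?_
    rw [hone]
    have := mul_pos hk ht
    omega
  have hcast := sum_clusterCard_cast hr (fun k => 0 < c * crossZ (dir i) (base i - base k))
  change _ = (chordWeight i c).1 * (r : ℤ) + (chordWeight i c).2 at hcast
  rcases chordWeight_cases i hi c hc with h | h | ⟨k, l, hik, hil, hkl, hk, hl, hk0, hl0, h⟩
  · have hs := sum_le_leftIdx (r := r) (x := ⟨i, s⟩) (y := ⟨i, t⟩) ∅ _ (by simp) hpos
    rw [h] at hcast
    simp only at hcast
    omega
  · have hs := sum_le_leftIdx (r := r) (x := ⟨i, s⟩) (y := ⟨i, t⟩) ∅ _ (by simp) hpos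
    rw [h] at hcast
    simp only at hcast
    omega
  · have hs := sum_le_leftIdx (r := r) (x := ⟨i, s⟩) (y := ⟨i, t⟩) {k, l} _
      (by simp [hk0, hl0]) hpos
    rw [sum_pair hkl] at hs
    have hck := clusterCard_eq_sub_one hr hk
    have hcl := clusterCard_eq_sub_one hr hl
    have hpos2 : ∀ k, crossZ (dir i) (base i - base k) = 0 → ∀ v,
        c * crossZ (dir i) (dir k) * param r v < 0 → Pos r ⟨i, s⟩ ⟨i, t⟩ ⟨k, v⟩ := by
      intro k hk v hv
      refine Or.inr ⟨orientZ_self i k, Or.inr ⟨?_, Or.inl ?_⟩⟩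
      · rw [hone, hk]; ring
      · rw [htwo]
        have := mul_pos (neg_pos.2 hv) ht
        omega
    -- The parameter changes sign at `(r - 1) / 2`. Two lower halves give at least `r - 2` points
    -- and two upper halves at least `r - 1`, completing `3r + 2` and `3r + 1` to `4r`.
    have hup : ∀ v : ℕ, v < (r - 1) / 2 → 0 < param r v := by
      intro v hv; unfold param; omega
    have hdown : ∀ v : ℕ, (r - 1) / 2 ≤ v → param r v < 0 := by
      intro v hv; unfold param; omega
    rcases h with ⟨h, h1, h2⟩ | ⟨h, h1, h2⟩
    · have a1 : (r - 1) / 2 ≤ _ := le_leftIdxIn_of_lt (r := r) (x := ⟨i, s⟩) (y := ⟨i, t⟩) (k := k)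
        (by omega) fun v hv => hpos2 k hk0 v (mul_neg_of_neg_of_pos h1 (hup v hv))
      have a2 : (r - 1) / 2 ≤ _ := le_leftIdxIn_of_lt (r := r) (x := ⟨i, s⟩) (y := ⟨i, t⟩) (k := l)
        (by omega) fun v hv => hpos2 l hl0 v (mul_neg_of_neg_of_pos h2 (hup v hv))
      rw [h] at hcast
      simp only at hcast
      omega
    · have a1 := le_leftIdxIn_of_ge (r := r) (x := ⟨i, s⟩) (y := ⟨i, t⟩) (k := k)
        fun v hv => hpos2 k hk0 v (mul_neg_of_pos_of_neg h1 (hdown v hv))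
      have a2 := le_leftIdxIn_of_ge (r := r) (x := ⟨i, s⟩) (y := ⟨i, t⟩) (k := l)
        fun v hv => hpos2 l hl0 v (mul_neg_of_pos_of_neg h2 (hdown v hv))
      rw [h] at hcast
      simp only at hcast
      omega

end ClusterConfig

/-! ### Counting the pairs of the configuration -/

namespace ClusterConfig

variable {r : ℕ}

/-- Ranks are positions read forwards or backwards, hence a permutation of `range n`. -/
theorem sum_range_rank (a : ℤ) (n : ℕ) (f : ℕ → ℤ) :
    ∑ s ∈ range n, f (rank a n s) = ∑ s ∈ range n, f s := by
  unfold rank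
  split_ifs
  · rfl
  · exact sum_range_reflect f n

/-- The number of pairs between two clusters with few points on the left. -/
theorem two_mul_sum_le (hr : 3 ≤ r) {K : ℕ} (hK : K ≤ 4 * r) (i j : Fin 15) :
    2 * ∑ s ∈ range (clusterCard r i), ∑ t ∈ range (clusterCard r j),
      (if (⟨i, s⟩ : Σ _ : Fin 15, ℕ) ≠ ⟨j, t⟩ ∧ leftIdx r ⟨i, s⟩ ⟨j, t⟩ < K then (1 : ℤ) else 0) ≤
    if i = j ∨ Aligned i j then 0 else ∑ c, (boundTerm i j c).1 *
      twiceTriangle (K - ((boundTerm i j c).2.1 * r + (boundTerm i j c).2.2)) := by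
  split_ifs with h
  · refine le_of_eq ?_
    rw [mul_eq_zero]
    right
    refine sum_eq_zero fun s hs => sum_eq_zero fun t ht => if_neg ?_
    rintro ⟨hne, hlt⟩
    rw [mem_range] at hs ht
    by_cases hij : i = j
    · subst hij
      have hst : s ≠ t := fun e => hne (by rw [e])
      have := four_mul_le_leftIdx_of_fst_eq hr (dir_ne_zero_of_lt hr hs ht hst) hst
      omega
    · rcases h.resolve_left hij with ⟨h1, h2⟩ | ⟨h1, h2⟩
      · have := four_mul_le_leftIdx_of_aligned_left hr hij h1 h2 (s := s) ht
        omega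
      · have := four_mul_le_leftIdx_of_aligned_right hr hij h1 h2 (t := t) hs
        omega
  · have hij : i ≠ j := fun e => h (Or.inl e)
    have hal : ¬ Aligned i j := fun e => h (Or.inr e)
    set a := crossZ (dir i) (base i - base j)
    set b := crossZ (dir j) (base i - base j)
    set D : ℤ := K - ((weight i j).1 * r + (weight i j).2) with hD
    have h1 : ∑ s ∈ range (clusterCard r i), ∑ t ∈ range (clusterCard r j),
        (if (⟨i, s⟩ : Σ _ : Fin 15, ℕ) ≠ ⟨j, t⟩ ∧ leftIdx r ⟨i, s⟩ ⟨j, t⟩ < K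
          then (1 : ℤ) else 0) ≤
        ∑ s ∈ range (clusterCard r i), ∑ t ∈ range (clusterCard r j),
          (if (rank a (clusterCard r i) s : ℤ) + rank b (clusterCard r j) t < D
            then (1 : ℤ) else 0) := by
      refine sum_le_sum fun s hs => sum_le_sum fun t ht => ?_
      rw [mem_range] at hs ht
      have h4 : (weight i j).1 * r + (weight i j).2 + rank a (clusterCard r i) s +
          rank b (clusterCard r j) t ≤ (leftIdx r ⟨i, s⟩ ⟨j, t⟩ : ℤ) :=
        le_leftIdx_of_not_aligned hr hij hal hs ht
      split_ifs with h2 h3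
      · exact le_rfl
      · exact absurd (by omega) h3
      · exact zero_le_one
      · exact le_rfl
    have h2 : ∑ s ∈ range (clusterCard r i), ∑ t ∈ range (clusterCard r j),
          (if (rank a (clusterCard r i) s : ℤ) + rank b (clusterCard r j) t < D
            then (1 : ℤ) else 0) =
        ∑ s ∈ range (clusterCard r i), ∑ t ∈ range (clusterCard r j),
          (if (s : ℤ) + t < D then (1 : ℤ) else 0) := by
      rw [sum_range_rank a (clusterCard r i) (fun s' => ∑ t ∈ range (clusterCard r j),
        if (s' : ℤ) + rank b (clusterCard r j) t < D then (1 : ℤ) else 0)]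
      exact sum_congr rfl fun s _ => sum_range_rank b (clusterCard r j)
        (fun t' => if (s : ℤ) + t' < D then (1 : ℤ) else 0)
    have h3 := two_mul_sum_range_sum_range_ite (clusterCard r i) (clusterCard r j) D
    rw [h2] at h1
    refine (mul_le_mul_of_nonneg_left h1 zero_le_two).trans (le_of_eq ?_)
    rw [h3, clusterCard_cast hr, clusterCard_cast hr, Fin.sum_univ_four]
    simp only [boundTerm, Prod.fst_add, Prod.snd_add, hD]
    ring_nf

/-- The number of pairs of points of the configuration with few points on the left. -/
theorem two_mul_card_le (hr : 3 ≤ r) {K : ℕ} (hK : K ≤ 4 * r) :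
    2 * (#{p ∈ indices r ×ˢ indices r | p.1 ≠ p.2 ∧ leftIdx r p.1 p.2 < K} : ℤ) ≤
      3 * (twiceTriangle K + twiceTriangle (K - 3 * r) + twiceTriangle (K - (4 * r - 1))) := by
  have h1 := sum_boundTerm (fun w => twiceTriangle (K - (w.1 * r + w.2))) fun w hw => by
    refine twiceTriangle_of_nonpos ?_
    obtain ⟨h1, h2⟩ := hw
    have h3 : 0 ≤ (w.1 - 4) * ((r : ℤ) - 3) := mul_nonneg (by omega) (by omega)
    have h4 : (w.1 - 4) * ((r : ℤ) - 3) = w.1 * r - 3 * w.1 - 4 * r + 12 := by ring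
    omega
  have h2 : (#{p ∈ indices r ×ˢ indices r | p.1 ≠ p.2 ∧ leftIdx r p.1 p.2 < K} : ℤ) =
      ∑ i, ∑ j, ∑ s ∈ range (clusterCard r i), ∑ t ∈ range (clusterCard r j),
      (if (⟨i, s⟩ : Σ _ : Fin 15, ℕ) ≠ ⟨j, t⟩ ∧ leftIdx r ⟨i, s⟩ ⟨j, t⟩ < K
        then (1 : ℤ) else 0) := by
    rw [card_filter, sum_product]
    simp only [indices, sum_sigma]
    push_cast
    exact sum_congr rfl fun i _ => sum_comm
  rw [h2, mul_sum]
  simp only [mul_sum (s := (univ : Finset (Fin 15)))]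
  refine (sum_le_sum fun i _ => sum_le_sum fun j _ => two_mul_sum_le hr hK i j).trans ?_
  rw [h1]
  refine le_of_eq ?_
  simp only [zero_mul, add_zero, sub_zero]
  ring_nf

theorem card_indices (hr : 3 ≤ r) : #(indices r) = 9 * r := by
  have h : ((∑ i, clusterCard r i : ℕ) : ℤ) = 9 * r := by
    have h1 : (∑ i, size i).1 = 9 := by rw [sum_size]
    have h2 : (∑ i, size i).2 = 0 := by rw [sum_size]
    rw [Prod.fst_sum] at h1
    rw [Prod.snd_sum] at h2
    push_cast
    simp only [clusterCard_cast hr, sum_add_distrib, ← sum_mul, h1, h2, add_zero]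
  simp only [indices, card_sigma, card_range]
  exact_mod_cast h

theorem exists_eps (r : ℕ) : ∃ ε : ℝ, ∀ x ∈ indices r, ∀ y ∈ indices r, ∀ z ∈ indices r,
    Pos r x y z → 0 < orient (pt r ε x) (pt r ε y) (pt r ε z) := by
  have h : ∀ᶠ ε : ℝ in 𝓝[>] 0, ∀ x ∈ indices r, ∀ y ∈ indices r, ∀ z ∈ indices r,
      Pos r x y z → 0 < orient (pt r ε x) (pt r ε y) (pt r ε z) := by
    rw [Filter.eventually_all_finset]
    intro x _
    rw [Filter.eventually_all_finset]
    intro y _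
    rw [Filter.eventually_all_finset]
    intro z _
    by_cases hp : Pos r x y z
    · exact hp.eventually.mono fun ε h _ => h
    · exact Filter.Eventually.of_forall fun ε h => absurd h hp
  exact h.exists

/-- A point set in general position with few `k`-edges for all `k` up to four ninths of its
size. -/
theorem exists_finset (hr : 3 ≤ r) : ∃ S : Finset Plane, #S = 9 * r ∧ GeneralPosition S ∧
    ∀ K : ℕ, K ≤ 4 * r → 2 * (#(pairsLT S K) : ℤ) ≤
      3 * (twiceTriangle K + twiceTriangle (K - 3 * r) + twiceTriangle (K - (4 * r - 1))) := by
  classical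
  obtain ⟨ε, hε⟩ := exists_eps r
  have hne : ∀ x ∈ indices r, ∀ y ∈ indices r, ∀ z ∈ indices r, x ≠ y → x ≠ z → y ≠ z →
      orient (pt r ε x) (pt r ε y) (pt r ε z) ≠ 0 := by
    intro x hx y hy z hz hxy hxz hyz
    rcases (nondegenerate hr hx hy hz hxy hxz hyz).pos_or with h | h
    · exact (hε x hx y hy z hz h).ne'
    · have := hε y hy x hx z hz h
      rw [orient_swap] at this
      linarith
  have hinj : Set.InjOn (pt r ε) (indices r) := by
    intro x hx y hy hxy
    by_contra hne'
    have h3 : 2 < #(indices r) := by rw [card_indices hr]; omega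
    -- Coinciding images would be degenerate with any third point.
    obtain ⟨z, hz, hzxy⟩ : ∃ z ∈ indices r, z ∉ ({x, y} : Finset (Σ _ : Fin 15, ℕ)) :=
      exists_mem_notMem_of_card_lt_card (lt_of_le_of_lt card_le_two h3)
    simp only [mem_insert, mem_singleton, not_or] at hzxy
    refine hne x hx y hy z hz hne' (Ne.symm hzxy.1) (Ne.symm hzxy.2) ?_
    rw [hxy]
    simp only [orient]; ring
  refine ⟨(indices r).image (pt r ε), ?_, ?_, fun K hK => ?_⟩
  · rw [card_image_of_injOn hinj, card_indices hr]
  · rw [generalPosition_iff]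
    intro p hp q hq s hs hpq hps hqs
    obtain ⟨x, hx, rfl⟩ := mem_image.1 hp
    obtain ⟨y, hy, rfl⟩ := mem_image.1 hq
    obtain ⟨z, hz, rfl⟩ := mem_image.1 hs
    exact hne x hx y hy z hz (fun e => hpq (by rw [e])) (fun e => hps (by rw [e]))
      fun e => hqs (by rw [e])
  · refine le_trans ?_ (two_mul_card_le hr hK)
    have hleft : ∀ x ∈ indices r, ∀ y ∈ indices r,
        leftIdx r x y ≤ leftCount ((indices r).image (pt r ε)) (pt r ε x) (pt r ε y) := by
      intro x hx y hy
      refine card_le_card_of_injOn (pt r ε) (fun z hz => ?_)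
        (hinj.mono fun z hz => ?_)
      · rw [mem_coe, mem_filter] at hz
        rw [mem_coe, mem_filter]
        exact ⟨mem_image_of_mem _ hz.1, hε x hx y hy z hz.1 hz.2⟩
      · rw [mem_coe, mem_filter] at hz
        exact hz.1
    have hsub : pairsLT ((indices r).image (pt r ε)) K ⊆
        {p ∈ indices r ×ˢ indices r | p.1 ≠ p.2 ∧ leftIdx r p.1 p.2 < K}.image
          (fun p => (pt r ε p.1, pt r ε p.2)) := by
      rintro ⟨p, q⟩ he
      obtain ⟨⟨hp, hq, hpq⟩, hlt⟩ := mem_pairsLT.1 he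
      obtain ⟨x, hx, rfl⟩ := mem_image.1 hp
      obtain ⟨y, hy, rfl⟩ := mem_image.1 hq
      refine mem_image.2 ⟨(x, y), mem_filter.2 ⟨mem_product.2 ⟨hx, hy⟩, ?_, ?_⟩, rfl⟩
      · exact fun e => hpq (congrArg (pt r ε) e)
      · exact (hleft x hx y hy).trans_lt hlt
    have := (card_le_card hsub).trans card_image_le
    omega

end ClusterConfig

/-! ### Matching the counts with the stated bound -/

theorem two_mul_choose_two (m : ℕ) : (2 * (m + 1).choose 2 : ℤ) = twiceTriangle m := by
  rw [twiceTriangle_of_nonneg (by positivity)]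
  have h1 := Nat.choose_two_right (m + 1)
  have h2 : 2 ∣ (m + 1) * (m + 1 - 1) := (Nat.even_mul_pred_self _).two_dvd
  have h3 : 2 * (m + 1).choose 2 = (m + 1) * m := by
    rw [Nat.add_sub_cancel] at h1 h2
    omega
  have h4 : (2 * (m + 1).choose 2 : ℤ) = (m + 1) * m := by exact_mod_cast h3
  rw [h4]; ring

theorem two_mul_choose_sub_two (K a : ℕ) :
    (2 * (K + 1 - a).choose 2 : ℤ) = twiceTriangle (K - a) := by
  rcases le_or_gt a K with h | h
  · have : K + 1 - a = K - a + 1 := by omega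
    rw [this, two_mul_choose_two, Nat.cast_sub h]
  · rw [Nat.choose_eq_zero_of_lt (by omega), twiceTriangle_of_nonpos (by omega)]
    simp

/-- One formula covers the three cases because `twiceTriangle` vanishes at nonpositive arguments.
The last term is nonzero only at `k + 1 = 4r`, where `3 * twiceTriangle 1 = 6` is twice the extra
`3`. -/
theorem two_mul_leKEdgeBound {r k : ℕ} (hk : k + 1 ≤ 4 * r) : (2 * leKEdgeBound (9 * r) k : ℤ) =
    3 * (twiceTriangle ((k + 1 : ℕ)) + twiceTriangle ((k + 1 : ℕ) - 3 * r) +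
      twiceTriangle ((k + 1 : ℕ) - (4 * r - 1))) := by
  have e1 : 9 * r / 3 = 3 * r := by omega
  have e2 : 4 * (9 * r) / 9 = 4 * r := by omega
  have c1 := two_mul_choose_two (k + 1)
  have c2 := two_mul_choose_sub_two (k + 1) (3 * r)
  push_cast at c1 c2 ⊢
  unfold leKEdgeBound
  rw [e1, e2]
  split_ifs with h1 h2
  · rw [twiceTriangle_of_nonpos (x := (k : ℤ) + 1 - 3 * r) (by omega),
      twiceTriangle_of_nonpos (x := (k : ℤ) + 1 - (4 * r - 1)) (by omega), ← c1]
    push_cast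
    ring
  · rw [twiceTriangle_of_nonpos (x := (k : ℤ) + 1 - (4 * r - 1)) (by omega), ← c1, ← c2]
    push_cast
    ring
  · have e3 : k + 1 = 4 * r := by omega
    have e4 : (k : ℤ) + 1 - (4 * r - 1) = 1 := by omega
    have e5 : twiceTriangle 1 = 2 := rfl
    rw [e4, e5, ← c1, ← c2, ← e3]
    push_cast
    ring

theorem leKEdgeBound_le_card_pairsLT {r k : ℕ} (hr : 3 ≤ r) (hk : k + 1 ≤ 4 * r)
    {P : Finset Plane} (hP : GeneralPosition P) (hcard : #P = 9 * r) :
    leKEdgeBound (9 * r) k ≤ #(pairsLT P (k + 1)) := by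
  have h := two_mul_leKEdgeBound hk
  suffices (2 * leKEdgeBound (9 * r) k : ℤ) ≤ 2 * #(pairsLT P (k + 1)) by omega
  rw [h]
  rcases hk.lt_or_eq with hk | hk
  · have h1 := le_card_pairsLT (3 * r) (k + 1) P hP (by omega) (by omega)
    have c1 := two_mul_choose_two (k + 1)
    have c2 := two_mul_choose_sub_two (k + 1) (3 * r)
    have h2 : (3 * (k + 1 + 1).choose 2 + 3 * (k + 1 + 1 - 3 * r).choose 2 : ℤ) ≤
        #(pairsLT P (k + 1)) := by exact_mod_cast h1
    rw [twiceTriangle_of_nonpos (x := ((k + 1 : ℕ) : ℤ) - (4 * r - 1)) (by push_cast; omega)]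
    push_cast at *
    linarith
  · have h1 := le_card_pairsLT_four_mul hr hP hcard
    have h2 : (51 * r ^ 2 + 15 * r + 6 : ℤ) ≤ 2 * #(pairsLT P (k + 1)) := by
      rw [hk]; exact_mod_cast h1
    refine le_trans (le_of_eq ?_) h2
    rw [hk, twiceTriangle_of_nonneg (by positivity), twiceTriangle_of_nonneg (by push_cast; omega),
      twiceTriangle_of_nonneg (by push_cast; omega)]
    push_cast
    ring

end

theorem mainTheorem8 (r : ℕ) (hr : 3 ≤ r) :
    (∃ S : Finset Plane, S.card = 9 * r ∧ GeneralPosition S ∧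
      ∀ k : ℕ, k ≤ 4 * r - 1 → leKEdgeCount S k = leKEdgeBound (9 * r) k) ∧
    (∀ k : ℕ, k ≤ 4 * r - 1 → minLeKEdgeCount (9 * r) k = leKEdgeBound (9 * r) k) := by
  have hlow : ∀ P : Finset Plane, P.card = 9 * r → GeneralPosition P → ∀ k : ℕ, k ≤ 4 * r - 1 →
      leKEdgeBound (9 * r) k ≤ leKEdgeCount P k := by
    intro P hcard hP k hk
    rw [leKEdgeCount_eq hP (by omega)]
    exact leKEdgeBound_le_card_pairsLT hr (by omega) hP hcard
  obtain ⟨S, hcard, hS, hup⟩ := ClusterConfig.exists_finset hr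
  have heq : ∀ k : ℕ, k ≤ 4 * r - 1 → leKEdgeCount S k = leKEdgeBound (9 * r) k := by
    intro k hk
    refine le_antisymm ?_ (hlow S hcard hS k hk)
    have h1 := hup (k + 1) (by omega)
    rw [← two_mul_leKEdgeBound (by omega)] at h1
    rw [leKEdgeCount_eq hS (by omega)]
    omega
  refine ⟨⟨S, hcard, hS, heq⟩, fun k hk => le_antisymm ?_ ?_⟩
  · exact Nat.sInf_le ⟨S, hcard, hS, heq k hk⟩
  -- Nonemptiness matters: the infimum of an empty set of naturals is `0`.
  · refine le_csInf ⟨_, S, hcard, hS, rfl⟩ ?_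
    rintro e ⟨P, hPcard, hP, rfl⟩
    exact hlow P hPcard hP k hk
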